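/- For $\lambda\in\mathbb{R}$ and $0<\alpha\le 1$ let $L(\lambda,\alpha,s)=\sum_{n\ge 0}e^{2\pi i\lambda n}(n+\alpha)^{-s}$ be the Lerch zeta-function (the series converges for $\Re s>0$ if $\lambda\notin\mathbb{Z}$; for $\lambda\in\mathbb{Z}$ it converges for $\Re s>1$ and $L(\lambda,\alpha,s)$ is the analytically continued Hurwitz zeta-function $\zeta(s,\alpha)$). Write $\psi_z(w)=e^{i\Re(z\overline{w})}$ and $|dz|=(2\pi)^{-1}dx\,dy$. Let $S$ be the set of all $\alpha\in(0,1]$ such that (1) the numbers $\log(n+\alpha)$, $n\ge 0$, are linearly independent over $\mathbb{Q}$, and (2) there are constants $\Omega(\alpha)>0$ and $X(\alpha)$ such that for all $X\ge X(\alpha)$, all $N$, all integers $0\le n_1,\dots,n_N\le X$ and all $\epsilon_j\in\{1,-1\}$ with $\sum_{j}\epsilon_j\log(n_j+\alpha)\ne 0$ we have $\bigl|\sum_{j=1}^N\epsilon_j\log(n_j+\alpha)\bigr|\ge X^{-\Omega(\alpha)N^2}$. For $0<\alpha\le 1$ and $\sigma>1/2$ let $\phi_n$ be the uniform probability distribution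 on the circle $|z|=(n+\alpha)^{-\sigma}$. Then $\phi_0*\phi_1*\cdots*\phi_n$ converges weakly, as $n\to\infty$, to a probability measure which has a non-negative continuous density $M_\sigma(z;\alpha)$ with respect to $|dz|$, and the Fourier transform $\tilde M_\sigma(z;\alpha)=\int_{\mathbb{C}}M_\sigma(w;\alpha)\psi_z(w)\,|dw|$ satisfies \[\tilde M_\sigma(z;\alpha)=\prod_{n=0}^\infty J_0\bigl(|z|(n+\alpha)^{-\sigma}\bigr)\qquad(z\in\mathbb{C}),\] where $J_0$ is the Bessel function of order $0$. Theorem. Let $\lambda\in\mathbb{R}$, $\alpha\in S$, $\sigma_1>0$, and $\theta,\delta>0$ with $\theta+\delta<1/4$. Then there exists $T_0=T_0(\alpha,\theta,\delta)>0$ such that for all $T\ge T_0$, all $\sigma\in[1/2+(\log T)^{-\theta},\sigma_1]$ and all $z=x+iy$ with $|x|\le(\log T)^\delta$ and $|y|\le(\log T)^\delta$, \[\frac1T\int_0^T\psi_z\bigl(L(\lambda,\alpha,\sigma+it)\bigr)\,dt=\tilde M_\sigma(z;\alpha)+O\Bigl(\exp\bigl(-\tfrac12(\log T)^{\theta/2}\bigr)\Bigr),\]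 where the implied constant depends only on $\lambda$ and $\sigma_1$. -/

import Mathlib

open MeasureTheory Filter Topology

namespace LerchDensity

/-- The admissible set of parameters `α ∈ (0, 1]`: the numbers `log (n + α)` are linearly
independent over `ℚ`, and their nonzero signed sums of length `N` with `n ≤ X` are at least
`X ^ (-Ω N²)` in absolute value, for all `X` from some point on (uniformly in `N`). -/
structure Admissible (α : ℝ) : Prop where
  pos : 0 < α
  le_one : α ≤ 1
  independent : LinearIndependent ℚ (fun n : ℕ => Real.log ((n : ℝ) + α))
  spacing : ∃ Ω : ℝ, 0 < Ω ∧ ∃ X₀ : ℝ, ∀ X : ℝ, X₀ ≤ X →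
    ∀ (N : ℕ) (n : Fin N → ℕ) (ε : Fin N → ℝ),
      (∀ j, (n j : ℝ) ≤ X) → (∀ j, ε j = 1 ∨ ε j = -1) →
      ∑ j, ε j * Real.log ((n j : ℝ) + α) ≠ 0 →
      X ^ (-(Ω * (N : ℝ) ^ 2)) ≤ |∑ j, ε j * Real.log ((n j : ℝ) + α)|

open Classical in
/-- The Lerch zeta-function `L(lam, α, s)` for `0 < α ≤ 1`. If `lam` is an integer, it is the
(analytically continued) Hurwitz zeta-function `ζ(s, α)`. If `lam` is not an integer, it is the sum
`∑_{n ≥ 0} e^{2 π i lam n} (n + α)^{-s}`, the limit of the partial sums, which exists in the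
half-plane `Re s > 0`; the function is only used there. -/
noncomputable def lerchZeta (lam α : ℝ) (s : ℂ) : ℂ :=
  if ∃ k : ℤ, (k : ℝ) = lam then HurwitzZeta.hurwitzZeta (α : UnitAddCircle) s
  else limUnder atTop (fun N : ℕ => ∑ n ∈ Finset.range N,
    Complex.exp (2 * Real.pi * Complex.I * lam * n) / ((n : ℂ) + α) ^ s)

/-- The additive character `ψ_z(w) = exp(i Re(z w̄))`. -/
noncomputable def psi (z w : ℂ) : ℂ :=
  Complex.exp (Complex.I * ((z * (starRingEnd ℂ) w).re : ℂ))

/-- The Bessel function of the first kind of order zero. -/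
noncomputable def besselJ0 (x : ℝ) : ℝ :=
  ∑' k : ℕ, (-1 : ℝ) ^ k / ((k.factorial : ℝ) ^ 2) * (x / 2) ^ (2 * k)

/-- The equidistribution on the circle `|z| = r`: the law of `r e^{2 π i u}` with `u` uniform in
`(0, 1]`. -/
noncomputable def circleEquidistribution (r : ℝ) : ProbabilityMeasure ℂ :=
  ⟨(volume.restrict (Set.Ioc (0 : ℝ) 1)).map
      (fun u : ℝ => (r : ℂ) * Complex.exp (2 * Real.pi * Complex.I * u)), by
    have : IsProbabilityMeasure (volume.restrict (Set.Ioc (0 : ℝ) 1)) := ⟨by simp⟩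
    exact Measure.isProbabilityMeasure_map (by fun_prop)⟩

/-- The convolution `φ₀ ∗ φ₁ ∗ ⋯ ∗ φ_n`, where `φ_n` is the equidistribution on the circle
`|z| = (n + α)^{-σ}`. -/
noncomputable def partialConvolution (σ α : ℝ) : ℕ → ProbabilityMeasure ℂ
  | 0 => circleEquidistribution (α ^ (-σ))
  | n + 1 =>
    ⟨(partialConvolution σ α n : Measure ℂ) ∗
      (circleEquidistribution ((((n + 1 : ℕ) : ℝ) + α) ^ (-σ)) : Measure ℂ), inferInstance⟩

/-- The measure `|dz| = (2 π)⁻¹ dx dy` on the complex plane. -/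
noncomputable def planeMeasure : Measure ℂ :=
  ENNReal.ofReal (2 * Real.pi)⁻¹ • (volume : Measure ℂ)

/-- `M` is a nonnegative continuous density with respect to `|dz|` of the infinite convolution
`φ₀ ∗ φ₁ ∗ ⋯`, the weak limit of the partial convolutions. There is at most one such `M`. -/
def IsLimitDensity (σ α : ℝ) (M : ℂ → ℝ) : Prop :=
  Continuous M ∧ (∀ z, 0 ≤ M z) ∧
    ∃ φ : ProbabilityMeasure ℂ, Tendsto (partialConvolution σ α) atTop (𝓝 φ) ∧
      (φ : Measure ℂ) = planeMeasure.withDensity (fun z => ENNReal.ofReal (M z))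

open Classical in
/-- The density function `M_σ(z; α)`. -/
noncomputable def densityM (σ α : ℝ) : ℂ → ℝ :=
  if h : ∃ M : ℂ → ℝ, IsLimitDensity σ α M then h.choose else 0

/-- The Fourier transform `M̃_σ(z; α) = ∫ M_σ(w; α) ψ_z(w) |dw|`. -/
noncomputable def fourierM (σ α : ℝ) (z : ℂ) : ℂ :=
  ∫ w, (densityM σ α w : ℂ) * psi z w ∂planeMeasure

end LerchDensity

/-!
For independent `u_n`, uniformly distributed in `(0, 1]`, put `X = ∑_n (n + α)^{-σ} e^{2π i u_n}`.
Its characteristic function is the product of the `J₀(|z| (n + α)^{-σ})`, which decays fast enough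
for Fourier inversion to give a continuous density.

On the vertical line, `L(λ, α, σ + it)` is approximated in mean square by its first
`N ≈ exp((log T)^{3θ/2})` terms, a trigonometric sum in `t` with the frequencies `log (n + α)`.
These are linearly independent over `ℚ`, so each moment of this sum over `[0, T]` agrees with that
of the random model up to the contribution of the nonzero frequencies `∑ ± log (n_j + α)`, which the
spacing condition bounds from below. Comparing the Taylor expansions of the two characteristic
functions up to degree `2K`, and bounding the moment of degree `2K` of the random model by
Chernoff's method, shows that the mean value of `ψ_z` is close to the product of the first `N`
Bessel factors.
-/

namespace LerchDensity

open scoped Real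
open Complex (I)

/-! ### Averages over a circle and the Bessel function -/

section CircleAverage

theorem integral_cexp_two_pi_int (k : ℤ) :
    ∫ u in (0 : ℝ)..1, Complex.exp (2 * π * I * k * u) = if k = 0 then 1 else 0 := by
  split_ifs with h
  · simp [h]
  · have hk : 2 * π * I * k ≠ 0 := by simp [Real.pi_ne_zero, h]
    have hperiod : Complex.exp (2 * π * I * k * (1 : ℝ)) = 1 :=
      Complex.exp_eq_one_iff.2 ⟨k, by push_cast; ring⟩
    rw [integral_exp_mul_complex hk, hperiod]
    simp

theorem conj_cexp_two_pi (u : ℝ) :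
    starRingEnd ℂ (Complex.exp (2 * π * I * u)) = Complex.exp (-(2 * π * I * u)) := by
  rw [← Complex.exp_conj]
  simp only [map_mul, Complex.conj_ofReal, Complex.conj_I, Complex.conj_ofNat, mul_neg, neg_mul]

theorem norm_cexp_two_pi (u : ℝ) : ‖Complex.exp (2 * π * I * u)‖ = 1 := by
  rw [show (2 * π * I * u : ℂ) = (2 * π * u : ℝ) * I by push_cast; ring,
    Complex.norm_exp_ofReal_mul_I]

theorem hasSum_cexp_add (z w : ℂ) :
    HasSum (fun p : ℕ × ℕ => z ^ p.1 / (p.1.factorial : ℂ) * (w ^ p.2 / (p.2.factorial : ℂ)))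
      (Complex.exp (z + w)) := by
  have hexp (z : ℂ) : HasSum (fun n : ℕ => z ^ n / (n.factorial : ℂ)) (Complex.exp z) := by
    rw [Complex.exp_eq_exp_ℂ]
    exact NormedSpace.expSeries_div_hasSum_exp z
  have hnorm (z : ℂ) : Summable fun n : ℕ => ‖z ^ n / (n.factorial : ℂ)‖ := by
    simpa using Real.summable_pow_div_factorial ‖z‖
  have hsummable := summable_mul_of_summable_norm (hnorm z) (hnorm w)
  rw [Complex.exp_add]
  convert (hexp z).mul (hexp w) hsummable

theorem integral_cexp_pow_mul_pow (a b : ℂ) (i j : ℕ) :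
    ∫ u in (0 : ℝ)..1, (a * Complex.exp (2 * π * I * u)) ^ i / (i.factorial : ℂ) *
        ((b * Complex.exp (-(2 * π * I * u))) ^ j / (j.factorial : ℂ))
      = if i = j then a ^ i / (i.factorial : ℂ) * (b ^ j / (j.factorial : ℂ)) else 0 := by
  have hinteg (u : ℝ) : (a * Complex.exp (2 * π * I * u)) ^ i / (i.factorial : ℂ) *
        ((b * Complex.exp (-(2 * π * I * u))) ^ j / (j.factorial : ℂ))
      = a ^ i / (i.factorial : ℂ) * (b ^ j / (j.factorial : ℂ)) *
        Complex.exp (2 * π * I * ((i - j : ℤ) : ℂ) * u) := by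
    have hmul : Complex.exp (2 * π * I * ((i - j : ℤ) : ℂ) * u)
        = Complex.exp (i * (2 * π * I * u)) * Complex.exp (j * -(2 * π * I * u)) := by
      rw [← Complex.exp_add]
      congr 1
      push_cast
      ring
    simp only [hmul, mul_pow, ← Complex.exp_nat_mul]
    ring
  simp only [hinteg, intervalIntegral.integral_const_mul, integral_cexp_two_pi_int, sub_eq_zero,
    Nat.cast_inj, mul_ite, mul_one, mul_zero]

theorem hasSum_integral_cexp_circle (a b : ℂ) :
    HasSum (fun j : ℕ => (a * b) ^ j / ((j.factorial : ℂ) ^ 2))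
      (∫ u in (0 : ℝ)..1,
        Complex.exp (a * Complex.exp (2 * π * I * u) + b * Complex.exp (-(2 * π * I * u)))) := by
  set F : ℕ × ℕ → ℝ → ℂ := fun p u =>
    (a * Complex.exp (2 * π * I * u)) ^ p.1 / (p.1.factorial : ℂ) *
      ((b * Complex.exp (-(2 * π * I * u))) ^ p.2 / (p.2.factorial : ℂ)) with hF
  have hnorm (p : ℕ × ℕ) (u : ℝ) :
      ‖F p u‖ = ‖a‖ ^ p.1 / p.1.factorial * (‖b‖ ^ p.2 / p.2.factorial) := by
    simp [hF, Complex.exp_neg, norm_cexp_two_pi]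
  have hinteg (p : ℕ × ℕ) : Integrable (F p) (volume.restrict (Set.Ioc (0 : ℝ) 1)) :=
    (intervalIntegrable_iff_integrableOn_Ioc_of_le zero_le_one).1
      (Continuous.intervalIntegrable (by fun_prop) _ _)
  have hsummable : Summable fun p => ∫ u in Set.Ioc (0 : ℝ) 1, ‖F p u‖ := by
    simp_rw [hnorm]
    simpa using (Real.summable_pow_div_factorial ‖a‖).mul_of_nonneg
      (Real.summable_pow_div_factorial ‖b‖) (fun _ => by positivity) (fun _ => by positivity)
  have hdouble := hasSum_integral_of_summable_integral_norm hinteg hsummable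
  simp_rw [hF, (hasSum_cexp_add _ _).tsum_eq,
    ← intervalIntegral.integral_of_le (zero_le_one (α := ℝ)), integral_cexp_pow_mul_pow] at hdouble
  have hdiag : Function.Injective (fun j : ℕ => (j, j)) := fun i j h => (Prod.mk.inj h).1
  rw [← hdiag.hasSum_iff] at hdouble
  · simpa [Function.comp_def, mul_pow, div_mul_div_comm, sq] using hdouble
  · rintro ⟨i, j⟩ hij
    have hne : i ≠ j := fun h => hij ⟨i, by simp [h]⟩
    simp [hne]

theorem psi_mul_circle (z c : ℂ) (u : ℝ) :
    psi z (c * Complex.exp (2 * π * I * u)) =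
      Complex.exp (I * (starRingEnd ℂ z * c) / 2 * Complex.exp (2 * π * I * u)
        + I * (z * starRingEnd ℂ c) / 2 * Complex.exp (-(2 * π * I * u))) := by
  rw [psi, Complex.re_eq_add_conj]
  simp only [map_mul, Complex.conj_conj]
  rw [conj_cexp_two_pi]
  ring_nf

theorem integral_psi_circle (z c : ℂ) :
    ∫ u in (0 : ℝ)..1, psi z (c * Complex.exp (2 * π * I * u))
      = (besselJ0 (‖z‖ * ‖c‖) : ℂ) := by
  have hprod : I * (starRingEnd ℂ z * c) / 2 * (I * (z * starRingEnd ℂ c) / 2)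
      = -1 * ((‖z‖ * ‖c‖ / 2 : ℝ) : ℂ) ^ 2 := by
    have hz := Complex.mul_conj' z
    have hc := Complex.mul_conj' c
    push_cast
    linear_combination (1 / 4 : ℂ) * (z * starRingEnd ℂ z * (c * starRingEnd ℂ c)) * Complex.I_sq
      - (1 / 4 : ℂ) * (c * starRingEnd ℂ c) * hz - (1 / 4 : ℂ) * ‖z‖ ^ 2 * hc
  simp_rw [psi_mul_circle]
  rw [← (hasSum_integral_cexp_circle _ _).tsum_eq, besselJ0, Complex.ofReal_tsum]
  refine tsum_congr fun k => ?_
  rw [hprod, mul_pow, ← pow_mul]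
  push_cast
  ring

theorem hasSum_integral_exp_re_circle (w : ℂ) :
    HasSum (fun j : ℕ => (‖w‖ ^ 2 / 4) ^ j / (j.factorial : ℝ) ^ 2)
      (∫ u in (0 : ℝ)..1, Real.exp (w * Complex.exp (2 * π * I * u)).re) := by
  have hre (u : ℝ) : Complex.exp (w / 2 * Complex.exp (2 * π * I * u)
        + starRingEnd ℂ w / 2 * Complex.exp (-(2 * π * I * u)))
      = (Real.exp (w * Complex.exp (2 * π * I * u)).re : ℂ) := by
    rw [Complex.ofReal_exp, Complex.re_eq_add_conj, map_mul, conj_cexp_two_pi]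
    ring_nf
  have hprod : w / 2 * (starRingEnd ℂ w / 2) = ((‖w‖ ^ 2 / 4 : ℝ) : ℂ) := by
    push_cast
    linear_combination Complex.mul_conj' w / 4
  have hsum := hasSum_integral_cexp_circle (w / 2) (starRingEnd ℂ w / 2)
  simp_rw [hre, hprod, intervalIntegral.integral_ofReal] at hsum
  exact_mod_cast hsum

theorem integral_exp_re_circle_le (w : ℂ) :
    ∫ u in (0 : ℝ)..1, Real.exp (w * Complex.exp (2 * π * I * u)).re
      ≤ Real.exp (‖w‖ ^ 2 / 4) := by
  have hexp : HasSum (fun j : ℕ => (‖w‖ ^ 2 / 4) ^ j / (j.factorial : ℝ))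
      (Real.exp (‖w‖ ^ 2 / 4)) := by
    simpa only [Real.exp_eq_exp_ℝ] using NormedSpace.expSeries_div_hasSum_exp (‖w‖ ^ 2 / 4)
  refine hasSum_le (fun j => ?_) (hasSum_integral_exp_re_circle w) hexp
  have hfact : (1 : ℝ) ≤ j.factorial := by exact_mod_cast j.factorial_pos
  gcongr
  exact le_self_pow₀ hfact two_ne_zero

end CircleAverage

section Bessel

theorem besselJ0_abs (x : ℝ) : besselJ0 |x| = besselJ0 x := by
  simp only [besselJ0, pow_mul, div_pow, sq_abs]

theorem besselJ0_eq_integral_cos (x : ℝ) :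
    besselJ0 x = ∫ u in (0 : ℝ)..1, Real.cos (x * Real.cos (2 * π * u)) := by
  have hpsi (u : ℝ) : psi x (1 * Complex.exp (2 * π * I * u))
      = Complex.exp ((x * Real.cos (2 * π * u) : ℝ) * I) := by
    have hre : (Complex.exp (2 * π * I * u)).re = Real.cos (2 * π * u) := by
      rw [show (2 * π * I * u : ℂ) = (2 * π * u : ℝ) * I by push_cast; ring,
        Complex.exp_ofReal_mul_I_re]
    rw [psi, one_mul, Complex.re_ofReal_mul, Complex.conj_re, hre, mul_comm]
  have hJ := integral_psi_circle x 1
  simp_rw [hpsi, norm_one, mul_one, Complex.norm_real, Real.norm_eq_abs, besselJ0_abs] at hJ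
  calc besselJ0 x = Complex.reCLM (∫ u in (0 : ℝ)..1,
        Complex.exp ((x * Real.cos (2 * π * u) : ℝ) * I)) := by rw [hJ]; simp
    _ = ∫ u in (0 : ℝ)..1, Complex.reCLM (Complex.exp ((x * Real.cos (2 * π * u) : ℝ) * I)) :=
        (ContinuousLinearMap.intervalIntegral_comp_comm _
          (Continuous.intervalIntegrable (by fun_prop) _ _)).symm
    _ = _ := by simp only [Complex.reCLM_apply, Complex.exp_ofReal_mul_I_re]

theorem abs_besselJ0_le_one (x : ℝ) : |besselJ0 x| ≤ 1 := by
  rw [besselJ0_eq_integral_cos]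
  simpa using intervalIntegral.norm_integral_le_of_norm_le_const (a := 0) (b := 1)
    (f := fun u => Real.cos (x * Real.cos (2 * π * u))) fun _ _ => Real.abs_cos_le_one _

theorem abs_besselJ0_sub_one_le (x : ℝ) : |besselJ0 x - 1| ≤ x ^ 2 / 2 := by
  have hcos (u : ℝ) : ‖Real.cos (x * Real.cos (2 * π * u)) - 1‖ ≤ x ^ 2 / 2 := by
    have hsq : (x * Real.cos (2 * π * u)) ^ 2 ≤ x ^ 2 := by
      rw [mul_pow]
      exact mul_le_of_le_one_right (sq_nonneg _) (Real.cos_sq_le_one _)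
    rw [Real.norm_eq_abs, abs_le]
    constructor <;>
      linarith [Real.one_sub_sq_div_two_le_cos (x := x * Real.cos (2 * π * u)),
        Real.cos_le_one (x * Real.cos (2 * π * u)), sq_nonneg x]
  have hdiff : besselJ0 x - 1
      = ∫ u in (0 : ℝ)..1, (Real.cos (x * Real.cos (2 * π * u)) - 1) := by
    rw [intervalIntegral.integral_sub (Continuous.intervalIntegrable (by fun_prop) _ _) (by simp),
      besselJ0_eq_integral_cos]
    simp
  rw [hdiff]
  simpa using intervalIntegral.norm_integral_le_of_norm_le_const (a := 0) (b := 1)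
    fun u _ => hcos u

theorem besselJ0_eq_integral_zero_pi_div_two (x : ℝ) :
    besselJ0 x = 2 / π * ∫ u in 0..π / 2, Real.cos (x * Real.cos u) := by
  set f : ℝ → ℝ := fun u => Real.cos (x * Real.cos u) with hf
  have hinteg (a b : ℝ) : IntervalIntegrable f volume a b :=
    Continuous.intervalIntegrable (by fun_prop) _ _
  have hperiodic : Function.Periodic f π := fun u => by simp [hf]
  have hreflect : ∫ u in π / 2..π, f u = ∫ u in 0..π / 2, f u := by
    calc ∫ u in π / 2..π, f u = ∫ u in π - π / 2..π - 0, f u := by congr 1 <;> ring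
      _ = ∫ u in 0..π / 2, f (π - u) := (intervalIntegral.integral_comp_sub_left f π).symm
      _ = ∫ u in 0..π / 2, f u := by simp [hf, Real.cos_pi_sub]
  have hhalf : ∫ u in 0..π, f u = 2 * ∫ u in 0..π / 2, f u := by
    rw [← intervalIntegral.integral_add_adjacent_intervals (hinteg 0 (π / 2)) (hinteg _ _),
      hreflect]
    ring
  have hfull : ∫ u in 0..2 * π, f u = 2 * ∫ u in 0..π, f u := by
    have hshift := hperiodic.intervalIntegral_add_eq π 0
    rw [← intervalIntegral.integral_add_adjacent_intervals (hinteg 0 π) (hinteg _ _), two_mul π,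
      hshift, zero_add]
    ring
  calc besselJ0 x = ∫ u in (0 : ℝ)..1, f (2 * π * u) := besselJ0_eq_integral_cos x
    _ = (2 * π)⁻¹ * ∫ u in 0..2 * π, f u := by
        rw [intervalIntegral.integral_comp_mul_left f Real.two_pi_pos.ne', smul_eq_mul, mul_zero,
          mul_one]
    _ = 2 / π * ∫ u in 0..π / 2, f u := by
        rw [hfull, hhalf]
        field_simp

theorem sin_ne_zero_of_mem_uIcc {ε u : ℝ} (hε : 0 < ε) (hε' : ε ≤ π / 2)
    (hu : u ∈ Set.uIcc ε (π / 2)) : Real.sin u ≠ 0 := by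
  rw [Set.uIcc_of_le hε'] at hu
  exact (Real.sin_pos_of_pos_of_lt_pi (by linarith [hu.1]) (by linarith [hu.2, Real.pi_pos])).ne'

/-- Integration by parts, writing `cos (x cos u)` as `-(x sin u)⁻¹` times the derivative of
`sin (x cos u)`; the boundary term at `π / 2` vanishes. -/
theorem integral_cos_mul_cos_eq {x ε : ℝ} (hx : x ≠ 0) (hε : 0 < ε) (hε' : ε ≤ π / 2) :
    ∫ u in ε..π / 2, Real.cos (x * Real.cos u)
      = x⁻¹ * ((Real.sin ε)⁻¹ * Real.sin (x * Real.cos ε)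
        - ∫ u in ε..π / 2, Real.cos u / Real.sin u ^ 2 * Real.sin (x * Real.cos u)) := by
  have hsin : ∀ u ∈ Set.uIcc ε (π / 2), Real.sin u ≠ 0 :=
    fun u => sin_ne_zero_of_mem_uIcc hε hε'
  have hinv : ∀ u ∈ Set.uIcc ε (π / 2),
      HasDerivAt (fun u => (Real.sin u)⁻¹) (-Real.cos u / Real.sin u ^ 2) u :=
    fun u hu => (Real.hasDerivAt_sin u).fun_inv (hsin u hu)
  have houter : ∀ u ∈ Set.uIcc ε (π / 2), HasDerivAt (fun u => Real.sin (x * Real.cos u))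
      (Real.cos (x * Real.cos u) * (x * -Real.sin u)) u :=
    fun u _ => ((Real.hasDerivAt_cos u).const_mul x).sin
  have hcont : ContinuousOn (fun u => -Real.cos u / Real.sin u ^ 2) (Set.uIcc ε (π / 2)) :=
    ContinuousOn.div (by fun_prop) (by fun_prop) fun u hu => pow_ne_zero 2 (hsin u hu)
  have hparts := intervalIntegral.integral_mul_deriv_eq_deriv_mul hinv houter
    hcont.intervalIntegrable (Continuous.intervalIntegrable (by fun_prop) _ _)
  have hleft : ∫ u in ε..π / 2, (Real.sin u)⁻¹ * (Real.cos (x * Real.cos u) * (x * -Real.sin u))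
      = -x * ∫ u in ε..π / 2, Real.cos (x * Real.cos u) := by
    rw [← intervalIntegral.integral_const_mul]
    refine intervalIntegral.integral_congr fun u hu => ?_
    have := hsin u hu
    field_simp
  have hright : ∫ u in ε..π / 2, -Real.cos u / Real.sin u ^ 2 * Real.sin (x * Real.cos u)
      = -∫ u in ε..π / 2, Real.cos u / Real.sin u ^ 2 * Real.sin (x * Real.cos u) := by
    simp only [neg_div, neg_mul, intervalIntegral.integral_neg]
  rw [hleft, hright] at hparts
  simp only [Real.cos_pi_div_two, mul_zero, Real.sin_zero, zero_sub] at hparts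
  rw [eq_inv_mul_iff_mul_eq₀ hx]
  linear_combination -hparts

theorem integral_cos_div_sin_sq {ε : ℝ} (hε : 0 < ε) (hε' : ε ≤ π / 2) :
    IntervalIntegrable (fun u => Real.cos u / Real.sin u ^ 2) volume ε (π / 2) ∧
      ∫ u in ε..π / 2, Real.cos u / Real.sin u ^ 2 = (Real.sin ε)⁻¹ - 1 := by
  have hsin : ∀ u ∈ Set.uIcc ε (π / 2), Real.sin u ≠ 0 :=
    fun u => sin_ne_zero_of_mem_uIcc hε hε'
  have hinteg : IntervalIntegrable (fun u => Real.cos u / Real.sin u ^ 2) volume ε (π / 2) :=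
    (ContinuousOn.div (by fun_prop) (by fun_prop)
      fun u hu => pow_ne_zero 2 (hsin u hu)).intervalIntegrable
  have hderiv : ∀ u ∈ Set.uIcc ε (π / 2),
      HasDerivAt (fun u => -(Real.sin u)⁻¹) (Real.cos u / Real.sin u ^ 2) u := fun u hu => by
    simpa [neg_div] using ((Real.hasDerivAt_sin u).fun_inv (hsin u hu)).fun_neg
  refine ⟨hinteg, ?_⟩
  rw [intervalIntegral.integral_eq_sub_of_hasDerivAt hderiv hinteg, Real.sin_pi_div_two]
  ring

theorem abs_integral_cos_mul_cos_le {x ε : ℝ} (hx : 0 < x) (hε : 0 < ε) (hε' : ε ≤ π / 2) :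
    |∫ u in ε..π / 2, Real.cos (x * Real.cos u)| ≤ π / (x * ε) := by
  have hsin : 2 / π * ε ≤ Real.sin ε := Real.mul_le_sin hε.le hε'
  have hsin_pos : 0 < Real.sin ε := lt_of_lt_of_le (by positivity) hsin
  obtain ⟨hinteg, hval⟩ := integral_cos_div_sin_sq hε hε'
  have hremainder :
      |∫ u in ε..π / 2, Real.cos u / Real.sin u ^ 2 * Real.sin (x * Real.cos u)|
        ≤ (Real.sin ε)⁻¹ - 1 := by
    rw [← hval, ← Real.norm_eq_abs]
    refine intervalIntegral.norm_integral_le_of_norm_le hε' (ae_of_all _ fun u hu => ?_) hinteg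
    have hcos : 0 ≤ Real.cos u :=
      Real.cos_nonneg_of_neg_pi_div_two_le_of_le (by linarith [hu.1, Real.pi_pos]) hu.2
    rw [norm_mul, Real.norm_of_nonneg (by positivity)]
    exact mul_le_of_le_one_right (by positivity) (Real.abs_sin_le_one _)
  have hboundary : |(Real.sin ε)⁻¹ * Real.sin (x * Real.cos ε)| ≤ (Real.sin ε)⁻¹ := by
    rw [abs_mul, abs_of_pos (inv_pos.2 hsin_pos)]
    exact mul_le_of_le_one_right (inv_pos.2 hsin_pos).le (Real.abs_sin_le_one _)
  rw [integral_cos_mul_cos_eq hx.ne' hε hε', abs_mul, abs_of_pos (inv_pos.2 hx)]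
  calc x⁻¹ * |_ - _| ≤ x⁻¹ * ((Real.sin ε)⁻¹ + ((Real.sin ε)⁻¹ - 1)) := by
        gcongr
        exact (abs_sub _ _).trans (add_le_add hboundary hremainder)
    _ ≤ x⁻¹ * (2 * (2 / π * ε)⁻¹) := by
        gcongr
        linarith [inv_anti₀ (by positivity) hsin]
    _ = π / (x * ε) := by field_simp

theorem abs_besselJ0_le_rpow {x : ℝ} (hx : 0 < x) : |besselJ0 x| ≤ 3 * x ^ (-(1 / 2) : ℝ) := by
  set ε : ℝ := x ^ (-(1 / 2) : ℝ) with hε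
  have hε0 : 0 < ε := by positivity
  rcases lt_or_ge x 1 with hx1 | hx1
  · have : 1 ≤ ε := Real.one_le_rpow_of_pos_of_le_one_of_nonpos hx hx1.le (by norm_num)
    linarith [abs_besselJ0_le_one x]
  have hε1 : ε ≤ 1 := Real.rpow_le_one_of_one_le_of_nonpos hx1 (by norm_num)
  have hε_le : ε ≤ π / 2 := by linarith [Real.two_le_pi]
  have hxε : x * ε * ε = 1 := by
    rw [mul_assoc, hε, ← Real.rpow_add hx]
    norm_num [Real.rpow_neg_one, hx.ne']
  have hinteg (a b : ℝ) :
      IntervalIntegrable (fun u => Real.cos (x * Real.cos u)) volume a b :=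
    Continuous.intervalIntegrable (by fun_prop) _ _
  have hshort : |∫ u in 0..ε, Real.cos (x * Real.cos u)| ≤ ε := by
    simpa [abs_of_pos hε0] using intervalIntegral.norm_integral_le_of_norm_le_const (a := 0)
      (b := ε) (f := fun u => Real.cos (x * Real.cos u)) fun _ _ => Real.abs_cos_le_one _
  have hlong : |∫ u in ε..π / 2, Real.cos (x * Real.cos u)| ≤ π * ε := by
    refine (abs_integral_cos_mul_cos_le hx hε0 hε_le).trans_eq ?_
    rw [div_eq_iff (by positivity)]
    linear_combination -π * hxε
  rw [besselJ0_eq_integral_zero_pi_div_two, abs_mul, abs_of_pos (by positivity : 0 < 2 / π),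
    ← intervalIntegral.integral_add_adjacent_intervals (hinteg 0 ε) (hinteg _ _)]
  calc 2 / π * |_ + _| ≤ 2 / π * (ε + π * ε) := by
        gcongr
        exact (abs_add_le _ _).trans (add_le_add hshort hlong)
    _ = 2 * ε / π + 2 * ε := by field_simp
    _ ≤ 2 * ε / 2 + 2 * ε := by gcongr; exact Real.two_le_pi
    _ = 3 * ε := by ring

end Bessel

/-! ### Densities of measures with integrable characteristic function -/

section FourierInversion

open scoped FourierTransform ContDiff Manifold ComplexOrder SchwartzMap

variable {V : Type*} [NormedAddCommGroup V] [InnerProductSpace ℝ V] [FiniteDimensional ℝ V]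
  [MeasurableSpace V] [BorelSpace V]

/-- The inverse Fourier transform of the characteristic function of a measure. Mathlib's Fourier
transform is normalised by the character `e^{2πi⟨x, ξ⟩}` and `charFun` by `e^{i⟨x, ξ⟩}`, hence the
dilation. -/
noncomputable def charDensity (μ : Measure V) : V → ℂ :=
  𝓕⁻ (fun ξ : V => charFun μ ((-(2 * π) : ℝ) • ξ))

theorem integrable_charFun_dilation {μ : Measure V} (h : Integrable (charFun μ)) :
    Integrable (fun ξ : V => charFun μ ((-(2 * π) : ℝ) • ξ)) :=
  h.comp_smul (by simp [Real.pi_ne_zero])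

omit [FiniteDimensional ℝ V] [MeasurableSpace V] [BorelSpace V] in
theorem continuous_innerₗ : Continuous fun p : V × V => innerₗ V p.1 p.2 := by
  simpa only [innerₗ_apply_apply] using continuous_inner

omit [FiniteDimensional ℝ V] [MeasurableSpace V] [BorelSpace V] in
theorem continuous_neg_innerₗ : Continuous fun p : V × V => (-innerₗ V) p.1 p.2 := by
  have hneg : Continuous fun p : V × V => -inner ℝ p.1 p.2 := by fun_prop
  simpa only [LinearMap.neg_apply, innerₗ_apply_apply] using hneg

theorem continuous_charDensity {μ : Measure V} (h : Integrable (charFun μ)) :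
    Continuous (charDensity μ) :=
  VectorFourier.fourierIntegral_continuous Real.continuous_fourierChar
    (L := -innerₗ V) continuous_neg_innerₗ (integrable_charFun_dilation h)

theorem integral_fourierInv_mul_eq {f g : V → ℂ} (hf : Integrable f) (hg : Integrable g) :
    ∫ ξ, 𝓕⁻ f ξ * g ξ = ∫ x, f x * 𝓕⁻ g x := by
  have hflip : (-innerₗ V).flip = -innerₗ V := by
    ext x y
    simp [real_inner_comm]
  have hswap := VectorFourier.integral_fourierIntegral_smul_eq_flip (μ := volume) (ν := volume)
    (L := -innerₗ V) Real.continuous_fourierChar continuous_neg_innerₗ hf hg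
  rwa [hflip] at hswap

variable {μ : Measure V} [IsFiniteMeasure μ]

theorem integral_schwartz_eq_integral_fourierInv_mul (S : 𝓢(V, ℂ)) :
    ∫ x, S x ∂μ = ∫ ξ, 𝓕⁻ (S : V → ℂ) ξ * charFun μ ((-(2 * π) : ℝ) • ξ) := by
  have hchar : (fun ξ : V => charFun μ ((-(2 * π) : ℝ) • ξ))
      = VectorFourier.fourierIntegral 𝐞 μ (innerₗ V) (1 : V → ℂ) := by
    funext ξ
    rw [charFun_eq_fourierIntegral', smul_smul, neg_mul_neg,
      inv_mul_cancel₀ Real.two_pi_pos.ne', one_smul]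
  have hinversion : VectorFourier.fourierIntegral 𝐞 volume (innerₗ V) (𝓕⁻ S : 𝓢(V, ℂ)) = S := by
    have h : 𝓕 (𝓕⁻ S) = S := FourierTransform.fourier_fourierInv_eq S
    nth_rewrite 2 [← h]
    rw [SchwartzMap.fourier_coe]
    rfl
  have hswap := VectorFourier.integral_fourierIntegral_smul_eq_flip (μ := μ) (ν := volume)
    (L := innerₗ V) (f := (1 : V → ℂ)) Real.continuous_fourierChar continuous_innerₗ
    (integrable_const 1) (SchwartzMap.integrable (𝓕⁻ S : 𝓢(V, ℂ)))
  rw [flip_innerₗ, hinversion, ← hchar] at hswap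
  simp only [Pi.one_apply, one_mul, smul_eq_mul] at hswap
  rw [← hswap, ← SchwartzMap.fourierInv_coe]
  simp only [mul_comm]

theorem integral_eq_integral_mul_charDensity (h : Integrable (charFun μ)) {f : V → ℂ}
    (hf : HasCompactSupport f) (hf' : ContDiff ℝ ∞ f) :
    ∫ x, f x ∂μ = ∫ x, f x * charDensity μ x :=
  (integral_schwartz_eq_integral_fourierInv_mul (hf.toSchwartzMap hf')).trans
    (integral_fourierInv_mul_eq (SchwartzMap.integrable (hf.toSchwartzMap hf'))
      (integrable_charFun_dilation h))

/-- Smooth bumps shrinking to `x` have nonnegative `μ`-means, which converge to the density. -/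
theorem charDensity_nonneg (h : Integrable (charFun μ)) (x : V) : 0 ≤ charDensity μ x := by
  let bump : ℕ → ContDiffBump (0 : V) := fun n =>
    ⟨1 / ((n : ℝ) + 1) / 2, 1 / ((n : ℝ) + 1), by positivity, half_lt_self (by positivity)⟩
  have hlim := ContDiffBump.convolution_tendsto_right_of_continuous (φ := bump) (l := atTop)
    (μ := (volume : Measure V)) tendsto_one_div_add_atTop_nhds_zero_nat
    (continuous_charDensity h) x
  refine isClosed_Ici.mem_of_tendsto hlim (Eventually.of_forall fun n => ?_)
  set p : V → ℝ := fun t => (bump n).normed volume (x - t) with hp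
  have hp_supp : HasCompactSupport p :=
    ((bump n).hasCompactSupport_normed (μ := volume)).comp_homeomorph (Homeomorph.subLeft x)
  have hp_smooth : ContDiff ℝ ∞ p := (bump n).contDiff_normed.comp (contDiff_const.sub contDiff_id)
  have hmean := integral_eq_integral_mul_charDensity h (f := fun t => (p t : ℂ))
    (hp_supp.comp_left (g := fun r : ℝ => (r : ℂ)) Complex.ofReal_zero)
    (Complex.ofRealCLM.contDiff.comp hp_smooth)
  have hmean_nonneg : (0 : ℂ) ≤ ∫ t, (p t : ℂ) ∂μ := by
    rw [integral_complex_ofReal]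
    exact_mod_cast integral_nonneg fun t => (bump n).nonneg_normed _
  rw [hmean] at hmean_nonneg
  rw [Set.mem_Ici, convolution_eq_swap]
  simpa [hp] using hmean_nonneg

section SmoothTestFunctions

variable {E : Type*} [NormedAddCommGroup E] [NormedSpace ℝ E] [FiniteDimensional ℝ E]
  [MeasurableSpace E] [BorelSpace E] {μ ν : Measure E}

theorem measure_le_of_isOpen_of_integral_contDiff [IsFiniteMeasureOnCompacts μ]
    [IsFiniteMeasureOnCompacts ν]
    (h : ∀ f : E → ℝ, HasCompactSupport f → ContDiff ℝ ∞ f → ∫ x, f x ∂μ = ∫ x, f x ∂ν)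
    {U : Set E} (hU : IsOpen U) : μ U ≤ ν U := by
  rw [hU.measure_eq_iSup_isCompact]
  refine iSup_le fun K => iSup_le fun hKU => iSup_le fun hK => ?_
  obtain ⟨W, hW, hKW, hWU, hWc⟩ := exists_open_between_and_isCompact_closure hK hU hKU
  obtain ⟨f, hf_zero, hf_one, hf_mem⟩ := exists_contMDiffMap_zero_one_of_isClosed 𝓘(ℝ, E) (n := ⊤)
    hW.isClosed_compl hK.isClosed (Set.disjoint_compl_left_iff_subset.2 hKW)
  have hf_smooth : ContDiff ℝ ∞ (f : E → ℝ) := f.contMDiff.contDiff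
  have hf_supp : HasCompactSupport (f : E → ℝ) :=
    HasCompactSupport.of_support_subset_isCompact hWc fun x hx =>
      subset_closure (by_contra fun hxW => hx (hf_zero hxW))
  have hlintegral {ρ : Measure E} [IsFiniteMeasureOnCompacts ρ] :
      ∫⁻ x, ENNReal.ofReal (f x) ∂ρ = ENNReal.ofReal (∫ x, f x ∂ρ) :=
    (ofReal_integral_eq_lintegral_ofReal
      (hf_smooth.continuous.integrable_of_hasCompactSupport hf_supp)
      (Eventually.of_forall fun x => (hf_mem x).1)).symm
  calc μ K = ∫⁻ x, K.indicator 1 x ∂μ := (lintegral_indicator_one hK.measurableSet).symm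
    _ ≤ ∫⁻ x, ENNReal.ofReal (f x) ∂μ := by
      refine lintegral_mono fun x => ?_
      by_cases hx : x ∈ K
      · simp [hx, hf_one hx]
      · simp [hx]
    _ = ∫⁻ x, ENNReal.ofReal (f x) ∂ν := by
      rw [hlintegral (ρ := μ), hlintegral (ρ := ν), h f hf_supp hf_smooth]
    _ ≤ ∫⁻ x, U.indicator 1 x ∂ν := by
      refine lintegral_mono fun x => ?_
      by_cases hx : x ∈ W
      · simpa [hWU (subset_closure hx)] using (hf_mem x).2
      · simp [hf_zero hx]
    _ = ν U := lintegral_indicator_one hU.measurableSet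

theorem measure_ext_of_integral_contDiff [IsFiniteMeasure μ] [IsFiniteMeasureOnCompacts ν]
    (h : ∀ f : E → ℝ, HasCompactSupport f → ContDiff ℝ ∞ f → ∫ x, f x ∂μ = ∫ x, f x ∂ν) :
    μ = ν := by
  have hopen {U : Set E} (hU : IsOpen U) : μ U = ν U :=
    le_antisymm (measure_le_of_isOpen_of_integral_contDiff h hU)
      (measure_le_of_isOpen_of_integral_contDiff (fun f hf hf' => (h f hf hf').symm) hU)
  exact ext_of_generate_finite {U : Set E | IsOpen U} BorelSpace.measurable_eq isPiSystem_isOpen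
    (fun U hU => hopen hU) (hopen isOpen_univ)

end SmoothTestFunctions

theorem eq_withDensity_charDensity (h : Integrable (charFun μ)) :
    μ = volume.withDensity fun x => ENNReal.ofReal (charDensity μ x).re := by
  have hcont : Continuous fun x => (charDensity μ x).re :=
    Complex.continuous_re.comp (continuous_charDensity h)
  have hnonneg (x : V) : 0 ≤ (charDensity μ x).re := (Complex.le_def.1 (charDensity_nonneg h x)).1
  have hreal (r : ℝ) (x : V) : (r : ℂ) * charDensity μ x = (r * (charDensity μ x).re : ℝ) := by
    rw [Complex.ofReal_mul]
    exact congrArg _ (Complex.ext rfl (Complex.le_def.1 (charDensity_nonneg h x)).2.symm)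
  have : IsLocallyFiniteMeasure (volume.withDensity fun x => ENNReal.ofReal (charDensity μ x).re) :=
    IsLocallyFiniteMeasure.withDensity_ofReal hcont
  refine measure_ext_of_integral_contDiff fun f hf hf' => ?_
  have hinteg := integral_eq_integral_mul_charDensity h (f := fun t => (f t : ℂ))
    (hf.comp_left (g := fun r : ℝ => (r : ℂ)) Complex.ofReal_zero)
    (Complex.ofRealCLM.contDiff.comp hf')
  simp_rw [hreal, integral_complex_ofReal] at hinteg
  rw [Complex.ofReal_inj.1 hinteg, integral_withDensity_eq_integral_toReal_smul
    hcont.measurable.ennreal_ofReal (Eventually.of_forall fun _ => ENNReal.ofReal_lt_top)]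
  refine integral_congr_ae (Eventually.of_forall fun x => ?_)
  beta_reduce
  rw [ENNReal.toReal_ofReal (hnonneg x), smul_eq_mul, mul_comm]

theorem exists_continuous_planeMeasure_density {μ : Measure ℂ} [IsFiniteMeasure μ]
    (h : Integrable (charFun μ)) :
    ∃ M : ℂ → ℝ, Continuous M ∧ (∀ z, 0 ≤ M z) ∧
      μ = planeMeasure.withDensity (fun z => ENNReal.ofReal (M z)) := by
  have hcont : Continuous fun z => 2 * π * (charDensity μ z).re :=
    (Complex.continuous_re.comp (continuous_charDensity h)).const_mul _
  refine ⟨_, hcont, fun z => ?_, ?_⟩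
  · exact mul_nonneg Real.two_pi_pos.le (Complex.le_def.1 (charDensity_nonneg h z)).1
  · rw [planeMeasure, withDensity_smul_measure,
      ← withDensity_smul _ hcont.measurable.ennreal_ofReal]
    refine (eq_withDensity_charDensity h).trans (congrArg _ (funext fun z => ?_))
    rw [Pi.smul_apply, smul_eq_mul, ← ENNReal.ofReal_mul (by positivity), ← mul_assoc,
      inv_mul_cancel₀ Real.two_pi_pos.ne', one_mul]

end FourierInversion

theorem norm_psi (z w : ℂ) : ‖psi z w‖ = 1 := by
  rw [psi, mul_comm, Complex.norm_exp_ofReal_mul_I]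

theorem continuous_psi (z : ℂ) : Continuous (psi z) := by
  unfold psi
  fun_prop

theorem charFun_eq_integral_psi (μ : Measure ℂ) (z : ℂ) : charFun μ z = ∫ w, psi z w ∂μ := by
  simp only [charFun_apply, psi, Complex.inner, mul_comm I, mul_comm z]

theorem charFun_circleEquidistribution {r : ℝ} (hr : 0 ≤ r) (z : ℂ) :
    charFun (circleEquidistribution r : Measure ℂ) z = (besselJ0 (‖z‖ * r) : ℂ) := by
  rw [charFun_eq_integral_psi, circleEquidistribution, ProbabilityMeasure.coe_mk,
    integral_map (by fun_prop) (continuous_psi z).aestronglyMeasurable,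
    ← intervalIntegral.integral_of_le zero_le_one, integral_psi_circle, Complex.norm_real,
    Real.norm_of_nonneg hr]

theorem charFun_partialConvolution {σ α : ℝ} (hα : 0 < α) (n : ℕ) (z : ℂ) :
    charFun (partialConvolution σ α n : Measure ℂ) z
      = ∏ k ∈ Finset.range (n + 1), (besselJ0 (‖z‖ * ((k : ℝ) + α) ^ (-σ)) : ℂ) := by
  induction n with
  | zero => simp [partialConvolution, charFun_circleEquidistribution (Real.rpow_nonneg hα.le _)]
  | succ n ih =>
    rw [Finset.prod_range_succ, ← ih, partialConvolution, ProbabilityMeasure.coe_mk, charFun_conv,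
      charFun_circleEquidistribution (by positivity)]

/-! ### The infinite convolution -/

theorem exists_tendsto_of_tendsto_charFun {V : Type*} [NormedAddCommGroup V]
    [InnerProductSpace ℝ V] [FiniteDimensional ℝ V] [MeasurableSpace V] [BorelSpace V]
    {μ : ℕ → ProbabilityMeasure V} {g : V → ℂ} (hg : ContinuousAt g 0)
    (h : ∀ x, Tendsto (fun n => charFun (μ n : Measure V) x) atTop (𝓝 (g x))) :
    ∃ φ : ProbabilityMeasure V, Tendsto μ atTop (𝓝 φ) ∧ charFun (φ : Measure V) = g := by
  have hcompact : IsCompact (closure (Set.range μ)) := by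
    refine isCompact_closure_of_isTightMeasureSet ?_
    convert isTightMeasureSet_of_tendsto_charFun hg h using 1
    ext ν
    simp
  obtain ⟨φ, -, hφ⟩ := hcompact.ultrafilter_le_nhds ((Ultrafilter.of atTop).map μ) <|
    le_principal_iff.2 <| Ultrafilter.mem_map.2 <|
      univ_mem' fun n => subset_closure (Set.mem_range_self n)
  have hφ_tendsto : Tendsto μ (Ultrafilter.of atTop : Ultrafilter ℕ) (𝓝 φ) := hφ
  have hchar : charFun (φ : Measure V) = g := by
    funext x
    refine tendsto_nhds_unique ?_ ((h x).mono_left (Ultrafilter.of_le atTop))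
    simpa only [charFun_eq_integral_innerProbChar] using
      (ProbabilityMeasure.tendsto_iff_forall_integral_rclike_tendsto ℂ).1 hφ_tendsto
        (BoundedContinuousFunction.innerProbChar x)
  exact ⟨φ, ProbabilityMeasure.tendsto_of_tendsto_charFun fun x => hchar ▸ h x, hchar⟩

theorem sum_Ico_succ_rpow_le {p : ℝ} (hp : 0 < p) {N M : ℕ} (hN : 1 ≤ N) (hNM : N ≤ M) :
    ∑ n ∈ Finset.Ico N M, ((n + 1 : ℕ) : ℝ) ^ (-(1 + p)) ≤ (N : ℝ) ^ (-p) / p := by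
  have hN' : (1 : ℝ) ≤ N := by exact_mod_cast hN
  have hM' : (N : ℝ) ≤ M := by exact_mod_cast hNM
  have hanti : AntitoneOn (fun x : ℝ => x ^ (-(1 + p))) (Set.Icc N M) := fun x hx y _ hxy =>
    Real.rpow_le_rpow_of_nonpos (by linarith [hx.1]) hxy (by linarith)
  have hzero : (0 : ℝ) ∉ Set.uIcc (N : ℝ) M := by
    rw [Set.uIcc_of_le hM']
    exact fun h => by linarith [h.1]
  calc ∑ n ∈ Finset.Ico N M, ((n + 1 : ℕ) : ℝ) ^ (-(1 + p))
      ≤ ∫ x in (N : ℝ)..M, x ^ (-(1 + p)) := hanti.sum_le_integral_Ico hNM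
    _ = ((N : ℝ) ^ (-p) - (M : ℝ) ^ (-p)) / p := by
      rw [integral_rpow (Or.inr ⟨by linarith, hzero⟩), show -(1 + p) + 1 = -p by ring, div_neg,
        ← neg_div, neg_sub]
    _ ≤ (N : ℝ) ^ (-p) / p := by
      gcongr
      exact sub_le_self _ (by positivity)

theorem rpow_neg_sq {x : ℝ} (hx : 0 ≤ x) (σ : ℝ) : (x ^ (-σ)) ^ 2 = x ^ (-(2 * σ)) := by
  rw [← Real.rpow_mul_natCast hx]
  congr 1
  push_cast
  ring

section Radii

variable {σ α : ℝ} (hα : 0 < α) (hσ : 1 / 2 < σ)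
include hα hσ

theorem sum_Ico_radius_sq_le {N : ℕ} (hN : 1 ≤ N) (M : ℕ) :
    ∑ n ∈ Finset.Ico N M, (((n : ℝ) + α) ^ (-σ)) ^ 2
      ≤ (N : ℝ) ^ (1 - 2 * σ) * (1 + 1 / (2 * σ - 1)) := by
  have hp : 0 < 2 * σ - 1 := by linarith
  rcases le_or_gt M N with h | h
  · rw [Finset.Ico_eq_empty_of_le h, Finset.sum_empty]
    positivity
  have hN' : (1 : ℝ) ≤ N := by exact_mod_cast hN
  have hterm : ∀ n ∈ Finset.Ico N M, (((n : ℝ) + α) ^ (-σ)) ^ 2 ≤ (n : ℝ) ^ (-(2 * σ)) := by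
    intro n hn
    have hn' : (1 : ℝ) ≤ n := by exact_mod_cast hN.trans (Finset.mem_Ico.1 hn).1
    rw [rpow_neg_sq (by positivity)]
    exact Real.rpow_le_rpow_of_nonpos (by linarith) (by linarith) (by linarith)
  have hfirst : (N : ℝ) ^ (-(2 * σ)) ≤ (N : ℝ) ^ (1 - 2 * σ) :=
    Real.rpow_le_rpow_of_exponent_le hN' (by linarith)
  obtain ⟨k, rfl⟩ : ∃ k, M = N + k + 1 := ⟨M - (N + 1), by omega⟩
  have htail := sum_Ico_succ_rpow_le hp hN (Nat.le_add_right N k)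
  rw [Finset.sum_Ico_add' (fun n : ℕ => (n : ℝ) ^ (-(1 + (2 * σ - 1)))) N (N + k) 1,
    show 1 + (2 * σ - 1) = 2 * σ by ring, show -(2 * σ - 1) = 1 - 2 * σ by ring] at htail
  calc ∑ n ∈ Finset.Ico N (N + k + 1), (((n : ℝ) + α) ^ (-σ)) ^ 2
      ≤ ∑ n ∈ Finset.Ico N (N + k + 1), (n : ℝ) ^ (-(2 * σ)) := Finset.sum_le_sum hterm
    _ = (N : ℝ) ^ (-(2 * σ)) + ∑ n ∈ Finset.Ico (N + 1) (N + k + 1), (n : ℝ) ^ (-(2 * σ)) :=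
      Finset.sum_eq_sum_Ico_succ_bot (by omega) _
    _ ≤ (N : ℝ) ^ (1 - 2 * σ) + (N : ℝ) ^ (1 - 2 * σ) / (2 * σ - 1) := add_le_add hfirst htail
    _ = (N : ℝ) ^ (1 - 2 * σ) * (1 + 1 / (2 * σ - 1)) := by ring

theorem summable_radius_sq : Summable fun n : ℕ => (((n : ℝ) + α) ^ (-σ)) ^ 2 := by
  refine ((Real.summable_one_div_nat_add_rpow α (2 * σ)).2 (by linarith)).congr fun n => ?_
  have hn : 0 < (n : ℝ) + α := by positivity
  rw [rpow_neg_sq hn.le, abs_of_pos hn, Real.rpow_neg hn.le, one_div]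

end Radii

theorem norm_besselJ0_le_one (x : ℝ) : ‖(besselJ0 x : ℂ)‖ ≤ 1 :=
  (Complex.norm_real _).trans_le (abs_besselJ0_le_one x)

theorem norm_besselJ0_sub_one_le (z : ℂ) (r : ℝ) :
    ‖(besselJ0 (‖z‖ * r) : ℂ) - 1‖ ≤ ‖z‖ ^ 2 * r ^ 2 / 2 := by
  rw [← Complex.ofReal_one, ← Complex.ofReal_sub, Complex.norm_real, ← mul_pow]
  exact abs_besselJ0_sub_one_le (‖z‖ * r)

theorem besselJ0_zero : besselJ0 0 = 1 := by
  simpa [sub_eq_zero] using abs_besselJ0_sub_one_le 0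

/-- Decay of a single factor in the form that can be multiplied up to an integrable bound. -/
theorem norm_besselJ0_le_one_add_norm_rpow {r : ℝ} (hr : 0 < r) (z : ℂ) :
    ‖(besselJ0 (‖z‖ * r) : ℂ)‖
      ≤ 2 * (1 + 3 * r ^ (-(1 / 2) : ℝ)) * (1 + ‖z‖) ^ (-(1 / 2) : ℝ) := by
  set a : ℝ := (1 + ‖z‖) ^ (-(1 / 2) : ℝ)
  set b : ℝ := r ^ (-(1 / 2) : ℝ)
  have ha : 0 < a := by positivity
  have hb : 0 < b := by positivity
  have htwo : (1 : ℝ) / 2 ≤ 2 ^ (-(1 / 2) : ℝ) := by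
    rw [one_div, ← Real.rpow_neg_one]
    exact Real.rpow_le_rpow_of_exponent_le one_le_two (by norm_num)
  rcases le_total ‖z‖ 1 with hz | hz
  · have hahalf : 1 / 2 ≤ a := htwo.trans <|
      Real.rpow_le_rpow_of_nonpos (by positivity) (by linarith) (by norm_num)
    nlinarith [norm_besselJ0_le_one (‖z‖ * r), mul_pos ha hb]
  · have hscale : (2 : ℝ) ^ (-(1 / 2) : ℝ) * ‖z‖ ^ (-(1 / 2) : ℝ) ≤ a := by
      rw [← Real.mul_rpow zero_le_two (norm_nonneg z)]
      exact Real.rpow_le_rpow_of_nonpos (by positivity) (by linarith) (by norm_num)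
    have hz' : ‖z‖ ^ (-(1 / 2) : ℝ) ≤ 2 * a := by
      nlinarith [Real.rpow_nonneg (norm_nonneg z) (-(1 / 2))]
    calc ‖(besselJ0 (‖z‖ * r) : ℂ)‖ = |besselJ0 (‖z‖ * r)| := Complex.norm_real _
      _ ≤ 3 * (‖z‖ * r) ^ (-(1 / 2) : ℝ) := abs_besselJ0_le_rpow (by positivity)
      _ = 3 * (‖z‖ ^ (-(1 / 2) : ℝ) * b) := by rw [Real.mul_rpow (norm_nonneg z) hr.le]
      _ ≤ 3 * (2 * a * b) := by gcongr
      _ ≤ 2 * (1 + 3 * b) * a := by linarith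

/-- The infinite product `∏_n J₀(|z| (n + α)^{-σ})`, the characteristic function of the infinite
convolution `φ₀ ∗ φ₁ ∗ ⋯`. -/
noncomputable def besselProduct (σ α : ℝ) (z : ℂ) : ℂ :=
  ∏' n : ℕ, (besselJ0 (‖z‖ * ((n : ℝ) + α) ^ (-σ)) : ℂ)

theorem besselProduct_zero (σ α : ℝ) : besselProduct σ α 0 = 1 := by
  simp [besselProduct, besselJ0_zero]

section Product

variable {σ α : ℝ} (hα : 0 < α) (hσ : 1 / 2 < σ)
include hα hσ

theorem hasProd_besselProduct (z : ℂ) :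
    HasProd (fun n : ℕ => (besselJ0 (‖z‖ * ((n : ℝ) + α) ^ (-σ)) : ℂ)) (besselProduct σ α z) := by
  have h := multipliable_one_add_of_summable
    (f := fun n : ℕ => (besselJ0 (‖z‖ * ((n : ℝ) + α) ^ (-σ)) : ℂ) - 1)
    (Summable.of_nonneg_of_le (fun n => norm_nonneg _) (fun n => norm_besselJ0_sub_one_le z _)
      (((summable_radius_sq hα hσ).mul_left (‖z‖ ^ 2)).div_const 2))
  simp only [add_sub_cancel] at h
  exact h.hasProd

theorem continuousAt_besselProduct : ContinuousAt (besselProduct σ α) 0 := by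
  have hpointwise (n : ℕ) :
      Tendsto (fun z : ℂ => (besselJ0 (‖z‖ * ((n : ℝ) + α) ^ (-σ)) : ℂ) - 1) (𝓝 0) (𝓝 0) := by
    refine squeeze_zero_norm (fun z => norm_besselJ0_sub_one_le z _) ?_
    have : Continuous fun z : ℂ => ‖z‖ ^ 2 * (((n : ℝ) + α) ^ (-σ)) ^ 2 / 2 := by fun_prop
    simpa using this.tendsto 0
  have hdominated : ∀ᶠ z : ℂ in 𝓝 0, ∀ n : ℕ,
      ‖(besselJ0 (‖z‖ * ((n : ℝ) + α) ^ (-σ)) : ℂ) - 1‖ ≤ (((n : ℝ) + α) ^ (-σ)) ^ 2 / 2 := by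
    filter_upwards [Metric.ball_mem_nhds (0 : ℂ) one_pos] with z hz n
    have hz' : ‖z‖ ^ 2 ≤ 1 := pow_le_one₀ (norm_nonneg _) (mem_ball_zero_iff.1 hz).le
    refine (norm_besselJ0_sub_one_le z _).trans ?_
    gcongr
    exact mul_le_of_le_one_left (sq_nonneg _) hz'
  have h := tendsto_tprod_one_add_of_dominated_convergence
    ((summable_radius_sq hα hσ).div_const 2) hpointwise hdominated
  simp only [add_sub_cancel, add_zero, tprod_one] at h
  rwa [ContinuousAt, besselProduct_zero]

theorem tendsto_charFun_partialConvolution (z : ℂ) :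
    Tendsto (fun n => charFun (partialConvolution σ α n : Measure ℂ) z) atTop
      (𝓝 (besselProduct σ α z)) := by
  simp_rw [charFun_partialConvolution hα]
  exact (hasProd_besselProduct hα hσ z).tendsto_prod_nat.comp (tendsto_add_atTop_nat 1)

/-- Five factors are enough for integrability on the plane, since `5 / 2 > 2`. -/
theorem exists_norm_besselProduct_le :
    ∃ C : ℝ, ∀ z : ℂ, ‖besselProduct σ α z‖ ≤ C * (1 + ‖z‖) ^ (-(5 / 2) : ℝ) := by
  set r : ℕ → ℝ := fun n => ((n : ℝ) + α) ^ (-σ)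
  have hr_pos (n : ℕ) : 0 < r n := by positivity
  refine ⟨∏ n ∈ Finset.range 5, 2 * (1 + 3 * r n ^ (-(1 / 2) : ℝ)), fun z => ?_⟩
  refine le_of_tendsto (hasProd_besselProduct hα hσ z).tendsto_prod_nat.norm ?_
  filter_upwards [eventually_ge_atTop 5] with N hN
  calc ‖∏ n ∈ Finset.range N, (besselJ0 (‖z‖ * r n) : ℂ)‖
      = ∏ n ∈ Finset.range N, ‖(besselJ0 (‖z‖ * r n) : ℂ)‖ := norm_prod _ _
    _ ≤ ∏ n ∈ Finset.range 5, ‖(besselJ0 (‖z‖ * r n) : ℂ)‖ := by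
      rw [← Finset.prod_range_mul_prod_Ico _ hN]
      exact mul_le_of_le_one_right (Finset.prod_nonneg fun _ _ => norm_nonneg _)
        (Finset.prod_le_one (fun _ _ => norm_nonneg _) fun _ _ => norm_besselJ0_le_one _)
    _ ≤ ∏ n ∈ Finset.range 5,
          (2 * (1 + 3 * r n ^ (-(1 / 2) : ℝ)) * (1 + ‖z‖) ^ (-(1 / 2) : ℝ)) :=
      Finset.prod_le_prod (fun _ _ => norm_nonneg _)
        fun n _ => norm_besselJ0_le_one_add_norm_rpow (hr_pos n) z
    _ = _ := by
      rw [Finset.prod_mul_distrib, Finset.prod_const, Finset.card_range,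
        ← Real.rpow_mul_natCast (by positivity)]
      norm_num

theorem isLimitDensity_densityM : IsLimitDensity σ α (densityM σ α) := by
  obtain ⟨φ, hφ, hchar⟩ := exists_tendsto_of_tendsto_charFun (continuousAt_besselProduct hα hσ)
    (tendsto_charFun_partialConvolution hα hσ)
  obtain ⟨C, hC⟩ := exists_norm_besselProduct_le hα hσ
  have hinteg : Integrable (charFun (φ : Measure ℂ)) := by
    refine Integrable.mono' ((integrable_one_add_norm (r := 5 / 2) ?_).const_mul C)
      measurable_charFun.aestronglyMeasurable (Eventually.of_forall fun z => hchar ▸ hC z)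
    rw [Complex.finrank_real_complex]
    norm_num
  obtain ⟨M, hM, hM_nonneg, hMφ⟩ := exists_continuous_planeMeasure_density hinteg
  have hexists : ∃ M : ℂ → ℝ, IsLimitDensity σ α M := ⟨M, hM, hM_nonneg, φ, hφ, hMφ⟩
  rw [densityM, dif_pos hexists]
  exact hexists.choose_spec

theorem fourierM_eq_besselProduct (z : ℂ) : fourierM σ α z = besselProduct σ α z := by
  obtain ⟨hM, hM_nonneg, φ, hφ, hMφ⟩ := isLimitDensity_densityM hα hσ
  have hchar : charFun (φ : Measure ℂ) z = besselProduct σ α z :=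
    tendsto_nhds_unique (ProbabilityMeasure.tendsto_iff_tendsto_charFun.1 hφ z)
      (tendsto_charFun_partialConvolution hα hσ z)
  rw [← hchar, charFun_eq_integral_psi, hMφ, fourierM,
    integral_withDensity_eq_integral_toReal_smul hM.measurable.ennreal_ofReal (by simp)]
  refine integral_congr_ae (Eventually.of_forall fun w => ?_)
  simp [ENNReal.toReal_ofReal (hM_nonneg w)]

end Product

theorem norm_prod_sub_one_le_sum {ι R : Type*} [NormedCommRing R] [NormOneClass R]
    (s : Finset ι) {a : ι → R} (ha : ∀ i ∈ s, ‖a i‖ ≤ 1) :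
    ‖∏ i ∈ s, a i - 1‖ ≤ ∑ i ∈ s, ‖a i - 1‖ := by
  classical
  induction s using Finset.induction_on with
  | empty => simp
  | insert i s hi ih =>
    rw [Finset.prod_insert hi, Finset.sum_insert hi]
    calc ‖a i * ∏ j ∈ s, a j - 1‖ = ‖(a i - 1) + a i * (∏ j ∈ s, a j - 1)‖ := by ring_nf
      _ ≤ ‖a i - 1‖ + ‖a i‖ * ‖∏ j ∈ s, a j - 1‖ := norm_add_le_of_le le_rfl (norm_mul_le _ _)
      _ ≤ ‖a i - 1‖ + ‖∏ j ∈ s, a j - 1‖ := by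
        gcongr
        exact mul_le_of_le_one_left (norm_nonneg _) (ha i (Finset.mem_insert_self i s))
      _ ≤ ‖a i - 1‖ + ∑ j ∈ s, ‖a j - 1‖ := by
        gcongr
        exact ih fun j hj => ha j (Finset.mem_insert_of_mem hj)

theorem norm_besselProduct_sub_prod_le {σ α : ℝ} (hα : 0 < α) (hσ : 1 / 2 < σ) {N : ℕ}
    (hN : 1 ≤ N) (z : ℂ) :
    ‖besselProduct σ α z - ∏ n ∈ Finset.range N, (besselJ0 (‖z‖ * ((n : ℝ) + α) ^ (-σ)) : ℂ)‖
      ≤ ‖z‖ ^ 2 * ((N : ℝ) ^ (1 - 2 * σ) * (1 + 1 / (2 * σ - 1))) := by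
  set J : ℕ → ℂ := fun n => (besselJ0 (‖z‖ * ((n : ℝ) + α) ^ (-σ)) : ℂ)
  have hJ (n : ℕ) : ‖J n‖ ≤ 1 := norm_besselJ0_le_one _
  have hlim := ((hasProd_besselProduct hα hσ z).tendsto_prod_nat.sub_const
    (∏ n ∈ Finset.range N, J n)).norm
  refine le_of_tendsto hlim ?_
  filter_upwards [eventually_ge_atTop N] with M hM
  rw [← Finset.prod_range_mul_prod_Ico _ hM, ← mul_sub_one, norm_mul, norm_prod]
  calc (∏ n ∈ Finset.range N, ‖J n‖) * ‖∏ n ∈ Finset.Ico N M, J n - 1‖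
      ≤ ‖∏ n ∈ Finset.Ico N M, J n - 1‖ :=
      mul_le_of_le_one_left (norm_nonneg _)
        (Finset.prod_le_one (fun _ _ => norm_nonneg _) fun n _ => hJ n)
    _ ≤ ∑ n ∈ Finset.Ico N M, ‖J n - 1‖ := norm_prod_sub_one_le_sum _ fun n _ => hJ n
    _ ≤ ∑ n ∈ Finset.Ico N M, ‖z‖ ^ 2 * (((n : ℝ) + α) ^ (-σ)) ^ 2 := by
      refine Finset.sum_le_sum fun n _ => (norm_besselJ0_sub_one_le z _).trans ?_
      exact half_le_self (by positivity)
    _ ≤ ‖z‖ ^ 2 * ((N : ℝ) ^ (1 - 2 * σ) * (1 + 1 / (2 * σ - 1))) := by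
      rw [← Finset.mul_sum]
      gcongr
      exact sum_Ico_radius_sq_le hα hσ hN M

/-! ### Characteristic functions and moments -/

/-- The remainder of order `m` in the Taylor expansion of `e^{ix}` at `0`. -/
noncomputable def cexpRemainder (m : ℕ) (x : ℝ) : ℂ :=
  Complex.exp (I * x) - ∑ k ∈ Finset.range m, (I * x) ^ k / (k.factorial : ℂ)

theorem cexpRemainder_succ_zero (m : ℕ) : cexpRemainder (m + 1) 0 = 0 := by
  simp [cexpRemainder, Finset.sum_range_succ']

theorem cexpRemainder_neg (m : ℕ) (x : ℝ) :
    cexpRemainder m (-x) = starRingEnd ℂ (cexpRemainder m x) := by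
  simp [cexpRemainder, ← Complex.exp_conj]

theorem continuous_cexpRemainder (m : ℕ) : Continuous (cexpRemainder m) := by
  unfold cexpRemainder
  fun_prop

theorem hasDerivAt_pow_div_factorial {𝕜 : Type*} [NontriviallyNormedField 𝕜] [CharZero 𝕜]
    (m : ℕ) (x : 𝕜) :
    HasDerivAt (fun x : 𝕜 => x ^ (m + 1) / ((m + 1).factorial : 𝕜)) (x ^ m / m.factorial) x := by
  refine ((hasDerivAt_pow (m + 1) x).div_const _).congr_deriv ?_
  have hm : (m.factorial : 𝕜) ≠ 0 := by exact_mod_cast m.factorial_ne_zero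
  have hm' : (m : 𝕜) + 1 ≠ 0 := by exact_mod_cast m.succ_ne_zero
  rw [Nat.factorial_succ, Nat.add_sub_cancel]
  push_cast
  field_simp

theorem hasDerivAt_cexpRemainder_succ (m : ℕ) (x : ℝ) :
    HasDerivAt (cexpRemainder (m + 1)) (I * cexpRemainder m x) x := by
  have hlin : HasDerivAt (fun x : ℝ => I * (x : ℂ)) I x := by
    simpa using (Complex.ofRealCLM.hasDerivAt (x := x)).const_mul I
  have hsum : HasDerivAt (fun x : ℝ => ∑ k ∈ Finset.range m,
      (I * x) ^ (k + 1) / ((k + 1).factorial : ℂ))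
      (∑ k ∈ Finset.range m, (I * x) ^ k / (k.factorial : ℂ) * I) x :=
    HasDerivAt.fun_sum fun k _ => HasDerivAt.comp
      (h₂ := fun z : ℂ => z ^ (k + 1) / ((k + 1).factorial : ℂ)) x
      (hasDerivAt_pow_div_factorial k (I * (x : ℂ))) hlin
  have hfun : cexpRemainder (m + 1) = fun x : ℝ => Complex.exp (I * x)
      - (∑ k ∈ Finset.range m, (I * x) ^ (k + 1) / ((k + 1).factorial : ℂ) + 1) := by
    funext x
    simp [cexpRemainder, Finset.sum_range_succ']
  rw [hfun]
  refine (hlin.cexp.sub (hsum.add_const 1)).congr_deriv ?_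
  rw [cexpRemainder, ← Finset.sum_mul]
  ring

theorem norm_cexpRemainder_le (m : ℕ) (x : ℝ) : ‖cexpRemainder m x‖ ≤ |x| ^ m / m.factorial := by
  wlog hx : 0 ≤ x generalizing x
  · simpa only [cexpRemainder_neg, Complex.norm_conj, abs_neg] using
      this (-x) (neg_nonneg.2 (not_le.1 hx).le)
  rw [abs_of_nonneg hx]
  induction m generalizing x with
  | zero => simp [cexpRemainder, mul_comm I, Complex.norm_exp_ofReal_mul_I]
  | succ m ih =>
    refine image_norm_le_of_norm_deriv_right_le_deriv_boundary (a := 0) (b := x)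
      (continuous_cexpRemainder _).continuousOn
      (fun y _ => (hasDerivAt_cexpRemainder_succ m y).hasDerivWithinAt) ?_
      (hasDerivAt_pow_div_factorial m) (fun y hy => ?_) ⟨hx, le_rfl⟩
    · simp [cexpRemainder_succ_zero]
    · rw [norm_mul, Complex.norm_I, one_mul]
      exact ih y hy.1

section Moments

variable {X Y : Type*} [MeasurableSpace X] [MeasurableSpace Y] {μ : Measure X} {ν : Measure Y}
  {f : X → ℝ} {g : Y → ℝ}

theorem norm_integral_cexp_sub_sum_moments_le [IsFiniteMeasure μ]
    (hf : ∀ k : ℕ, Integrable (fun x => f x ^ k) μ) (K : ℕ) :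
    ‖∫ x, Complex.exp (I * f x) ∂μ
        - ∑ k ∈ Finset.range (2 * K), I ^ k / (k.factorial : ℂ) * (∫ x, f x ^ k ∂μ : ℝ)‖
      ≤ (∫ x, f x ^ (2 * K) ∂μ) / (2 * K).factorial := by
  have hmeas : AEStronglyMeasurable f μ := by simpa using (hf 1).aestronglyMeasurable
  have hexp : Integrable (fun x => Complex.exp (I * f x)) μ :=
    Integrable.of_bound (Complex.continuous_exp.comp_aestronglyMeasurable
      ((Complex.continuous_ofReal.comp_aestronglyMeasurable hmeas).const_mul I)) 1
      (Eventually.of_forall fun x => by rw [mul_comm, Complex.norm_exp_ofReal_mul_I])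
  have hterm (k : ℕ) : (fun x => (I * f x) ^ k / (k.factorial : ℂ))
      = fun x => I ^ k / (k.factorial : ℂ) * ((f x ^ k : ℝ) : ℂ) := by
    funext x
    push_cast
    ring
  have hterm_int (k : ℕ) : Integrable (fun x => (I * f x) ^ k / (k.factorial : ℂ)) μ :=
    hterm k ▸ (hf k).ofReal.const_mul _
  have hsum : ∑ k ∈ Finset.range (2 * K), I ^ k / (k.factorial : ℂ) * (∫ x, f x ^ k ∂μ : ℝ)
      = ∫ x, ∑ k ∈ Finset.range (2 * K), (I * f x) ^ k / (k.factorial : ℂ) ∂μ := by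
    rw [integral_finsetSum _ fun k _ => hterm_int k]
    simp only [hterm, integral_const_mul, integral_complex_ofReal]
  rw [hsum, ← integral_sub hexp (integrable_finsetSum _ fun k _ => hterm_int k), ← integral_div]
  refine norm_integral_le_of_norm_le ((hf _).div_const _) (Eventually.of_forall fun x => ?_)
  simpa only [cexpRemainder, pow_mul, sq_abs] using norm_cexpRemainder_le (2 * K) (f x)

theorem norm_integral_cexp_sub_le_of_moments [IsFiniteMeasure μ] [IsFiniteMeasure ν]
    (hf : ∀ k : ℕ, Integrable (fun x => f x ^ k) μ)
    (hg : ∀ k : ℕ, Integrable (fun y => g y ^ k) ν) (K : ℕ) {ε : ℝ}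
    (hε : ∀ k ≤ 2 * K, |∫ x, f x ^ k ∂μ - ∫ y, g y ^ k ∂ν| ≤ ε) :
    ‖∫ x, Complex.exp (I * f x) ∂μ - ∫ y, Complex.exp (I * g y) ∂ν‖
      ≤ (2 * K + 1) * ε + 2 * ((∫ y, g y ^ (2 * K) ∂ν) / (2 * K).factorial) := by
  set a : ℕ → ℂ := fun k => I ^ k / (k.factorial : ℂ) * (∫ x, f x ^ k ∂μ : ℝ)
  set b : ℕ → ℂ := fun k => I ^ k / (k.factorial : ℂ) * (∫ y, g y ^ k ∂ν : ℝ)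
  have hfactorial (k : ℕ) : (1 : ℝ) ≤ k.factorial := by exact_mod_cast k.factorial_pos
  have hε_nonneg : 0 ≤ ε := (abs_nonneg _).trans (hε 0 (Nat.zero_le _))
  have hterm (k : ℕ) (hk : k < 2 * K) : ‖a k - b k‖ ≤ ε := by
    rw [← mul_sub, norm_mul, norm_div, norm_pow, Complex.norm_I, one_pow, Complex.norm_natCast,
      ← Complex.ofReal_sub, Complex.norm_real, Real.norm_eq_abs]
    exact (mul_le_of_le_one_left (abs_nonneg _)
      (div_le_one_of_le₀ (hfactorial k) (by positivity))).trans (hε k hk.le)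
  have hsums : ‖∑ k ∈ Finset.range (2 * K), a k - ∑ k ∈ Finset.range (2 * K), b k‖
      ≤ 2 * K * ε := by
    rw [← Finset.sum_sub_distrib]
    refine (norm_sum_le_of_le _ fun k hk => hterm k (Finset.mem_range.1 hk)).trans_eq ?_
    simp
  have htop : (∫ x, f x ^ (2 * K) ∂μ) / (2 * K).factorial
      ≤ (∫ y, g y ^ (2 * K) ∂ν) / (2 * K).factorial + ε := by
    rw [← sub_le_iff_le_add', ← sub_div]
    exact (div_le_div_of_nonneg_right ((le_abs_self _).trans (hε (2 * K) le_rfl))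
      (by positivity)).trans (div_le_self hε_nonneg (hfactorial _))
  have hμ := norm_integral_cexp_sub_sum_moments_le hf K
  have hν := norm_integral_cexp_sub_sum_moments_le hg K
  rw [norm_sub_rev] at hν
  have htriangle := dist_triangle4 (∫ x, Complex.exp (I * f x) ∂μ)
    (∑ k ∈ Finset.range (2 * K), a k) (∑ k ∈ Finset.range (2 * K), b k)
    (∫ y, Complex.exp (I * g y) ∂ν)
  simp only [dist_eq_norm] at htriangle
  linarith

end Moments

/-! ### Trigonometric sums with independent frequencies -/

section TrigonometricSums

variable {ι : Type*} [Fintype ι]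

/-- The real trigonometric sum `∑ Re (w_n e^{i θ_n})`. -/
noncomputable def trigSum (w : ι → ℂ) (θ : ι → ℝ) : ℝ :=
  ∑ n, (w n * Complex.exp (I * θ n)).re

/-- The coefficients of `trigSum` as a sum of the characters `e^{± i θ_n}`; the boolean is the sign,
as in `boolSign`. -/
noncomputable def trigCoeff (w : ι → ℂ) (p : ι × Bool) : ℂ :=
  (bif p.2 then w p.1 else starRingEnd ℂ (w p.1)) / 2

/-- The sign `1` or `-1` encoded by a boolean. -/
def boolSign (b : Bool) : ℤ := bif b then 1 else -1

/-- The signed sum `∑_i ± x_{n_i}` with signs and indices recorded by `p`: the frequencies of the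
powers of a trigonometric sum. -/
def signedSum {κ : Type*} [Fintype κ] (p : κ → ι × Bool) (x : ι → ℝ) : ℝ :=
  ∑ i, boolSign (p i).2 * x (p i).1

omit [Fintype ι] in
theorem signedSum_mul_left {κ : Type*} [Fintype κ] (p : κ → ι × Bool) (c : ℝ) (x : ι → ℝ) :
    signedSum p (fun n => c * x n) = c * signedSum p x := by
  simp only [signedSum, Finset.mul_sum, mul_left_comm]

omit [Fintype ι] in
theorem integrable_cexp_signedSum {κ X : Type*} [Fintype κ] [TopologicalSpace X] [MeasurableSpace X]
    [OpensMeasurableSpace X] {μ : Measure X} [IsFiniteMeasure μ] (p : κ → ι × Bool) {θ : X → ι → ℝ}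
    (hθ : Continuous θ) : Integrable (fun x => Complex.exp (I * signedSum p (θ x))) μ := by
  unfold signedSum
  exact Integrable.of_bound (Continuous.aestronglyMeasurable (by fun_prop)) 1
    (Eventually.of_forall fun x => by rw [mul_comm, Complex.norm_exp_ofReal_mul_I])

theorem exists_signedSum_eq_sum_int {κ : Type*} [Fintype κ] (p : κ → ι × Bool) :
    ∃ c : ι → ℤ, ∀ x : ι → ℝ, signedSum p x = ∑ n, c n * x n := by
  classical
  refine ⟨fun n => ∑ i, if (p i).1 = n then boolSign (p i).2 else 0, fun x => ?_⟩
  push_cast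
  simp_rw [Finset.sum_mul]
  rw [Finset.sum_comm]
  simp [signedSum]

theorem trigSum_eq_sum (w : ι → ℂ) (θ : ι → ℝ) :
    (trigSum w θ : ℂ)
      = ∑ p, trigCoeff w p * Complex.exp (I * ((boolSign p.2 * θ p.1 : ℝ) : ℂ)) := by
  rw [trigSum, Fintype.sum_prod_type, Complex.ofReal_sum]
  refine Finset.sum_congr rfl fun n _ => ?_
  rw [Fintype.sum_bool, Complex.re_eq_add_conj, map_mul, ← Complex.exp_conj]
  simp [trigCoeff, boolSign]
  ring

theorem trigSum_pow (w : ι → ℂ) (θ : ι → ℝ) (k : ℕ) :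
    ((trigSum w θ ^ k : ℝ) : ℂ) = ∑ p : Fin k → ι × Bool,
      (∏ i, trigCoeff w (p i)) * Complex.exp (I * signedSum p θ) := by
  rw [Complex.ofReal_pow, trigSum_eq_sum, Fintype.sum_pow]
  refine Finset.sum_congr rfl fun p _ => ?_
  rw [Finset.prod_mul_distrib, ← Complex.exp_sum, ← Finset.mul_sum, ← Complex.ofReal_sum, signedSum]

theorem sum_norm_trigCoeff (w : ι → ℂ) : ∑ p, ‖trigCoeff w p‖ = ∑ n, ‖w n‖ := by
  rw [Fintype.sum_prod_type]
  refine Finset.sum_congr rfl fun n _ => ?_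
  simp [trigCoeff]

theorem abs_trigSum_le (w : ι → ℂ) (θ : ι → ℝ) : |trigSum w θ| ≤ ∑ n, ‖w n‖ := by
  refine (Finset.abs_sum_le_sum_abs _ _).trans (Finset.sum_le_sum fun n _ => ?_)
  refine (Complex.abs_re_le_norm _).trans_eq ?_
  rw [norm_mul, mul_comm I, Complex.norm_exp_ofReal_mul_I, mul_one]

@[fun_prop]
theorem continuous_trigSum (w : ι → ℂ) : Continuous (trigSum w) := by
  unfold trigSum
  fun_prop

theorem trigSum_ofReal_mul (w : ι → ℂ) (y : ℝ) (θ : ι → ℝ) :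
    trigSum (fun n => y * w n) θ = y * trigSum w θ := by
  simp only [trigSum, Finset.mul_sum, mul_assoc, Complex.re_ofReal_mul]

theorem trigSum_two_pi_mul (w : ι → ℂ) (u : ι → ℝ) :
    trigSum w (fun n => 2 * π * u n) = ∑ n, (w n * Complex.exp (2 * π * I * u n)).re :=
  Finset.sum_congr rfl fun n _ => by
    push_cast
    rw [mul_right_comm _ I, mul_comm I]

theorem integrable_trigSum_pow {X : Type*} [TopologicalSpace X] [MeasurableSpace X]
    [OpensMeasurableSpace X] {μ : Measure X} [IsFiniteMeasure μ] (w : ι → ℂ) {θ : X → ι → ℝ}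
    (hθ : Continuous θ) (k : ℕ) : Integrable (fun x => trigSum w (θ x) ^ k) μ :=
  Integrable.of_bound (Continuous.aestronglyMeasurable (by fun_prop)) ((∑ n, ‖w n‖) ^ k)
    (Eventually.of_forall fun x => by
      rw [norm_pow]
      exact pow_le_pow_left₀ (norm_nonneg _) (abs_trigSum_le w _) k)

instance : IsProbabilityMeasure (volume.restrict (Set.Ioc (0 : ℝ) 1)) := ⟨by simp⟩

variable (ι) in
/-- The uniform probability measure on the torus, parametrised by `(0, 1]^ι`. -/
noncomputable def torusMeasure : Measure (ι → ℝ) :=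
  Measure.pi fun _ => volume.restrict (Set.Ioc (0 : ℝ) 1)

instance : IsProbabilityMeasure (torusMeasure ι) := by
  unfold torusMeasure
  infer_instance

/-- The uniform probability measure on `(0, T]`. -/
noncomputable def timeMeasure (T : ℝ) : Measure ℝ :=
  ENNReal.ofReal (1 / T) • volume.restrict (Set.Ioc (0 : ℝ) T)

instance (T : ℝ) : IsFiniteMeasure (timeMeasure T) := by
  unfold timeMeasure
  exact Measure.smul_finite _ ENNReal.ofReal_ne_top

theorem isProbabilityMeasure_timeMeasure {T : ℝ} (hT : 0 < T) :
    IsProbabilityMeasure (timeMeasure T) := by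
  constructor
  rw [timeMeasure, Measure.smul_apply, Measure.restrict_apply_univ, Real.volume_Ioc, smul_eq_mul,
    sub_zero, ← ENNReal.ofReal_mul (by positivity), one_div_mul_cancel hT.ne', ENNReal.ofReal_one]

theorem integral_timeMeasure {T : ℝ} (hT : 0 < T) (f : ℝ → ℂ) :
    ∫ t, f t ∂(timeMeasure T) = ((1 / T : ℝ) : ℂ) * ∫ t in (0 : ℝ)..T, f t := by
  rw [timeMeasure, integral_smul_measure, ENNReal.toReal_ofReal (by positivity),
    intervalIntegral.integral_of_le hT.le, Complex.real_smul]

theorem integral_torusMeasure_prod {𝕜 : Type*} [RCLike 𝕜] (f : ι → ℝ → 𝕜) :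
    ∫ u, ∏ n, f n (u n) ∂(torusMeasure ι) = ∏ n, ∫ x in (0 : ℝ)..1, f n x := by
  simp_rw [torusMeasure, integral_fintype_prod_eq_prod,
    intervalIntegral.integral_of_le (zero_le_one (α := ℝ))]

theorem integral_torus_character (c : ι → ℤ) :
    ∫ u, Complex.exp (I * ((∑ n, c n * (2 * π * u n) : ℝ) : ℂ)) ∂(torusMeasure ι)
      = if c = 0 then 1 else 0 := by
  have hprod (u : ι → ℝ) : Complex.exp (I * ((∑ n, c n * (2 * π * u n) : ℝ) : ℂ))
      = ∏ n, Complex.exp (2 * π * I * c n * u n) := by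
    rw [← Complex.exp_sum]
    push_cast
    rw [Finset.mul_sum]
    exact congrArg _ (Finset.sum_congr rfl fun n _ => by ring)
  simp_rw [hprod, integral_torusMeasure_prod fun n x => Complex.exp (2 * π * I * c n * x),
    integral_cexp_two_pi_int]
  split_ifs with hc
  · simp [hc]
  · obtain ⟨n, hn⟩ := Function.ne_iff.1 hc
    exact Finset.prod_eq_zero (Finset.mem_univ n) (if_neg hn)

theorem norm_integral_time_character_le {T Λ : ℝ} (hT : 0 < T) (hΛ : Λ ≠ 0) :
    ‖∫ t, Complex.exp (I * ((-t * Λ : ℝ) : ℂ)) ∂(timeMeasure T)‖ ≤ 2 / (T * |Λ|) := by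
  have hphase (t : ℝ) : Complex.exp (I * ((-t * Λ : ℝ) : ℂ)) = Complex.exp (-(I * Λ) * t) := by
    push_cast
    ring_nf
  have hnorm (t : ℝ) : ‖Complex.exp (-(I * Λ) * t)‖ = 1 := by
    rw [← hphase, mul_comm, Complex.norm_exp_ofReal_mul_I]
  rw [integral_timeMeasure hT]
  simp_rw [hphase]
  rw [integral_exp_mul_complex (by simpa using hΛ), norm_mul, norm_div, norm_neg, norm_mul,
    Complex.norm_I, one_mul, Complex.norm_real, Complex.norm_real, Real.norm_eq_abs,
    Real.norm_eq_abs, abs_of_pos (by positivity)]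
  calc 1 / T * (‖Complex.exp (-(I * Λ) * T) - Complex.exp (-(I * Λ) * (0 : ℝ))‖ / |Λ|)
      ≤ 1 / T * (2 / |Λ|) := by
        gcongr
        exact (norm_sub_le _ _).trans (by rw [hnorm, hnorm]; norm_num)
    _ = 2 / (T * |Λ|) := by field_simp

section Independent

variable {l : ι → ℝ} {T D : ℝ}

theorem norm_character_mean_sub_le (hl : LinearIndependent ℚ l) (hT : 0 < T) (hD : 0 < D)
    {κ : Type*} [Fintype κ] (p : κ → ι × Bool) (hgap : signedSum p l ≠ 0 → D⁻¹ ≤ |signedSum p l|) :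
    ‖∫ t, Complex.exp (I * signedSum p fun n => -t * l n) ∂(timeMeasure T)
        - ∫ u, Complex.exp (I * signedSum p fun n => 2 * π * u n) ∂(torusMeasure ι)‖
      ≤ 2 * D / T := by
  have := isProbabilityMeasure_timeMeasure hT
  obtain ⟨c, hc⟩ := exists_signedSum_eq_sum_int p
  simp_rw [signedSum_mul_left p _ l, hc fun _ => 2 * π * _, integral_torus_character]
  by_cases hzero : signedSum p l = 0
  · have hc_zero : c = 0 := by
      have hcomb : ∑ n, (c n : ℚ) • l n = 0 := by
        simpa only [Rat.smul_def, Rat.cast_intCast, ← hc] using hzero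
      exact funext fun n => by exact_mod_cast Fintype.linearIndependent_iff.1 hl _ hcomb n
    simp only [hzero, hc_zero, mul_zero, Complex.ofReal_zero, Complex.exp_zero, integral_const,
      probReal_univ, one_smul, if_true, sub_self, norm_zero]
    positivity
  · have hc_ne : c ≠ 0 := fun h => hzero (by simp [hc, h])
    rw [if_neg hc_ne, sub_zero]
    calc ‖∫ t, Complex.exp (I * ((-t * signedSum p l : ℝ) : ℂ)) ∂(timeMeasure T)‖
        ≤ 2 / (T * |signedSum p l|) := norm_integral_time_character_le hT hzero
      _ ≤ 2 / (T * D⁻¹) := by gcongr; exact hgap hzero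
      _ = 2 * D / T := by field_simp

theorem abs_moment_sub_le (hl : LinearIndependent ℚ l) (hT : 0 < T) (hD : 0 < D) (w : ι → ℂ)
    (k : ℕ) (hgap : ∀ p : Fin k → ι × Bool, signedSum p l ≠ 0 → D⁻¹ ≤ |signedSum p l|) :
    |∫ t, trigSum w (fun n => -t * l n) ^ k ∂(timeMeasure T)
        - ∫ u, trigSum w (fun n => 2 * π * u n) ^ k ∂(torusMeasure ι)|
      ≤ (∑ n, ‖w n‖) ^ k * (2 * D / T) := by
  rw [← Real.norm_eq_abs, ← Complex.norm_real, Complex.ofReal_sub, ← integral_complex_ofReal,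
    ← integral_complex_ofReal]
  simp_rw [trigSum_pow]
  rw [integral_finsetSum _ fun p _ => (integrable_cexp_signedSum p (by fun_prop)).const_mul _,
    integral_finsetSum _ fun p _ => (integrable_cexp_signedSum p (by fun_prop)).const_mul _,
    ← Finset.sum_sub_distrib]
  simp_rw [integral_const_mul, ← mul_sub]
  rw [← sum_norm_trigCoeff, Fintype.sum_pow, Finset.sum_mul]
  refine norm_sum_le_of_le _ fun p _ => ?_
  rw [norm_mul, norm_prod]
  gcongr
  exact norm_character_mean_sub_le hl hT hD p (hgap p)

end Independent

theorem integral_exp_trigSum_le (w : ι → ℂ) :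
    ∫ u, Real.exp (trigSum w fun n => 2 * π * u n) ∂(torusMeasure ι)
      ≤ Real.exp ((∑ n, ‖w n‖ ^ 2) / 4) := by
  have hprod (u : ι → ℝ) : Real.exp (trigSum w fun n => 2 * π * u n)
      = ∏ n, Real.exp (w n * Complex.exp (2 * π * I * u n)).re := by
    rw [← Real.exp_sum, trigSum_two_pi_mul]
  simp_rw [hprod,
    integral_torusMeasure_prod fun n x => Real.exp (w n * Complex.exp (2 * π * I * x)).re]
  rw [Finset.sum_div, Real.exp_sum]
  refine Finset.prod_le_prod (fun n _ => ?_) fun n _ => integral_exp_re_circle_le (w n)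
  exact intervalIntegral.integral_nonneg zero_le_one fun x _ => (Real.exp_pos _).le

theorem integral_cexp_trigSum (w : ι → ℂ) :
    ∫ u, Complex.exp (I * trigSum w fun n => 2 * π * u n) ∂(torusMeasure ι)
      = ∏ n, (besselJ0 ‖w n‖ : ℂ) := by
  have hprod (u : ι → ℝ) : Complex.exp (I * trigSum w fun n => 2 * π * u n)
      = ∏ n, psi 1 (w n * Complex.exp (2 * π * I * u n)) := by
    simp only [psi, one_mul, Complex.conj_re]
    rw [← Complex.exp_sum, ← Finset.mul_sum, ← Complex.ofReal_sum, trigSum_two_pi_mul]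
  simp_rw [hprod, integral_torusMeasure_prod fun n x => psi 1 (w n * Complex.exp (2 * π * I * x)),
    integral_psi_circle, norm_one, one_mul]

theorem pow_div_factorial_le_exp_add_exp (K : ℕ) (x : ℝ) :
    x ^ (2 * K) / (2 * K).factorial ≤ Real.exp x + Real.exp (-x) := by
  calc x ^ (2 * K) / (2 * K).factorial = |x| ^ (2 * K) / (2 * K).factorial := by
        rw [(even_two_mul K).pow_abs]
    _ ≤ Real.exp |x| := Real.pow_div_factorial_le_exp _ (abs_nonneg x) _
    _ ≤ Real.exp x + Real.exp (-x) := Real.exp_abs_le x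

/-- Chernoff's method: the moment is compared with the exponential moments at `y` and `-y`. -/
theorem integral_trigSum_pow_le (w : ι → ℂ) (K : ℕ) {y : ℝ} (hy : 0 < y) :
    (∫ u, trigSum w (fun n => 2 * π * u n) ^ (2 * K) ∂(torusMeasure ι)) / (2 * K).factorial
      ≤ 2 * (y ^ (2 * K))⁻¹ * Real.exp (y ^ 2 * (∑ n, ‖w n‖ ^ 2) / 4) := by
  set S : (ι → ℝ) → ℝ := fun u => trigSum w fun n => 2 * π * u n
  have hinteg (a : ℝ) : Integrable (fun u => Real.exp (a * S u)) (torusMeasure ι) :=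
    Integrable.of_bound (Continuous.aestronglyMeasurable (by fun_prop))
      (Real.exp (|a| * ∑ n, ‖w n‖)) (Eventually.of_forall fun u => by
        rw [Real.norm_eq_abs, Real.abs_exp, Real.exp_le_exp]
        refine (le_abs_self _).trans ?_
        rw [abs_mul]
        exact mul_le_mul_of_nonneg_left (abs_trigSum_le w _) (abs_nonneg _))
  have hmgf (a : ℝ) (ha : a ^ 2 = y ^ 2) : ∫ u, Real.exp (a * S u) ∂(torusMeasure ι)
      ≤ Real.exp (y ^ 2 * (∑ n, ‖w n‖ ^ 2) / 4) := by
    simpa only [trigSum_ofReal_mul, norm_mul, Complex.norm_real, mul_pow, Real.norm_eq_abs, sq_abs,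
      ha, ← Finset.mul_sum] using integral_exp_trigSum_le fun n => (a : ℂ) * w n
  have hpointwise (u : ι → ℝ) : S u ^ (2 * K) / (2 * K).factorial
      ≤ (y ^ (2 * K))⁻¹ * (Real.exp (y * S u) + Real.exp (-y * S u)) := by
    have h := pow_div_factorial_le_exp_add_exp K (y * S u)
    rwa [mul_pow, mul_div_assoc, ← neg_mul, ← le_inv_mul_iff₀ (by positivity)] at h
  rw [← integral_div]
  calc ∫ u, S u ^ (2 * K) / (2 * K).factorial ∂(torusMeasure ι)
      ≤ ∫ u, (y ^ (2 * K))⁻¹ * (Real.exp (y * S u) + Real.exp (-y * S u)) ∂(torusMeasure ι) :=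
        integral_mono ((integrable_trigSum_pow w (by fun_prop) _).div_const _)
          (((hinteg y).add (hinteg (-y))).const_mul _) hpointwise
    _ = (y ^ (2 * K))⁻¹ * (∫ u, Real.exp (y * S u) ∂(torusMeasure ι)
          + ∫ u, Real.exp (-y * S u) ∂(torusMeasure ι)) := by
        rw [integral_const_mul, integral_add (hinteg y) (hinteg (-y))]
    _ ≤ (y ^ (2 * K))⁻¹ * (Real.exp (y ^ 2 * (∑ n, ‖w n‖ ^ 2) / 4)
          + Real.exp (y ^ 2 * (∑ n, ‖w n‖ ^ 2) / 4)) := by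
        gcongr
        exacts [hmgf y rfl, hmgf (-y) (neg_sq y)]
    _ = _ := by ring

theorem norm_mean_cexp_trigSum_sub_prod_le {l : ι → ℝ} (hl : LinearIndependent ℚ l) {T D : ℝ}
    (hT : 0 < T) (hD : 0 < D) (w : ι → ℂ) (K : ℕ) {y : ℝ} (hy : 0 < y)
    (hgap : ∀ k ≤ 2 * K, ∀ p : Fin k → ι × Bool, signedSum p l ≠ 0 → D⁻¹ ≤ |signedSum p l|) :
    ‖(∫ t, Complex.exp (I * trigSum w fun n => -t * l n) ∂(timeMeasure T))
        - ∏ n, (besselJ0 ‖w n‖ : ℂ)‖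
      ≤ (2 * K + 1) * ((1 + ∑ n, ‖w n‖) ^ (2 * K) * (2 * D / T))
        + 2 * (2 * (y ^ (2 * K))⁻¹ * Real.exp (y ^ 2 * (∑ n, ‖w n‖ ^ 2) / 4)) := by
  have := isProbabilityMeasure_timeMeasure hT
  rw [← integral_cexp_trigSum]
  have hw : 0 ≤ ∑ n, ‖w n‖ := Finset.sum_nonneg fun _ _ => norm_nonneg _
  have hmoments (k : ℕ) (hk : k ≤ 2 * K) :
      |∫ t, trigSum w (fun n => -t * l n) ^ k ∂(timeMeasure T)
        - ∫ u, trigSum w (fun n => 2 * π * u n) ^ k ∂(torusMeasure ι)|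
        ≤ (1 + ∑ n, ‖w n‖) ^ (2 * K) * (2 * D / T) := by
    refine (abs_moment_sub_le hl hT hD w k (hgap k hk)).trans ?_
    gcongr
    exact (pow_le_pow_left₀ hw (by linarith) k).trans (pow_le_pow_right₀ (by linarith) hk)
  refine (norm_integral_cexp_sub_le_of_moments (integrable_trigSum_pow w (by fun_prop))
    (integrable_trigSum_pow w (by fun_prop)) K hmoments).trans ?_
  gcongr
  exact integral_trigSum_pow_le w K hy

end TrigonometricSums

/-! ### The tail of the Lerch series for non-integral `λ` -/

/-- The term `e^{2π i λ n} (n + α)^{-s}` of the Lerch series; the exponential form avoids complex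
powers. -/
noncomputable def lerchTerm (lam α : ℝ) (s : ℂ) (n : ℕ) : ℂ :=
  Complex.exp (2 * π * I * lam * n - s * Real.log ((n : ℝ) + α))

/-- The increment `log (n + 1 + α) - log (n + α)`, which governs the ratio of consecutive terms of
the Lerch series. -/
noncomputable def logStep (α : ℝ) (n : ℕ) : ℝ :=
  Real.log ((n : ℝ) + 1 + α) - Real.log ((n : ℝ) + α)

theorem lerchTerm_eq {lam α : ℝ} (hα : 0 < α) (s : ℂ) (n : ℕ) :
    Complex.exp (2 * π * I * lam * n) / ((n : ℂ) + α) ^ s = lerchTerm lam α s n := by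
  have hpos : (0 : ℝ) < n + α := by positivity
  have hcast : (n : ℂ) + α = ((n + α : ℝ) : ℂ) := by push_cast; rfl
  rw [lerchTerm, hcast, Complex.cpow_def_of_ne_zero (by exact_mod_cast hpos.ne'),
    ← Complex.ofReal_log hpos.le, Complex.exp_sub, mul_comm s]

theorem norm_lerchTerm {lam α : ℝ} (hα : 0 < α) (s : ℂ) (n : ℕ) :
    ‖lerchTerm lam α s n‖ = ((n : ℝ) + α) ^ (-s.re) := by
  rw [lerchTerm, Complex.norm_exp, Real.rpow_def_of_pos (by positivity)]
  congr 1
  simp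
  ring

theorem norm_lerchTerm_le {lam α : ℝ} (hα : 0 < α) {s : ℂ} (hs : 0 ≤ s.re) {n : ℕ} (hn : 1 ≤ n) :
    ‖lerchTerm lam α s n‖ ≤ (n : ℝ) ^ (-s.re) := by
  rw [norm_lerchTerm hα]
  exact Real.rpow_le_rpow_of_nonpos (by exact_mod_cast hn) (by linarith) (by linarith)

theorem lerchTerm_succ (lam α : ℝ) (s : ℂ) (n : ℕ) :
    lerchTerm lam α s (n + 1)
      = Complex.exp (2 * π * I * lam - s * logStep α n) * lerchTerm lam α s n := by
  rw [lerchTerm, lerchTerm, ← Complex.exp_add, logStep]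
  congr 1
  push_cast
  ring

section LogStep

variable {α : ℝ} (hα : 0 < α) (n : ℕ)
include hα

theorem logStep_eq_log_div : logStep α n = Real.log (((n : ℝ) + α + 1) / ((n : ℝ) + α)) := by
  rw [logStep, add_right_comm, Real.log_div (by positivity) (by positivity)]

theorem inv_le_logStep : ((n : ℝ) + α + 1)⁻¹ ≤ logStep α n := by
  rw [logStep_eq_log_div hα]
  refine le_trans (le_of_eq ?_) (Real.one_sub_inv_le_log_of_pos (by positivity))
  field_simp
  ring

theorem logStep_le_inv : logStep α n ≤ ((n : ℝ) + α)⁻¹ := by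
  rw [logStep_eq_log_div hα]
  refine (Real.log_le_sub_one_of_pos (by positivity)).trans (le_of_eq ?_)
  field_simp
  ring

theorem logStep_pos : 0 < logStep α n :=
  lt_of_lt_of_le (by positivity) (inv_le_logStep hα n)

theorem inv_logStep_le : (logStep α n)⁻¹ ≤ (n : ℝ) + α + 1 :=
  inv_le_of_inv_le₀ (by positivity) (inv_le_logStep hα n)

theorem le_inv_logStep : (n : ℝ) + α ≤ (logStep α n)⁻¹ :=
  (le_inv_comm₀ (by positivity) (logStep_pos hα n)).2 (logStep_le_inv hα n)

theorem logStep_sub_eq : logStep α n - logStep α (n + 1)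
    = Real.log (((n : ℝ) + α + 1) ^ 2 / (((n : ℝ) + α) * ((n : ℝ) + α + 2))) := by
  rw [logStep_eq_log_div hα, logStep_eq_log_div hα,
    ← Real.log_div (by positivity) (by positivity)]
  congr 1
  push_cast
  field_simp
  ring

theorem logStep_sub_le :
    logStep α n - logStep α (n + 1) ≤ (((n : ℝ) + α) * ((n : ℝ) + α + 2))⁻¹ := by
  rw [logStep_sub_eq hα]
  refine (Real.log_le_sub_one_of_pos (by positivity)).trans (le_of_eq ?_)
  field_simp
  ring

theorem inv_sq_le_logStep_sub :
    (((n : ℝ) + α + 1) ^ 2)⁻¹ ≤ logStep α n - logStep α (n + 1) := by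
  rw [logStep_sub_eq hα]
  refine le_trans (le_of_eq ?_) (Real.one_sub_inv_le_log_of_pos (by positivity))
  field_simp
  ring

theorem logStep_succ_le : logStep α (n + 1) ≤ logStep α n := by
  have hgap := inv_sq_le_logStep_sub hα n
  have hpos : 0 ≤ (((n : ℝ) + α + 1) ^ 2)⁻¹ := by positivity
  linarith

theorem inv_mul_inv_le_logStep_mul_logStep_succ :
    ((n : ℝ) + α + 1)⁻¹ * ((n : ℝ) + α + 2)⁻¹ ≤ logStep α n * logStep α (n + 1) := by
  have hsucc := inv_le_logStep hα (n + 1)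
  rw [Nat.cast_add_one, show (n : ℝ) + 1 + α + 1 = n + α + 2 by ring] at hsucc
  exact mul_le_mul (inv_le_logStep hα n) hsucc (by positivity) (logStep_pos hα n).le

theorem logStep_mul_logStep_succ_le_inv_mul_inv :
    logStep α n * logStep α (n + 1) ≤ ((n : ℝ) + α)⁻¹ * ((n : ℝ) + α + 1)⁻¹ := by
  have hsucc := logStep_le_inv hα (n + 1)
  rw [Nat.cast_add_one, add_right_comm] at hsucc
  exact mul_le_mul (logStep_le_inv hα n) hsucc (logStep_pos hα (n + 1)).le (by positivity)

theorem inv_logStep_succ_sub_le :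
    (logStep α (n + 1))⁻¹ - (logStep α n)⁻¹ ≤ 1 + ((n : ℝ) + α)⁻¹ := by
  have hpos := logStep_pos hα n
  have hpos' := logStep_pos hα (n + 1)
  rw [inv_sub_inv hpos'.ne' hpos.ne', div_le_iff₀ (by positivity), mul_comm (logStep α (n + 1))]
  calc logStep α n - logStep α (n + 1)
      ≤ (((n : ℝ) + α) * ((n : ℝ) + α + 2))⁻¹ := logStep_sub_le hα n
    _ = (1 + ((n : ℝ) + α)⁻¹) * (((n : ℝ) + α + 1)⁻¹ * ((n : ℝ) + α + 2)⁻¹) := by field_simp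
    _ ≤ (1 + ((n : ℝ) + α)⁻¹) * (logStep α n * logStep α (n + 1)) := by
        refine mul_le_mul_of_nonneg_left ?_ (by positivity)
        exact inv_mul_inv_le_logStep_mul_logStep_succ hα n

theorem one_sub_inv_le_inv_logStep_succ_sub :
    1 - ((n : ℝ) + α)⁻¹ ≤ (logStep α (n + 1))⁻¹ - (logStep α n)⁻¹ := by
  have hpos := logStep_pos hα n
  have hpos' := logStep_pos hα (n + 1)
  rcases le_or_gt (1 - ((n : ℝ) + α)⁻¹) 0 with hneg | hx
  · exact hneg.trans (sub_nonneg.2 (inv_anti₀ hpos' (logStep_succ_le hα n)))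
  rw [inv_sub_inv hpos'.ne' hpos.ne', le_div_iff₀ (by positivity), mul_comm (logStep α (n + 1))]
  calc (1 - ((n : ℝ) + α)⁻¹) * (logStep α n * logStep α (n + 1))
      ≤ (1 - ((n : ℝ) + α)⁻¹) * (((n : ℝ) + α)⁻¹ * ((n : ℝ) + α + 1)⁻¹) := by
        refine mul_le_mul_of_nonneg_left ?_ hx.le
        exact logStep_mul_logStep_succ_le_inv_mul_inv hα n
    _ = (((n : ℝ) + α + 1) ^ 2)⁻¹ - 1 / (((n : ℝ) + α) ^ 2 * ((n : ℝ) + α + 1) ^ 2) := by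
        field_simp
        ring
    _ ≤ (((n : ℝ) + α + 1) ^ 2)⁻¹ := sub_le_self _ (by positivity)
    _ ≤ logStep α n - logStep α (n + 1) := inv_sq_le_logStep_sub hα n

theorem abs_inv_logStep_sub_le :
    |(logStep α (n + 1))⁻¹ - (logStep α n)⁻¹ - 1| ≤ ((n : ℝ) + α)⁻¹ := by
  rw [abs_le]
  constructor <;>
    linarith [inv_logStep_succ_sub_le hα n, one_sub_inv_le_inv_logStep_succ_sub hα n]

end LogStep

theorem sum_mul_sub_succ_eq {R : Type*} [CommRing R] (G b : ℕ → R) {M N : ℕ} (h : M ≤ N) :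
    ∑ n ∈ Finset.Ico M N, G n * (b n - b (n + 1)) = G M * b M - G N * b N
      + ∑ n ∈ Finset.Ico M N, (G (n + 1) - G n) * b (n + 1) := by
  induction N, h using Nat.le_induction with
  | base => simp
  | succ N hN ih =>
    rw [Finset.sum_Ico_succ_top hN, Finset.sum_Ico_succ_top hN, ih]
    ring

theorem norm_sum_mul_sub_succ_le {R : Type*} [NormedCommRing R] {G b : ℕ → R} {A σ : ℝ}
    (hσ : 0 < σ) {M N : ℕ} (hM : 1 ≤ M) (h : M ≤ N) (hb : ∀ n, M ≤ n → ‖b n‖ ≤ (n : ℝ) ^ (-σ))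
    (hG : ∀ n, M ≤ n → ‖G n‖ ≤ A)
    (hG' : ∀ n, M ≤ n → ‖G (n + 1) - G n‖ ≤ A / ((n + 1 : ℕ) : ℝ)) :
    ‖∑ n ∈ Finset.Ico M N, G n * (b n - b (n + 1))‖ ≤ (2 + σ⁻¹) * A * (M : ℝ) ^ (-σ) := by
  have hA : 0 ≤ A := (norm_nonneg _).trans (hG M le_rfl)
  have hM_pos : (0 : ℝ) < M := by exact_mod_cast hM
  have hboundary (n : ℕ) (hn : M ≤ n) : ‖G n * b n‖ ≤ A * (M : ℝ) ^ (-σ) := by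
    refine (norm_mul_le _ _).trans (mul_le_mul (hG n hn) ((hb n hn).trans ?_) (norm_nonneg _) hA)
    exact Real.rpow_le_rpow_of_nonpos hM_pos (by exact_mod_cast hn) (by linarith)
  have hterm (n : ℕ) (hn : n ∈ Finset.Ico M N) :
      ‖(G (n + 1) - G n) * b (n + 1)‖ ≤ A * ((n + 1 : ℕ) : ℝ) ^ (-(1 + σ)) := by
    have hn' := (Finset.mem_Ico.1 hn).1
    refine (norm_mul_le _ _).trans ((mul_le_mul (hG' n hn') (hb (n + 1) (by omega)) (norm_nonneg _)
      (by positivity)).trans_eq ?_)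
    rw [neg_add, Real.rpow_add (by positivity), Real.rpow_neg_one]
    ring
  have hsum : ‖∑ n ∈ Finset.Ico M N, (G (n + 1) - G n) * b (n + 1)‖
      ≤ A * ((M : ℝ) ^ (-σ) / σ) := by
    refine (norm_sum_le_of_le _ hterm).trans ?_
    rw [← Finset.mul_sum]
    gcongr
    exact sum_Ico_succ_rpow_le hσ hM h
  rw [sum_mul_sub_succ_eq G b h]
  calc ‖G M * b M - G N * b N + ∑ n ∈ Finset.Ico M N, (G (n + 1) - G n) * b (n + 1)‖
      ≤ A * (M : ℝ) ^ (-σ) + A * (M : ℝ) ^ (-σ) + A * ((M : ℝ) ^ (-σ) / σ) :=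
        norm_add_le_of_le (norm_sub_le_of_le (hboundary M le_rfl) (hboundary N h)) hsum
    _ = (2 + σ⁻¹) * A * (M : ℝ) ^ (-σ) := by ring

theorem tendsto_const_mul_natCast_rpow_neg (C : ℝ) {σ : ℝ} (hσ : 0 < σ) :
    Tendsto (fun M : ℕ => C * (M : ℝ) ^ (-σ)) atTop (𝓝 0) := by
  simpa using ((tendsto_rpow_neg_atTop hσ).comp tendsto_natCast_atTop_atTop).const_mul C

theorem exists_tendsto_of_eventually_norm_sub_le {E : Type*} [NormedAddCommGroup E]
    [CompleteSpace E] {f : ℕ → E} {b : ℕ → ℝ} (hb : Tendsto b atTop (𝓝 0))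
    (h : ∀ᶠ M in atTop, ∀ N, M ≤ N → ‖f N - f M‖ ≤ b M) : ∃ L, Tendsto f atTop (𝓝 L) := by
  refine cauchySeq_tendsto_of_complete (Metric.cauchySeq_iff'.2 fun ε hε => ?_)
  obtain ⟨M, hM, hM_small⟩ := (h.and (hb.eventually (gt_mem_nhds hε))).exists
  exact ⟨M, fun N hN => (dist_eq_norm _ _).trans_lt ((hM N hN).trans_lt hM_small)⟩

theorem norm_cexp_neg_sub_one_le {u : ℂ} (hu : ‖u‖ ≤ 1) : ‖Complex.exp (-u) - 1‖ ≤ 2 * ‖u‖ := by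
  simpa using Complex.norm_exp_sub_one_le (x := -u) (by simpa using hu)

theorem norm_cexp_neg_sub_cexp_neg_le {u v : ℂ} (hu : 0 ≤ u.re) (huv : ‖v - u‖ ≤ 1) :
    ‖Complex.exp (-v) - Complex.exp (-u)‖ ≤ 2 * ‖v - u‖ := by
  have hfactor : Complex.exp (-v) - Complex.exp (-u)
      = Complex.exp (-u) * (Complex.exp (-(v - u)) - 1) := by
    rw [mul_sub, ← Complex.exp_add]
    ring_nf
  have hexp : ‖Complex.exp (-u)‖ ≤ 1 := by simpa [Complex.norm_exp] using hu
  rw [hfactor, norm_mul]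
  exact (mul_le_of_le_one_left (norm_nonneg _) hexp).trans (norm_cexp_neg_sub_one_le huv)

/-- The ratio `e^{2π i λ} ((n + α) / (n + 1 + α))^s` of consecutive terms of the Lerch series. -/
noncomputable def lerchRatio (lam α : ℝ) (s : ℂ) (n : ℕ) : ℂ :=
  Complex.exp (2 * π * I * lam) * Complex.exp (-(s * logStep α n))

theorem lerchTerm_succ_eq_ratio_mul (lam α : ℝ) (s : ℂ) (n : ℕ) :
    lerchTerm lam α s (n + 1) = lerchRatio lam α s n * lerchTerm lam α s n := by
  rw [lerchTerm_succ, lerchRatio, ← Complex.exp_add, sub_eq_add_neg]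

section LargeIndex

variable {α : ℝ} (hα : 0 < α) {s : ℂ} {n : ℕ} (hn : 1 ≤ n) {δ : ℝ} (hns : ‖s‖ ≤ δ * n)
include hα hn hns

theorem norm_mul_logStep_le : ‖s * logStep α n‖ ≤ δ := by
  have hn_pos : (0 : ℝ) < n := by exact_mod_cast hn
  rw [norm_mul, Complex.norm_real, Real.norm_of_nonneg (logStep_pos hα n).le]
  calc ‖s‖ * logStep α n ≤ ‖s‖ * (n : ℝ)⁻¹ := by
        gcongr
        exact (logStep_le_inv hα n).trans (inv_anti₀ hn_pos (by linarith))
    _ ≤ δ := by rwa [← div_eq_mul_inv, div_le_iff₀ hn_pos]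

theorem norm_mul_logStep_sub_le : ‖s * logStep α n - s * logStep α (n + 1)‖ ≤ δ / n := by
  have : (0 : ℝ) < n := by exact_mod_cast hn
  have hstep := logStep_succ_le hα n
  rw [← mul_sub, norm_mul, ← Complex.ofReal_sub, Complex.norm_real,
    Real.norm_of_nonneg (by linarith)]
  calc ‖s‖ * (logStep α n - logStep α (n + 1)) ≤ (δ * n) * ((n : ℝ) * n)⁻¹ := by
        refine mul_le_mul hns ((logStep_sub_le hα n).trans ?_) (by linarith)
          ((norm_nonneg s).trans hns)
        gcongr <;> linarith
    _ = δ / n := by field_simp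

theorem norm_lerchRatio_succ_sub_le (lam : ℝ) (hs : 0 ≤ s.re) (hδ : δ ≤ 1) :
    ‖lerchRatio lam α s (n + 1) - lerchRatio lam α s n‖ ≤ 2 * (δ / n) := by
  have hn_one : (1 : ℝ) ≤ n := by exact_mod_cast hn
  have hre : 0 ≤ (s * logStep α n).re := by
    rw [Complex.re_mul_ofReal]
    exact mul_nonneg hs (logStep_pos hα n).le
  have hdiff : ‖s * logStep α (n + 1) - s * logStep α n‖ ≤ δ / n := by
    rw [norm_sub_rev]
    exact norm_mul_logStep_sub_le hα hn hns
  have hsmall : δ / n ≤ 1 := by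
    rw [div_le_one (by positivity)]
    linarith
  rw [lerchRatio, lerchRatio, ← mul_sub, norm_mul, norm_cexp_two_pi, one_mul]
  exact (norm_cexp_neg_sub_cexp_neg_le hre (hdiff.trans hsmall)).trans (by gcongr)

end LargeIndex

section NonInteger

variable {lam α : ℝ} (hα : 0 < α) {s : ℂ} (hs : 0 < s.re) {c : ℝ} (hc : 0 < c)
  (hlam : c ≤ ‖1 - Complex.exp (2 * π * I * lam)‖)
include hlam

theorem le_two_of_le_norm_one_sub_cexp : c ≤ 2 :=
  hlam.trans ((norm_sub_le _ _).trans_eq (by rw [norm_cexp_two_pi, norm_one]; norm_num))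

include hα hc

theorem half_le_norm_one_sub_lerchRatio {n : ℕ} (hn : 1 ≤ n) (hns : 4 * ‖s‖ / c ≤ n) :
    c / 2 ≤ ‖1 - lerchRatio lam α s n‖ := by
  rw [div_le_iff₀ hc] at hns
  have hsmall := norm_mul_logStep_le hα (s := s) hn (δ := c / 4) (by linarith)
  have hc_two := le_two_of_le_norm_one_sub_cexp hlam
  have hexp := norm_cexp_neg_sub_one_le (u := s * logStep α n) (by linarith)
  have hclose : ‖lerchRatio lam α s n - Complex.exp (2 * π * I * lam)‖ ≤ c / 2 := by
    rw [lerchRatio, ← mul_sub_one, norm_mul, norm_cexp_two_pi, one_mul]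
    linarith
  have htriangle := norm_sub_le_norm_sub_add_norm_sub 1 (lerchRatio lam α s n)
    (Complex.exp (2 * π * I * lam))
  linarith

include hs

theorem norm_inv_one_sub_lerchRatio_succ_sub_le {n : ℕ} (hn : 1 ≤ n) (hns : 4 * ‖s‖ / c ≤ n) :
    ‖(1 - lerchRatio lam α s (n + 1))⁻¹ - (1 - lerchRatio lam α s n)⁻¹‖
      ≤ 4 / c / ((n + 1 : ℕ) : ℝ) := by
  have hn_one : (1 : ℝ) ≤ n := by exact_mod_cast hn
  have hlow := half_le_norm_one_sub_lerchRatio hα hc hlam hn hns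
  have hlow' := half_le_norm_one_sub_lerchRatio hα hc hlam (n := n + 1) (by omega)
    (hns.trans (by simp))
  have hne := norm_pos_iff.1 (lt_of_lt_of_le (half_pos hc) hlow)
  have hne' := norm_pos_iff.1 (lt_of_lt_of_le (half_pos hc) hlow')
  have hc_two := le_two_of_le_norm_one_sub_cexp hlam
  rw [div_le_iff₀ hc] at hns
  have hdiff := norm_lerchRatio_succ_sub_le hα (s := s) hn (δ := c / 4) (by linarith) lam hs.le
    (by linarith)
  rw [inv_sub_inv hne' hne, sub_sub_sub_cancel_left, norm_div, norm_mul]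
  calc _ ≤ 2 * (c / 4 / n) / (c / 2 * (c / 2)) := by gcongr
    _ = 2 / (c * n) := by
        field_simp
        norm_num
    _ ≤ 4 / c / ((n + 1 : ℕ) : ℝ) := by
        rw [Nat.cast_add_one, div_div, div_le_div_iff₀ (by positivity) (by positivity)]
        nlinarith

/-- The factor `(1 - ρ_n)⁻¹`, where `ρ_n` is the ratio of consecutive terms, turns the sum into one
of differences; `ρ_n` varies slowly and stays away from `1`, so summation by parts applies. -/
theorem norm_sum_lerchTerm_le {M N : ℕ} (hM : 1 ≤ M) (hMs : 4 * ‖s‖ / c ≤ M) (h : M ≤ N) :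
    ‖∑ n ∈ Finset.Ico M N, lerchTerm lam α s n‖
      ≤ (2 + s.re⁻¹) * (4 / c) * (M : ℝ) ^ (-s.re) := by
  have hlarge {n : ℕ} (hn : M ≤ n) : 4 * ‖s‖ / c ≤ n := hMs.trans (by exact_mod_cast hn)
  have hlow {n : ℕ} (hn : M ≤ n) : c / 2 ≤ ‖1 - lerchRatio lam α s n‖ :=
    half_le_norm_one_sub_lerchRatio hα hc hlam (hM.trans hn) (hlarge hn)
  have hsum : ∑ n ∈ Finset.Ico M N, lerchTerm lam α s n = ∑ n ∈ Finset.Ico M N,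
      (1 - lerchRatio lam α s n)⁻¹ * (lerchTerm lam α s n - lerchTerm lam α s (n + 1)) := by
    refine Finset.sum_congr rfl fun n hn => ?_
    have hne := norm_pos_iff.1 (lt_of_lt_of_le (half_pos hc) (hlow (Finset.mem_Ico.1 hn).1))
    rw [lerchTerm_succ_eq_ratio_mul, ← one_sub_mul, inv_mul_cancel_left₀ hne]
  rw [hsum]
  refine norm_sum_mul_sub_succ_le hs hM h (fun n hn => norm_lerchTerm_le hα hs.le (hM.trans hn))
    (fun n hn => ?_) fun n hn =>
      norm_inv_one_sub_lerchRatio_succ_sub_le hα hs hc hlam (hM.trans hn) (hlarge hn)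
  calc ‖(1 - lerchRatio lam α s n)⁻¹‖ ≤ (c / 2)⁻¹ := by
        rw [norm_inv]
        gcongr
        exact hlow hn
    _ ≤ 4 / c := by
        rw [inv_div]
        gcongr
        norm_num

theorem exists_tendsto_sum_lerchTerm : ∃ L, Tendsto
    (fun N => ∑ n ∈ Finset.range N, lerchTerm lam α s n) atTop (𝓝 L) := by
  refine exists_tendsto_of_eventually_norm_sub_le
    (tendsto_const_mul_natCast_rpow_neg ((2 + s.re⁻¹) * (4 / c)) hs) ?_
  filter_upwards [eventually_ge_atTop 1, tendsto_natCast_atTop_atTop.eventually_ge_atTop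
    (4 * ‖s‖ / c)] with M hM hMs N hN
  rw [← Finset.sum_Ico_eq_sub _ hN]
  exact norm_sum_lerchTerm_le hα hs hc hlam hM hMs hN

theorem norm_limit_sub_sum_le {L : ℂ} (hL : Tendsto
    (fun N => ∑ n ∈ Finset.range N, lerchTerm lam α s n) atTop (𝓝 L)) {M : ℕ} (hM : 1 ≤ M)
    (hMs : 4 * ‖s‖ / c ≤ M) :
    ‖L - ∑ n ∈ Finset.range M, lerchTerm lam α s n‖
      ≤ (2 + s.re⁻¹) * (4 / c) * (M : ℝ) ^ (-s.re) := by
  refine le_of_tendsto (hL.sub_const _).norm ?_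
  filter_upwards [eventually_ge_atTop M] with N hN
  rw [← Finset.sum_Ico_eq_sub _ hN]
  exact norm_sum_lerchTerm_le hα hs hc hlam hM hMs hN

end NonInteger

/-! ### The Hurwitz zeta-function: integral `λ` -/

/-- The function `(1 - e^{-u}) / u`; the division gives it the value `0` instead of `1` at `0`. -/
noncomputable def expQuot (u : ℂ) : ℂ := (1 - Complex.exp (-u)) / u

theorem norm_cexp_neg_sub_one_add_le {u : ℂ} (hu : ‖u‖ ≤ 1) :
    ‖Complex.exp (-u) - 1 + u‖ ≤ ‖u‖ ^ 2 := by
  simpa using Complex.norm_exp_sub_one_sub_id_le (x := -u) (by simpa using hu)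

section ExpQuot

variable {u v : ℂ} (hu0 : u ≠ 0)
include hu0

theorem norm_expQuot_sub_one_le (hu : ‖u‖ ≤ 1) : ‖expQuot u - 1‖ ≤ ‖u‖ := by
  have hfactor : expQuot u - 1 = -(Complex.exp (-u) - 1 + u) / u := by
    rw [expQuot]
    field_simp
    ring
  rw [hfactor, norm_div, norm_neg, div_le_iff₀ (norm_pos_iff.2 hu0), ← sq]
  exact norm_cexp_neg_sub_one_add_le hu

theorem half_le_norm_expQuot (hu : ‖u‖ ≤ 1 / 2) : 1 / 2 ≤ ‖expQuot u‖ := by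
  have hclose := norm_expQuot_sub_one_le hu0 (by linarith)
  have htriangle := norm_sub_norm_le (1 : ℂ) (expQuot u)
  rw [norm_one, norm_sub_rev] at htriangle
  linarith

theorem expQuot_ne_zero (hu : ‖u‖ ≤ 1 / 2) : expQuot u ≠ 0 :=
  norm_pos_iff.1 (one_half_pos.trans_le (half_le_norm_expQuot hu0 hu))

theorem norm_inv_expQuot_le (hu : ‖u‖ ≤ 1 / 2) : ‖(expQuot u)⁻¹‖ ≤ 2 := by
  rw [norm_inv]
  exact inv_le_of_inv_le₀ two_pos (by simpa using half_le_norm_expQuot hu0 hu)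

theorem norm_inv_expQuot_sub_one_le (hu : ‖u‖ ≤ 1 / 2) : ‖(expQuot u)⁻¹ - 1‖ ≤ 2 * ‖u‖ := by
  have hfactor : (expQuot u)⁻¹ - 1 = (expQuot u)⁻¹ * (1 - expQuot u) := by
    rw [mul_one_sub, inv_mul_cancel₀ (expQuot_ne_zero hu0 hu)]
  rw [hfactor, norm_mul, norm_sub_rev]
  exact mul_le_mul (norm_inv_expQuot_le hu0 hu) (norm_expQuot_sub_one_le hu0 (by linarith))
    (norm_nonneg _) zero_le_two

theorem expQuot_sub_expQuot (hv0 : v ≠ 0) : expQuot u - expQuot v = Complex.exp (-v) *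
    (-((u - v) * (Complex.exp v - 1 - v)) - v * (Complex.exp (-(u - v)) - 1 + (u - v)))
      / (u * v) := by
  have hexp : Complex.exp (-u) = Complex.exp (-v) * Complex.exp (-(u - v)) := by
    rw [← Complex.exp_add]
    ring_nf
  have hinv : Complex.exp (-v) * Complex.exp v = 1 := by rw [← Complex.exp_add]; simp
  rw [expQuot, expQuot, div_sub_div _ _ hu0 hv0, hexp]
  congr 1
  linear_combination (u - v) * hinv

theorem norm_expQuot_sub_le (hv0 : v ≠ 0) (hu : ‖u‖ ≤ 1) (hv_re : 0 ≤ v.re) (hvu : ‖v‖ ≤ ‖u‖)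
    (hsub : ‖u - v‖ ≤ ‖u‖) : ‖expQuot u - expQuot v‖ ≤ 2 * ‖u - v‖ := by
  have hexp_v : ‖Complex.exp (-v)‖ ≤ 1 := by simpa [Complex.norm_exp] using hv_re
  have htaylor_v : ‖Complex.exp v - 1 - v‖ ≤ ‖v‖ ^ 2 :=
    Complex.norm_exp_sub_one_sub_id_le (hvu.trans hu)
  have htaylor_sub := norm_cexp_neg_sub_one_add_le (hsub.trans hu)
  have : 0 < ‖u‖ := norm_pos_iff.2 hu0
  have : 0 < ‖v‖ := norm_pos_iff.2 hv0
  rw [expQuot_sub_expQuot hu0 hv0, norm_div, norm_mul, norm_mul, div_le_iff₀ (by positivity)]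
  calc _ ≤ 1 * (‖u - v‖ * ‖v‖ ^ 2 + ‖v‖ * ‖u - v‖ ^ 2) := by
        refine mul_le_mul hexp_v ((norm_sub_le _ _).trans ?_) (norm_nonneg _) zero_le_one
        rw [norm_neg, norm_mul, norm_mul]
        gcongr
    _ = ‖u - v‖ * ‖v‖ * (‖v‖ + ‖u - v‖) := by ring
    _ ≤ ‖u - v‖ * ‖v‖ * (‖u‖ + ‖u‖) := by gcongr
    _ = 2 * ‖u - v‖ * (‖u‖ * ‖v‖) := by ring

theorem norm_inv_expQuot_sub_inv_le (hv0 : v ≠ 0) (hu : ‖u‖ ≤ 1 / 2) (hv_re : 0 ≤ v.re)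
    (hvu : ‖v‖ ≤ ‖u‖) (hsub : ‖u - v‖ ≤ ‖u‖) :
    ‖(expQuot v)⁻¹ - (expQuot u)⁻¹‖ ≤ 8 * ‖u - v‖ := by
  have hv := hvu.trans hu
  rw [inv_sub_inv (expQuot_ne_zero hv0 hv) (expQuot_ne_zero hu0 hu), div_eq_mul_inv, mul_inv,
    norm_mul, norm_mul]
  calc _ ≤ 2 * ‖u - v‖ * (2 * 2) := by
        gcongr
        exacts [norm_expQuot_sub_le hu0 hv0 (by linarith) hv_re hvu hsub,
          norm_inv_expQuot_le hv0 hv, norm_inv_expQuot_le hu0 hu]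
    _ = 8 * ‖u - v‖ := by ring

end ExpQuot

/-- The correction term in the comparison of the Hurwitz series with its integral: the increments
of `hurwitzApprox` are `eulerCorrection α s n / (s - 1)` times the increments of the series. -/
noncomputable def eulerCorrection (α : ℝ) (s : ℂ) (n : ℕ) : ℂ :=
  s / (1 - Complex.exp (-(s * logStep α n))) - ((n : ℝ) + α : ℝ) - 1

theorem eulerCorrection_eq {α : ℝ} (hα : 0 < α) (s : ℂ) (n : ℕ) : eulerCorrection α s n
    = ((expQuot (s * logStep α n))⁻¹ - 1) * ((logStep α n)⁻¹ : ℝ)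
      + (((logStep α n)⁻¹ - ((n : ℝ) + α) - 1 : ℝ) : ℂ) := by
  have hstep_ne : (logStep α n : ℂ) ≠ 0 := by exact_mod_cast (logStep_pos hα n).ne'
  rw [eulerCorrection, expQuot, inv_div]
  push_cast
  field_simp
  ring

theorem eulerCorrection_succ_sub_eq {α : ℝ} (hα : 0 < α) (s : ℂ) (n : ℕ) :
    eulerCorrection α s (n + 1) - eulerCorrection α s n
      = ((expQuot (s * logStep α (n + 1)))⁻¹ - (expQuot (s * logStep α n))⁻¹)
          * ((logStep α (n + 1))⁻¹ : ℝ)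
        + ((expQuot (s * logStep α n))⁻¹ - 1)
          * (((logStep α (n + 1))⁻¹ - (logStep α n)⁻¹ : ℝ) : ℂ)
        + (((logStep α (n + 1))⁻¹ - (logStep α n)⁻¹ - 1 : ℝ) : ℂ) := by
  rw [eulerCorrection_eq hα, eulerCorrection_eq hα]
  push_cast
  ring

section Correction

variable {α : ℝ} (hα : 0 < α) {s : ℂ}
include hα

theorem mul_logStep_ne_zero (hs0 : s ≠ 0) (n : ℕ) : s * logStep α n ≠ 0 :=
  mul_ne_zero hs0 (by exact_mod_cast (logStep_pos hα n).ne')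

variable {n : ℕ} (hn : 1 ≤ n) (hns : 2 * ‖s‖ ≤ n)
include hn hns

theorem norm_mul_logStep_le_half : ‖s * logStep α n‖ ≤ 1 / 2 :=
  norm_mul_logStep_le hα hn (by linarith)

theorem one_sub_cexp_ne_zero (hs0 : s ≠ 0) : 1 - Complex.exp (-(s * logStep α n)) ≠ 0 :=
  (div_ne_zero_iff.1 (expQuot_ne_zero (mul_logStep_ne_zero hα hs0 n)
    (norm_mul_logStep_le_half hα hn hns))).1

theorem norm_eulerCorrection_le (hs0 : s ≠ 0) : ‖eulerCorrection α s n‖ ≤ 24 * ‖s‖ + 2 := by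
  have hstep := logStep_pos hα n
  have hquot := norm_inv_expQuot_sub_one_le (mul_logStep_ne_zero hα hs0 n)
    (norm_mul_logStep_le_half hα hn hns)
  rw [norm_mul, Complex.norm_real, Real.norm_of_nonneg hstep.le] at hquot
  have hmain : ‖((expQuot (s * logStep α n))⁻¹ - 1) * ((logStep α n)⁻¹ : ℝ)‖ ≤ 2 * ‖s‖ := by
    rw [norm_mul, Complex.norm_real, norm_inv, Real.norm_of_nonneg hstep.le]
    exact (mul_inv_le_iff₀ hstep).2 (by linarith)
  have hconst : ‖(((logStep α n)⁻¹ - ((n : ℝ) + α) - 1 : ℝ) : ℂ)‖ ≤ 1 := by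
    rw [Complex.norm_real, Real.norm_eq_abs, abs_le]
    constructor <;> linarith [inv_logStep_le hα n, le_inv_logStep hα n]
  rw [eulerCorrection_eq hα s]
  refine (norm_add_le_of_le hmain hconst).trans ?_
  linarith [norm_nonneg s]

theorem norm_expQuot_increment_le (hs : 0 < s.re) :
    ‖((expQuot (s * logStep α (n + 1)))⁻¹ - (expQuot (s * logStep α n))⁻¹)
      * ((logStep α (n + 1))⁻¹ : ℝ)‖ ≤ 8 * ‖s‖ / n := by
  have hs0 : s ≠ 0 := fun h => by simp [h] at hs
  have : (0 : ℝ) < n := by exact_mod_cast hn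
  have hmono := logStep_succ_le hα n
  have hpos := logStep_pos hα n
  have hpos' := logStep_pos hα (n + 1)
  have hnorm {a : ℝ} (ha : 0 ≤ a) : ‖s * a‖ = ‖s‖ * a := by
    rw [norm_mul, Complex.norm_real, Real.norm_of_nonneg ha]
  have hsub : ‖s * logStep α n - s * logStep α (n + 1)‖
      = ‖s‖ * (logStep α n - logStep α (n + 1)) := by
    rw [← mul_sub, ← Complex.ofReal_sub, hnorm (by linarith)]
  have hinv := norm_inv_expQuot_sub_inv_le (mul_logStep_ne_zero hα hs0 n)
    (mul_logStep_ne_zero hα hs0 (n + 1)) (norm_mul_logStep_le_half hα hn hns)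
    (by rw [Complex.re_mul_ofReal]; positivity)
    (by rw [hnorm hpos.le, hnorm hpos'.le]; gcongr)
    (by rw [hsub, hnorm hpos.le]; gcongr; linarith)
  have hsucc := inv_logStep_le hα (n + 1)
  rw [Nat.cast_add_one, show (n : ℝ) + 1 + α + 1 = n + α + 2 by ring] at hsucc
  rw [norm_mul, Complex.norm_real, norm_inv, Real.norm_of_nonneg hpos'.le]
  calc _ ≤ 8 * (‖s‖ * (((n : ℝ) + α) * ((n : ℝ) + α + 2))⁻¹) * ((n : ℝ) + α + 2) := by
        rw [hsub] at hinv
        refine mul_le_mul (hinv.trans ?_) hsucc (by positivity) (by positivity)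
        gcongr
        exact logStep_sub_le hα n
    _ = 8 * ‖s‖ / ((n : ℝ) + α) := by field_simp
    _ ≤ 8 * ‖s‖ / n := by
        gcongr
        linarith

theorem norm_eulerCorrection_succ_sub_le (hs : 0 < s.re) :
    ‖eulerCorrection α s (n + 1) - eulerCorrection α s n‖
      ≤ (24 * ‖s‖ + 2) / ((n + 1 : ℕ) : ℝ) := by
  have hs0 : s ≠ 0 := fun h => by simp [h] at hs
  have hn_one : (1 : ℝ) ≤ n := by exact_mod_cast hn
  have hn_inv : ((n : ℝ) + α)⁻¹ ≤ 1 / n := by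
    rw [one_div]
    gcongr
    linarith
  have hstep := abs_inv_logStep_sub_le hα n
  have hstep_le_two : |(logStep α (n + 1))⁻¹ - (logStep α n)⁻¹| ≤ 2 := by
    have hone : 1 / (n : ℝ) ≤ 1 := by rwa [div_le_one (by positivity)]
    rw [abs_le] at hstep ⊢
    constructor <;> linarith
  have hmiddle : ‖((expQuot (s * logStep α n))⁻¹ - 1)
      * (((logStep α (n + 1))⁻¹ - (logStep α n)⁻¹ : ℝ) : ℂ)‖ ≤ 4 * ‖s‖ / n := by
    have hquot := norm_inv_expQuot_sub_one_le (mul_logStep_ne_zero hα hs0 n)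
      (norm_mul_logStep_le_half hα hn hns)
    have hsmall := norm_mul_logStep_le hα (s := s) hn (δ := ‖s‖ / n)
      (by rw [div_mul_cancel₀ _ (by positivity)])
    rw [norm_mul, Complex.norm_real, Real.norm_eq_abs]
    calc _ ≤ 2 * (‖s‖ / n) * 2 := by
          gcongr
          linarith
      _ = 4 * ‖s‖ / n := by ring
  have hlast : ‖(((logStep α (n + 1))⁻¹ - (logStep α n)⁻¹ - 1 : ℝ) : ℂ)‖ ≤ 1 / n := by
    rw [Complex.norm_real, Real.norm_eq_abs]
    exact hstep.trans hn_inv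
  rw [eulerCorrection_succ_sub_eq hα]
  calc _ ≤ 8 * ‖s‖ / n + 4 * ‖s‖ / n + 1 / n :=
        norm_add_le_of_le (norm_add_le_of_le (norm_expQuot_increment_le hα hn hns hs) hmiddle) hlast
    _ = (12 * ‖s‖ + 1) / n := by ring
    _ ≤ (24 * ‖s‖ + 2) / ((n + 1 : ℕ) : ℝ) := by
        rw [div_le_div_iff₀ (by positivity) (by positivity), Nat.cast_add_one]
        nlinarith [norm_nonneg s]

end Correction

/-- Partial sums of the Hurwitz series, completed by the integral of the tail. -/
noncomputable def hurwitzApprox (α : ℝ) (N : ℕ) (s : ℂ) : ℂ :=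
  ∑ n ∈ Finset.range N, lerchTerm 0 α s n + ((N : ℝ) + α : ℝ) * lerchTerm 0 α s N / (s - 1)

section Hurwitz

variable {α : ℝ} (hα : 0 < α) {s : ℂ}
include hα

theorem hurwitzApprox_succ_sub (hs0 : s ≠ 0) (hs1 : s ≠ 1) {n : ℕ} (hn : 1 ≤ n)
    (hns : 2 * ‖s‖ ≤ n) : hurwitzApprox α (n + 1) s - hurwitzApprox α n s
      = (s - 1)⁻¹ * (eulerCorrection α s n * (lerchTerm 0 α s n - lerchTerm 0 α s (n + 1))) := by
  have hden := one_sub_cexp_ne_zero hα hn hns hs0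
  have hs_sub : s - 1 ≠ 0 := sub_ne_zero.2 hs1
  have hstep : lerchTerm 0 α s (n + 1)
      = Complex.exp (-(s * logStep α n)) * lerchTerm 0 α s n := by
    rw [lerchTerm_succ]
    simp
  rw [hurwitzApprox, hurwitzApprox, Finset.sum_range_succ, eulerCorrection, hstep]
  push_cast
  field_simp
  ring

variable (hs : 0 < s.re) (hs1 : s ≠ 1)
include hs hs1

theorem norm_hurwitzApprox_sub_le {M N : ℕ} (hM : 1 ≤ M) (hMs : 2 * ‖s‖ ≤ M) (h : M ≤ N) :
    ‖hurwitzApprox α N s - hurwitzApprox α M s‖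
      ≤ (2 + s.re⁻¹) * ((24 * ‖s‖ + 2) / ‖s - 1‖) * (M : ℝ) ^ (-s.re) := by
  have hs0 : s ≠ 0 := fun h => by simp [h] at hs
  have hlarge {n : ℕ} (hn : M ≤ n) : 2 * ‖s‖ ≤ n := hMs.trans (by exact_mod_cast hn)
  have hsum : hurwitzApprox α N s - hurwitzApprox α M s = (s - 1)⁻¹ * ∑ n ∈ Finset.Ico M N,
      eulerCorrection α s n * (lerchTerm 0 α s n - lerchTerm 0 α s (n + 1)) := by
    rw [Finset.mul_sum, ← Finset.sum_Ico_sub (fun n => hurwitzApprox α n s) h]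
    refine Finset.sum_congr rfl fun n hn => ?_
    have hn' := (Finset.mem_Ico.1 hn).1
    exact hurwitzApprox_succ_sub hα hs0 hs1 (hM.trans hn') (hlarge hn')
  rw [hsum, norm_mul, norm_inv]
  calc _ ≤ ‖s - 1‖⁻¹ * ((2 + s.re⁻¹) * (24 * ‖s‖ + 2) * (M : ℝ) ^ (-s.re)) := by
        gcongr
        exact norm_sum_mul_sub_succ_le hs hM h
          (fun n hn => norm_lerchTerm_le hα hs.le (hM.trans hn))
          (fun n hn => norm_eulerCorrection_le hα (hM.trans hn) (hlarge hn) hs0)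
          fun n hn => norm_eulerCorrection_succ_sub_le hα (hM.trans hn) (hlarge hn) hs
    _ = _ := by ring

theorem exists_tendsto_hurwitzApprox :
    ∃ L, Tendsto (fun N => hurwitzApprox α N s) atTop (𝓝 L) := by
  refine exists_tendsto_of_eventually_norm_sub_le
    (tendsto_const_mul_natCast_rpow_neg ((2 + s.re⁻¹) * ((24 * ‖s‖ + 2) / ‖s - 1‖)) hs) ?_
  filter_upwards [eventually_ge_atTop 1, tendsto_natCast_atTop_atTop.eventually_ge_atTop
    (2 * ‖s‖)] with M hM hMs N hN
  exact norm_hurwitzApprox_sub_le hα hs hs1 hM hMs hN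

theorem norm_limit_sub_hurwitzApprox_le {L : ℂ}
    (hL : Tendsto (fun N => hurwitzApprox α N s) atTop (𝓝 L)) {M : ℕ} (hM : 1 ≤ M)
    (hMs : 2 * ‖s‖ ≤ M) : ‖L - hurwitzApprox α M s‖
      ≤ (2 + s.re⁻¹) * ((24 * ‖s‖ + 2) / ‖s - 1‖) * (M : ℝ) ^ (-s.re) := by
  refine le_of_tendsto (hL.sub_const _).norm ?_
  filter_upwards [eventually_ge_atTop M] with N hN
  exact norm_hurwitzApprox_sub_le hα hs hs1 hM hMs hN

end Hurwitz

theorem tendsto_natCast_add_mul_lerchTerm_div {α : ℝ} (hα : 0 < α) {s : ℂ} (hs : 1 < s.re) :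
    Tendsto (fun N : ℕ => ((N : ℝ) + α : ℝ) * lerchTerm 0 α s N / (s - 1)) atTop (𝓝 0) := by
  rw [tendsto_zero_iff_norm_tendsto_zero]
  have hnorm (N : ℕ) : ‖(((N : ℝ) + α : ℝ) : ℂ) * lerchTerm 0 α s N / (s - 1)‖
      = ((N : ℝ) + α) ^ (-(s.re - 1)) / ‖s - 1‖ := by
    have hpos : (0 : ℝ) < N + α := by positivity
    rw [norm_div, norm_mul, norm_lerchTerm hα, Complex.norm_real, Real.norm_of_nonneg hpos.le,
      show -(s.re - 1) = 1 + -s.re by ring, Real.rpow_add hpos, Real.rpow_one]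
  have hshift : Tendsto (fun N : ℕ => (N : ℝ) + α) atTop atTop :=
    tendsto_atTop_add_const_right _ _ tendsto_natCast_atTop_atTop
  simp_rw [hnorm]
  simpa using ((tendsto_rpow_neg_atTop (sub_pos.2 hs)).comp hshift).div_const ‖s - 1‖

theorem tendsto_hurwitzApprox_of_one_lt_re {α : ℝ} (hα : 0 < α) (hα1 : α ≤ 1) {s : ℂ}
    (hs : 1 < s.re) : Tendsto (fun N => hurwitzApprox α N s) atTop
      (𝓝 (HurwitzZeta.hurwitzZeta (α : UnitAddCircle) s)) := by
  have hterm (n : ℕ) : 1 / ((n : ℂ) + α) ^ s = lerchTerm 0 α s n := by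
    rw [← lerchTerm_eq hα]
    simp
  have hseries := (HurwitzZeta.hasSum_hurwitzZeta_of_one_lt_re ⟨hα.le, hα1⟩ hs).tendsto_sum_nat
  simp_rw [hterm] at hseries
  simpa only [hurwitzApprox, add_zero] using
    hseries.add (tendsto_natCast_add_mul_lerchTerm_div hα hs)

theorem differentiable_lerchTerm (lam α : ℝ) (n : ℕ) :
    Differentiable ℂ fun s => lerchTerm lam α s n := by
  unfold lerchTerm
  fun_prop

theorem differentiableAt_hurwitzApprox (α : ℝ) (N : ℕ) {s : ℂ} (hs1 : s ≠ 1) :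
    DifferentiableAt ℂ (hurwitzApprox α N) s := by
  unfold hurwitzApprox
  exact (DifferentiableAt.fun_sum fun n _ => differentiable_lerchTerm 0 α n s).add
    (((differentiable_lerchTerm 0 α N s).const_mul _).div (by fun_prop) (sub_ne_zero.2 hs1))

/-- The open first quadrant. It is convex and avoids the pole at `1`, so analytic continuation
inside it needs no discussion of connectedness. -/
def openFirstQuadrant : Set ℂ := {s | 0 < s.re} ∩ {s | 0 < s.im}

theorem isOpen_openFirstQuadrant : IsOpen openFirstQuadrant :=
  (isOpen_lt continuous_const Complex.continuous_re).inter
    (isOpen_lt continuous_const Complex.continuous_im)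

theorem isPreconnected_openFirstQuadrant : IsPreconnected openFirstQuadrant :=
  ((convex_halfSpace_re_gt 0).inter (convex_halfSpace_im_gt 0)).isPreconnected

theorem ne_one_of_mem_openFirstQuadrant {s : ℂ} (hs : s ∈ openFirstQuadrant) : s ≠ 1 := by
  rintro rfl
  exact lt_irrefl (0 : ℝ) hs.2

theorem tendstoLocallyUniformlyOn_hurwitzApprox {α : ℝ} (hα : 0 < α) {F : ℂ → ℂ}
    (hF : ∀ s ∈ openFirstQuadrant, Tendsto (fun N => hurwitzApprox α N s) atTop (𝓝 (F s))) :
    TendstoLocallyUniformlyOn (hurwitzApprox α) F atTop openFirstQuadrant := by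
  rw [tendstoLocallyUniformlyOn_iff_forall_tendsto]
  intro s₀ hs₀
  have hre : 0 < s₀.re := hs₀.1
  have hs₀_sub : ‖s₀ - 1‖ ≠ 0 := norm_ne_zero_iff.2
    (sub_ne_zero.2 (ne_one_of_mem_openFirstQuadrant hs₀))
  have hconst : Tendsto (fun s : ℂ => (2 + s.re⁻¹) * ((24 * ‖s‖ + 2) / ‖s - 1‖))
      (𝓝[openFirstQuadrant] s₀) (𝓝 ((2 + s₀.re⁻¹) * ((24 * ‖s₀‖ + 2) / ‖s₀ - 1‖))) := by
    have hcont : ContinuousAt (fun s : ℂ => (2 + s.re⁻¹) * ((24 * ‖s‖ + 2) / ‖s - 1‖)) s₀ := by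
      fun_prop (disch := first | exact hre.ne' | exact hs₀_sub)
    exact hcont.tendsto.mono_left nhdsWithin_le_nhds
  have hbound := (hconst.comp tendsto_snd).mul
    ((tendsto_const_mul_natCast_rpow_neg 1 (half_pos hre)).comp tendsto_fst)
  rw [mul_zero] at hbound
  rw [uniformity_eq_comap_nhds_zero, tendsto_comap_iff]
  refine squeeze_zero_norm' ?_ hbound
  have hM : ∀ᶠ M : ℕ in atTop, 1 ≤ M ∧ 2 * (‖s₀‖ + 1) ≤ M :=
    (eventually_ge_atTop 1).and (tendsto_natCast_atTop_atTop.eventually_ge_atTop _)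
  have hs : ∀ᶠ s in 𝓝[openFirstQuadrant] s₀,
      s ∈ openFirstQuadrant ∧ s₀.re / 2 < s.re ∧ ‖s‖ < ‖s₀‖ + 1 :=
    eventually_mem_nhdsWithin.and (eventually_nhdsWithin_of_eventually_nhds
      ((Complex.continuous_re.continuousAt.eventually_const_lt (half_lt_self hre)).and
        (continuous_norm.continuousAt.eventually_lt_const (lt_add_one ‖s₀‖))))
  filter_upwards [hM.prod_mk hs]
  rintro ⟨M, s⟩ ⟨⟨hM_one, hM_large⟩, hs_mem, hs_re, hs_norm⟩
  have hs_pos : 0 < s.re := hs_mem.1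
  have := norm_limit_sub_hurwitzApprox_le hα hs_pos (ne_one_of_mem_openFirstQuadrant hs_mem)
    (hF s hs_mem) hM_one (by linarith)
  simp only [Function.comp_apply, one_mul]
  rw [norm_sub_rev]
  refine this.trans ?_
  gcongr
  exact_mod_cast hM_one

theorem tendsto_hurwitzApprox {α : ℝ} (hα : 0 < α) (hα1 : α ≤ 1) {s : ℂ}
    (hs : s ∈ openFirstQuadrant) : Tendsto (fun N => hurwitzApprox α N s) atTop
      (𝓝 (HurwitzZeta.hurwitzZeta (α : UnitAddCircle) s)) := by
  choose! F hF using fun (s : ℂ) (hs : s ∈ openFirstQuadrant) =>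
    exists_tendsto_hurwitzApprox hα hs.1 (ne_one_of_mem_openFirstQuadrant hs)
  have hF_diff : DifferentiableOn ℂ F openFirstQuadrant :=
    (tendstoLocallyUniformlyOn_hurwitzApprox hα hF).differentiableOn
      (Eventually.of_forall fun N s hs => (differentiableAt_hurwitzApprox α N
        (ne_one_of_mem_openFirstQuadrant hs)).differentiableWithinAt) isOpen_openFirstQuadrant
  have hzeta_diff : DifferentiableOn ℂ (HurwitzZeta.hurwitzZeta (α : UnitAddCircle))
      openFirstQuadrant := fun s hs => (HurwitzZeta.differentiableAt_hurwitzZeta _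
        (ne_one_of_mem_openFirstQuadrant hs)).differentiableWithinAt
  have heq : Set.EqOn F (HurwitzZeta.hurwitzZeta (α : UnitAddCircle)) openFirstQuadrant := by
    have hbase : (2 + I : ℂ) ∈ openFirstQuadrant := by constructor <;> simp
    refine (hF_diff.analyticOnNhd isOpen_openFirstQuadrant).eqOn_of_preconnected_of_eventuallyEq
      (hzeta_diff.analyticOnNhd isOpen_openFirstQuadrant) isPreconnected_openFirstQuadrant hbase ?_
    filter_upwards [isOpen_openFirstQuadrant.mem_nhds hbase,
      (isOpen_lt continuous_const Complex.continuous_re).mem_nhds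
        (show (2 + I : ℂ) ∈ {s : ℂ | 1 < s.re} by simp)] with s hs hs_re
    exact tendsto_nhds_unique (hF s hs) (tendsto_hurwitzApprox_of_one_lt_re hα hα1 hs_re)
  rw [← heq hs]
  exact hF s hs

theorem norm_le_two_mul_norm_sub_one {s : ℂ} (hs : 1 ≤ s.im) : ‖s‖ ≤ 2 * ‖s - 1‖ := by
  have him := Complex.abs_im_le_norm (s - 1)
  rw [Complex.sub_im, Complex.one_im, sub_zero] at him
  have htriangle := norm_le_norm_sub_add s 1
  rw [norm_one] at htriangle
  linarith [le_abs_self s.im]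

theorem norm_hurwitzZeta_sub_sum_le {α : ℝ} (hα : 0 < α) (hα1 : α ≤ 1) {s : ℂ} (hs : 1 / 2 ≤ s.re)
    (him : 1 ≤ s.im) {M : ℕ} (hM : 1 ≤ M) (hMs : 2 * ‖s‖ ≤ M) :
    ‖HurwitzZeta.hurwitzZeta (α : UnitAddCircle) s - ∑ n ∈ Finset.range M, lerchTerm 0 α s n‖
      ≤ 224 * (M : ℝ) ^ (-s.re) + 2 * M * (M : ℝ) ^ (-s.re) / s.im := by
  have hM_one : (1 : ℝ) ≤ M := by exact_mod_cast hM
  have hs_pos : 0 < s.re := by linarith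
  have him_le : s.im ≤ ‖s - 1‖ := by
    simpa using (le_abs_self _).trans (Complex.abs_im_le_norm (s - 1))
  have hs1 : s ≠ 1 := fun h => by norm_num [h] at him
  have hconst : (2 + s.re⁻¹) * ((24 * ‖s‖ + 2) / ‖s - 1‖) ≤ 224 := by
    have hinv : s.re⁻¹ ≤ 2 := inv_le_of_inv_le₀ two_pos (by simpa using hs)
    have hquot : (24 * ‖s‖ + 2) / ‖s - 1‖ ≤ 56 := by
      rw [div_le_iff₀ (by linarith)]
      linarith [norm_le_two_mul_norm_sub_one him, Complex.re_le_norm s]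
    calc _ ≤ (2 + 2) * (56 : ℝ) := by gcongr
      _ = 224 := by norm_num
  have hseries := norm_limit_sub_hurwitzApprox_le hα hs_pos hs1
    (tendsto_hurwitzApprox hα hα1 ⟨hs_pos, one_pos.trans_le him⟩) hM hMs
  have hintegral : ‖(((M : ℝ) + α : ℝ) : ℂ) * lerchTerm 0 α s M / (s - 1)‖
      ≤ 2 * M * (M : ℝ) ^ (-s.re) / s.im := by
    rw [norm_div, norm_mul, Complex.norm_real, Real.norm_of_nonneg (by positivity)]
    have := norm_lerchTerm_le (lam := 0) hα hs_pos.le hM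
    gcongr
    linarith
  rw [hurwitzApprox, ← sub_sub] at hseries
  calc _ ≤ _ := norm_le_norm_sub_add _ _
    _ ≤ _ := add_le_add (hseries.trans (by gcongr)) hintegral

/-! ### Mean squares of Dirichlet polynomials -/

theorem norm_psi_sub_le (z w w' : ℂ) : ‖psi z w - psi z w'‖ ≤ ‖z‖ * ‖w - w'‖ := by
  have hinner (w : ℂ) : psi z w = Complex.exp (I * ((z * starRingEnd ℂ w).re : ℝ)) := rfl
  have hfactor : psi z w - psi z w'
      = psi z w' * (Complex.exp (I * ((z * starRingEnd ℂ (w - w')).re : ℝ)) - 1) := by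
    rw [hinner, hinner, mul_sub_one, ← Complex.exp_add, ← mul_add, ← Complex.ofReal_add,
      ← Complex.add_re, ← mul_add, ← map_add, add_sub_cancel]
  rw [hfactor, norm_mul, norm_psi, one_mul, ← Complex.norm_conj (w - w'), ← norm_mul]
  exact Real.norm_exp_I_mul_ofReal_sub_one_le.trans (Complex.abs_re_le_norm _)

theorem sum_range_inv_le (M : ℕ) : ∑ k ∈ Finset.range M, (k : ℝ)⁻¹ ≤ 1 + Real.log M := by
  calc ∑ k ∈ Finset.range M, (k : ℝ)⁻¹ ≤ ∑ k ∈ Finset.range (M + 1), (k : ℝ)⁻¹ :=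
        Finset.sum_le_sum_of_subset_of_nonneg (by simp) fun _ _ _ => by positivity
    _ = (harmonic M : ℝ) := by simp [harmonic, Finset.sum_range_succ']
    _ ≤ 1 + Real.log M := harmonic_le_one_add_log M

theorem sum_range_inv_abs_sub_le {M n : ℕ} (hn : n < M) :
    ∑ m ∈ Finset.range M, |(m : ℝ) - n|⁻¹ ≤ 2 * (1 + Real.log M) := by
  have hinitial {k : ℕ} (hk : k ≤ M) : ∑ j ∈ Finset.range k, (j : ℝ)⁻¹ ≤ 1 + Real.log M :=
    (Finset.sum_le_sum_of_subset_of_nonneg (by simpa using hk) fun _ _ _ => by positivity).trans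
      (sum_range_inv_le M)
  have hbelow : ∑ m ∈ Finset.range (n + 1), |(m : ℝ) - n|⁻¹
      = ∑ j ∈ Finset.range (n + 1), (j : ℝ)⁻¹ := by
    rw [← Finset.sum_range_reflect]
    refine Finset.sum_congr rfl fun j hj => ?_
    rw [Nat.add_sub_cancel, Nat.cast_sub (Finset.mem_range_succ_iff.1 hj), sub_sub_cancel_left,
      abs_neg, Nat.abs_cast]
  have habove : ∑ m ∈ Finset.Ico (n + 1) M, |(m : ℝ) - n|⁻¹
      ≤ ∑ j ∈ Finset.range (M - n), (j : ℝ)⁻¹ := by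
    calc _ ≤ ∑ m ∈ Finset.Ico n M, |(m : ℝ) - n|⁻¹ := by
          refine Finset.sum_le_sum_of_subset_of_nonneg ?_ fun _ _ _ => by positivity
          exact Finset.Ico_subset_Ico_left n.le_succ
      _ = _ := by
          rw [Finset.sum_Ico_eq_sum_range]
          simp
  rw [← Finset.sum_range_add_sum_Ico _ hn, hbelow]
  linarith [hinitial hn, hinitial (Nat.sub_le M n)]

theorem inv_sqrt_mul_log_sub_le {x y : ℝ} (hx : 0 < x) (hxy : x < y) :
    (√(x * y) * (Real.log y - Real.log x))⁻¹ ≤ (y - x)⁻¹ + x⁻¹ := by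
  have hy : 0 < y := hx.trans hxy
  have hsub : 0 < y - x := sub_pos.2 hxy
  have hlog : (y - x) / y ≤ Real.log y - Real.log x := by
    have := Real.one_sub_inv_le_log_of_pos (div_pos hy hx)
    rwa [inv_div, one_sub_div hy.ne', Real.log_div hy.ne' hx.ne'] at this
  have hsqrt_le : √(x * y) ≤ y := Real.sqrt_le_iff.2 ⟨hy.le, by nlinarith⟩
  have hsqrt_sq : √(x * y) * √(x * y) = x * y := Real.mul_self_sqrt (by positivity)
  have : 0 < √(x * y) := by positivity
  calc (√(x * y) * (Real.log y - Real.log x))⁻¹ ≤ (√(x * y) * ((y - x) / y))⁻¹ := by gcongr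
    _ = √(x * y) / (x * (y - x)) := by
        field_simp
        linear_combination -hsqrt_sq
    _ ≤ y / (x * (y - x)) := by gcongr
    _ = (y - x)⁻¹ + x⁻¹ := by
        field_simp
        ring

theorem inv_sqrt_mul_abs_log_sub_le {x y : ℝ} (hx : 0 < x) (hy : 0 < y) (hxy : x ≠ y) :
    (√(x * y) * |Real.log x - Real.log y|)⁻¹ ≤ |x - y|⁻¹ + x⁻¹ + y⁻¹ := by
  wlog hlt : x < y generalizing x y
  · have := this hy hx hxy.symm (lt_of_le_of_ne (not_lt.1 hlt) hxy.symm)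
    rwa [mul_comm y, abs_sub_comm (Real.log y), abs_sub_comm y, add_right_comm] at this
  rw [abs_sub_comm, abs_of_pos (sub_pos.2 (Real.log_lt_log hx hlt)), abs_sub_comm,
    abs_of_pos (sub_pos.2 hlt)]
  exact (inv_sqrt_mul_log_sub_le hx hlt).trans (le_add_of_nonneg_right (by positivity))

theorem integral_norm_sq_sum_le {ι Ω : Type*} [MeasurableSpace Ω] {μ : Measure Ω} (s : Finset ι)
    {f : ι → Ω → ℂ}
    (hf : ∀ m ∈ s, ∀ n ∈ s, Integrable (fun x => f m x * starRingEnd ℂ (f n x)) μ) :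
    ∫ x, ‖∑ n ∈ s, f n x‖ ^ 2 ∂μ ≤ ∑ m ∈ s, ∑ n ∈ s, ‖∫ x, f m x * starRingEnd ℂ (f n x) ∂μ‖ := by
  have hexpand (x : Ω) : ((‖∑ n ∈ s, f n x‖ ^ 2 : ℝ) : ℂ)
      = ∑ m ∈ s, ∑ n ∈ s, f m x * starRingEnd ℂ (f n x) := by
    rw [Complex.ofReal_pow, ← Complex.mul_conj', map_sum, Finset.sum_mul_sum]
  have hintegral : ((∫ x, ‖∑ n ∈ s, f n x‖ ^ 2 ∂μ : ℝ) : ℂ)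
      = ∑ m ∈ s, ∑ n ∈ s, ∫ x, f m x * starRingEnd ℂ (f n x) ∂μ := by
    rw [← integral_complex_ofReal]
    simp_rw [hexpand]
    rw [integral_finsetSum _ fun m hm => integrable_finsetSum _ (hf m hm)]
    exact Finset.sum_congr rfl fun m hm => integral_finsetSum _ (hf m hm)
  refine (Real.le_norm_self _).trans ?_
  rw [← Complex.norm_real, hintegral]
  exact norm_sum_le_of_le _ fun m _ => norm_sum_le _ _

theorem sq_integral_norm_le {Ω E : Type*} [MeasurableSpace Ω] [NormedAddCommGroup E]
    {μ : Measure Ω} [IsProbabilityMeasure μ] {f : Ω → E} (hf : MemLp f 2 μ) :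
    (∫ x, ‖f x‖ ∂μ) ^ 2 ≤ ∫ x, ‖f x‖ ^ 2 ∂μ := by
  have hvar := ProbabilityTheory.variance_eq_sub hf.norm
  have hnonneg := ProbabilityTheory.variance_nonneg (fun x => ‖f x‖) μ
  rw [hvar] at hnonneg
  exact sub_nonneg.1 hnonneg

theorem sum_sum_kernel_le (M : ℕ) {c : ℝ} (hc : 0 ≤ c) :
    ∑ m ∈ Finset.range M, ∑ n ∈ Finset.range M, ((if m = n then (n : ℝ)⁻¹ else 0)
      + c * (|(m : ℝ) - n|⁻¹ + (m : ℝ)⁻¹ + (n : ℝ)⁻¹))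
      ≤ (1 + 4 * c * M) * (1 + Real.log M) := by
  have hharmonic := sum_range_inv_le M
  have hrow {m : ℕ} (hm : m ∈ Finset.range M) : ∑ n ∈ Finset.range M,
      ((if m = n then (n : ℝ)⁻¹ else 0) + c * (|(m : ℝ) - n|⁻¹ + (m : ℝ)⁻¹ + (n : ℝ)⁻¹))
      ≤ (m : ℝ)⁻¹ + c * (2 * (1 + Real.log M) + M * (m : ℝ)⁻¹ + (1 + Real.log M)) := by
    have hdist := sum_range_inv_abs_sub_le (Finset.mem_range.1 hm)
    simp_rw [abs_sub_comm _ (m : ℝ)] at hdist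
    rw [Finset.sum_add_distrib, Finset.sum_ite_eq, if_pos hm, ← Finset.mul_sum,
      Finset.sum_add_distrib, Finset.sum_add_distrib, Finset.sum_const, nsmul_eq_mul,
      Finset.card_range]
    gcongr
  calc _ ≤ _ := Finset.sum_le_sum fun m hm => hrow hm
    _ = (1 + c * M) * ∑ m ∈ Finset.range M, (m : ℝ)⁻¹ + 3 * c * M * (1 + Real.log M) := by
        simp only [Finset.sum_add_distrib, ← Finset.mul_sum, Finset.sum_const, nsmul_eq_mul,
          Finset.card_range]
        ring
    _ ≤ (1 + c * M) * (1 + Real.log M) + 3 * c * M * (1 + Real.log M) := by gcongr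
    _ = _ := by ring

theorem lerchTerm_add_mul_I (lam α σ t : ℝ) (n : ℕ) :
    lerchTerm lam α (σ + t * I) n
      = lerchTerm lam α σ n * Complex.exp (I * ((-t * Real.log ((n : ℝ) + α) : ℝ) : ℂ)) := by
  rw [lerchTerm, lerchTerm, ← Complex.exp_add]
  congr 1
  push_cast
  ring

theorem lerchTerm_mul_conj_lerchTerm (lam α σ t : ℝ) (m n : ℕ) :
    lerchTerm lam α (σ + t * I) m * starRingEnd ℂ (lerchTerm lam α (σ + t * I) n)
      = lerchTerm lam α σ m * starRingEnd ℂ (lerchTerm lam α σ n) * Complex.exp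
        (I * ((-t * (Real.log ((m : ℝ) + α) - Real.log ((n : ℝ) + α)) : ℝ) : ℂ)) := by
  rw [lerchTerm_add_mul_I, lerchTerm_add_mul_I, map_mul, ← Complex.exp_conj, mul_mul_mul_comm,
    ← Complex.exp_add]
  congr 2
  simp only [map_mul, Complex.conj_I, Complex.conj_ofReal]
  push_cast
  ring

@[fun_prop]
theorem continuous_lerchTerm (lam α σ : ℝ) (n : ℕ) :
    Continuous fun t : ℝ => lerchTerm lam α (σ + t * I) n := by
  unfold lerchTerm
  fun_prop

section MeanSquare

variable {lam α σ T : ℝ} (hα : 0 < α) {N M : ℕ}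

include hα in
theorem norm_lerchTerm_add_mul_I (t : ℝ) (n : ℕ) :
    ‖lerchTerm lam α (σ + t * I) n‖ = ((n : ℝ) + α) ^ (-σ) := by
  rw [norm_lerchTerm hα]
  simp

variable (hσ : 1 / 2 ≤ σ) (hN : 1 ≤ N)
include hα hσ hN

theorem norm_lerchTerm_mul_norm_lerchTerm_le {m n : ℕ} (hm : N ≤ m) (hn : N ≤ n) :
    ‖lerchTerm lam α σ m‖ * ‖lerchTerm lam α σ n‖
      ≤ (N : ℝ) ^ (1 - 2 * σ) * (√(((m : ℝ) + α) * ((n : ℝ) + α)))⁻¹ := by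
  have hN_one : (1 : ℝ) ≤ N := by exact_mod_cast hN
  have hterm {k : ℕ} (hk : N ≤ k) :
      ‖lerchTerm lam α σ k‖ ≤ (N : ℝ) ^ (1 / 2 - σ) * (√((k : ℝ) + α))⁻¹ := by
    have hk' : (N : ℝ) ≤ k := by exact_mod_cast hk
    have hpos : 0 < (k : ℝ) + α := by positivity
    rw [norm_lerchTerm hα, Complex.ofReal_re, show -σ = (1 / 2 - σ) + -(1 / 2) by ring,
      Real.rpow_add hpos, Real.rpow_neg hpos.le, Real.sqrt_eq_rpow]
    gcongr ?_ * _
    exact Real.rpow_le_rpow_of_nonpos (by linarith) (by linarith) (by linarith)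
  calc _ ≤ ((N : ℝ) ^ (1 / 2 - σ) * (√((m : ℝ) + α))⁻¹)
        * ((N : ℝ) ^ (1 / 2 - σ) * (√((n : ℝ) + α))⁻¹) := by
        gcongr
        exacts [hterm hm, hterm hn]
    _ = _ := by
        rw [mul_mul_mul_comm, ← mul_inv, ← Real.sqrt_mul (by positivity),
          ← Real.rpow_add (by linarith)]
        ring_nf

variable (hT : 0 < T)
include hT

theorem norm_correlation_le {m n : ℕ} (hm : N ≤ m) (hn : N ≤ n) :
    ‖∫ t, lerchTerm lam α (σ + t * I) m * starRingEnd ℂ (lerchTerm lam α (σ + t * I) n)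
        ∂(timeMeasure T)‖
      ≤ (N : ℝ) ^ (1 - 2 * σ) * ((if m = n then (n : ℝ)⁻¹ else 0)
        + 2 / T * (|(m : ℝ) - n|⁻¹ + (m : ℝ)⁻¹ + (n : ℝ)⁻¹)) := by
  have := isProbabilityMeasure_timeMeasure hT
  have hshift_inv {k : ℕ} (hk : N ≤ k) : ((k : ℝ) + α)⁻¹ ≤ (k : ℝ)⁻¹ := by
    have : (0 : ℝ) < k := by exact_mod_cast hN.trans hk
    gcongr
    linarith
  have hcoeff := norm_lerchTerm_mul_norm_lerchTerm_le (lam := lam) hα hσ hN hm hn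
  simp_rw [lerchTerm_mul_conj_lerchTerm]
  rw [integral_const_mul, norm_mul, norm_mul, Complex.norm_conj]
  rcases eq_or_ne m n with rfl | hmn
  · rw [Real.sqrt_mul_self (by positivity)] at hcoeff
    rw [if_pos rfl]
    simp only [sub_self, mul_zero, Complex.ofReal_zero, Complex.exp_zero, integral_const,
      probReal_univ, one_smul, norm_one, mul_one]
    refine hcoeff.trans ?_
    gcongr
    exact (hshift_inv hm).trans (le_add_of_nonneg_right (by positivity))
  have hm_pos : 0 < (m : ℝ) + α := by positivity
  have hn_pos : 0 < (n : ℝ) + α := by positivity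
  have hne : (m : ℝ) + α ≠ n + α := fun h => hmn (by exact_mod_cast add_right_cancel h)
  have hkernel := inv_sqrt_mul_abs_log_sub_le hm_pos hn_pos hne
  rw [add_sub_add_right_eq_sub, mul_inv] at hkernel
  have hlog_ne := sub_ne_zero.2 ((Real.log_injOn_pos.ne_iff hm_pos hn_pos).2 hne)
  rw [if_neg hmn, zero_add]
  calc _ ≤ (N : ℝ) ^ (1 - 2 * σ) * (√(((m : ℝ) + α) * ((n : ℝ) + α)))⁻¹
        * (2 / (T * |Real.log ((m : ℝ) + α) - Real.log ((n : ℝ) + α)|)) :=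
        mul_le_mul hcoeff (norm_integral_time_character_le hT hlog_ne) (norm_nonneg _)
          (by positivity)
    _ = (N : ℝ) ^ (1 - 2 * σ) * (2 / T * ((√(((m : ℝ) + α) * ((n : ℝ) + α)))⁻¹
        * |Real.log ((m : ℝ) + α) - Real.log ((n : ℝ) + α)|⁻¹)) := by
        rw [div_mul_eq_div_div]
        ring
    _ ≤ _ := by
        gcongr
        exact hkernel.trans (add_le_add_three le_rfl (hshift_inv hm) (hshift_inv hn))

theorem integral_norm_sq_sum_lerchTerm_le :
    ∫ t, ‖∑ n ∈ Finset.Ico N M, lerchTerm lam α (σ + t * I) n‖ ^ 2 ∂(timeMeasure T)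
      ≤ (N : ℝ) ^ (1 - 2 * σ) * (8 * (1 + M / T) * (1 + Real.log M)) := by
  have hinteg (m n : ℕ) : Integrable (fun t : ℝ => lerchTerm lam α (σ + t * I) m
      * starRingEnd ℂ (lerchTerm lam α (σ + t * I) n)) (timeMeasure T) := by
    refine Integrable.of_bound (Continuous.aestronglyMeasurable (by fun_prop))
      (((m : ℝ) + α) ^ (-σ) * ((n : ℝ) + α) ^ (-σ)) (Eventually.of_forall fun t => ?_)
    rw [norm_mul, Complex.norm_conj, norm_lerchTerm_add_mul_I hα, norm_lerchTerm_add_mul_I hα]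
  have hsubset : Finset.Ico N M ⊆ Finset.range M := fun n hn =>
    Finset.mem_range.2 (Finset.mem_Ico.1 hn).2
  have hkernel_nonneg (m n : ℕ) : 0 ≤ (if m = n then (n : ℝ)⁻¹ else 0)
      + 2 / T * (|(m : ℝ) - n|⁻¹ + (m : ℝ)⁻¹ + (n : ℝ)⁻¹) := by
    split_ifs <;> positivity
  have : 0 ≤ Real.log M := Real.log_natCast_nonneg M
  calc _ ≤ ∑ m ∈ Finset.Ico N M, ∑ n ∈ Finset.Ico N M, (N : ℝ) ^ (1 - 2 * σ) *
        ((if m = n then (n : ℝ)⁻¹ else 0) + 2 / T * (|(m : ℝ) - n|⁻¹ + (m : ℝ)⁻¹ + (n : ℝ)⁻¹)) :=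
        (integral_norm_sq_sum_le _ fun m _ n _ => hinteg m n).trans
          (Finset.sum_le_sum fun m hm => Finset.sum_le_sum fun n hn => norm_correlation_le hα hσ hN
            hT (Finset.mem_Ico.1 hm).1 (Finset.mem_Ico.1 hn).1)
    _ ≤ (N : ℝ) ^ (1 - 2 * σ) * ∑ m ∈ Finset.range M, ∑ n ∈ Finset.range M,
        ((if m = n then (n : ℝ)⁻¹ else 0) + 2 / T * (|(m : ℝ) - n|⁻¹ + (m : ℝ)⁻¹ + (n : ℝ)⁻¹)) := by
        simp_rw [← Finset.mul_sum]
        gcongr (N : ℝ) ^ (1 - 2 * σ) * ?_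
        refine (Finset.sum_le_sum fun m _ => Finset.sum_le_sum_of_subset_of_nonneg hsubset
          fun n _ _ => hkernel_nonneg m n).trans
            (Finset.sum_le_sum_of_subset_of_nonneg hsubset fun m _ _ =>
              Finset.sum_nonneg fun n _ => hkernel_nonneg m n)
    _ ≤ (N : ℝ) ^ (1 - 2 * σ) * ((1 + 4 * (2 / T) * M) * (1 + Real.log M)) := by
        gcongr
        exact sum_sum_kernel_le M (by positivity)
    _ ≤ _ := by
        gcongr
        have : 4 * (2 / T) * M = 8 * (M / T) := by ring
        linarith

theorem integral_norm_sum_lerchTerm_le :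
    ∫ t, ‖∑ n ∈ Finset.Ico N M, lerchTerm lam α (σ + t * I) n‖ ∂(timeMeasure T)
      ≤ (N : ℝ) ^ (1 / 2 - σ) * (8 * (1 + M / T) * (1 + Real.log M)) := by
  have := isProbabilityMeasure_timeMeasure hT
  have hN_pos : (0 : ℝ) < N := by exact_mod_cast hN
  have hlog := Real.log_natCast_nonneg M
  have hmemLp : MemLp (fun t : ℝ => ∑ n ∈ Finset.Ico N M, lerchTerm lam α (σ + t * I) n) 2
      (timeMeasure T) := by
    refine MemLp.of_bound (Continuous.aestronglyMeasurable (by fun_prop))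
      (∑ n ∈ Finset.Ico N M, ((n : ℝ) + α) ^ (-σ)) (Eventually.of_forall fun t => ?_)
    exact norm_sum_le_of_le _ fun n _ => (norm_lerchTerm_add_mul_I hα t n).le
  have hone : 1 ≤ 8 * (1 + M / T) * (1 + Real.log M) := by
    have : 0 ≤ M / T := by positivity
    nlinarith [mul_nonneg this hlog]
  refine le_of_sq_le_sq ?_ (by positivity)
  calc _ ≤ (N : ℝ) ^ (1 - 2 * σ) * (8 * (1 + M / T) * (1 + Real.log M)) :=
        (sq_integral_norm_le hmemLp).trans (integral_norm_sq_sum_lerchTerm_le hα hσ hN hT)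
    _ ≤ (N : ℝ) ^ (1 - 2 * σ) * (8 * (1 + M / T) * (1 + Real.log M)) ^ 2 := by
        gcongr
        exact le_self_pow₀ hone two_ne_zero
    _ = _ := by
        rw [mul_pow ((N : ℝ) ^ (1 / 2 - σ)), ← Real.rpow_mul_natCast hN_pos.le]
        congr 2
        push_cast
        ring

end MeanSquare

/-! ### Truncation of the Lerch zeta-function -/

theorem lerchTerm_intCast (k : ℤ) (α : ℝ) (s : ℂ) (n : ℕ) :
    lerchTerm k α s n = lerchTerm 0 α s n := by
  have hperiod : Complex.exp (2 * π * I * ((k : ℝ) : ℂ) * n) = 1 := by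
    rw [← Complex.exp_int_mul_two_pi_mul_I (k * n)]
    congr 1
    push_cast
    ring
  simp only [lerchTerm, Complex.exp_sub, hperiod, Complex.ofReal_zero, mul_zero, zero_mul,
    Complex.exp_zero]

theorem norm_one_sub_cexp_two_pi_pos {lam : ℝ} (hlam : ¬ ∃ k : ℤ, (k : ℝ) = lam) :
    0 < ‖1 - Complex.exp (2 * π * I * lam)‖ := by
  rw [norm_pos_iff, sub_ne_zero]
  intro hexp
  obtain ⟨k, hk⟩ := Complex.exp_eq_one_iff.1 hexp.symm
  rw [mul_comm (k : ℂ)] at hk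
  exact hlam ⟨k, by exact_mod_cast (mul_left_cancel₀ Complex.two_pi_I_ne_zero hk).symm⟩

theorem tendsto_sum_lerchTerm_lerchZeta {lam α : ℝ} (hlam : ¬ ∃ k : ℤ, (k : ℝ) = lam) (hα : 0 < α)
    {s : ℂ} (hs : 0 < s.re) :
    Tendsto (fun N => ∑ n ∈ Finset.range N, lerchTerm lam α s n) atTop
      (𝓝 (lerchZeta lam α s)) := by
  obtain ⟨L, hL⟩ :=
    exists_tendsto_sum_lerchTerm hα hs (norm_one_sub_cexp_two_pi_pos hlam) le_rfl
  rw [lerchZeta, if_neg hlam]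
  simp_rw [lerchTerm_eq hα]
  rwa [hL.limUnder_eq]

theorem aestronglyMeasurable_lerchZeta (lam : ℝ) {α σ : ℝ} (hα : 0 < α) (hσ : 0 < σ) (T : ℝ) :
    AEStronglyMeasurable (fun t : ℝ => lerchZeta lam α (σ + t * I)) (timeMeasure T) := by
  by_cases hlam : ∃ k : ℤ, (k : ℝ) = lam
  · refine AEStronglyMeasurable.smul_measure
      (ContinuousOn.aestronglyMeasurable (fun t ht => ?_) measurableSet_Ioc) _
    have hne : (σ + t * I : ℂ) ≠ 1 := fun h => ht.1.ne' (by simpa using congrArg Complex.im h)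
    simp_rw [lerchZeta, if_pos hlam]
    exact (ContinuousAt.comp (f := fun t : ℝ => (σ + t * I : ℂ))
      (HurwitzZeta.differentiableAt_hurwitzZeta _ hne).continuousAt
      (Continuous.continuousAt (by fun_prop))).continuousWithinAt
  · exact aestronglyMeasurable_of_tendsto_ae atTop
      (fun N => Continuous.aestronglyMeasurable (by fun_prop))
      (Eventually.of_forall fun t => tendsto_sum_lerchTerm_lerchZeta hlam hα (by simpa using hσ))

theorem mul_rpow_neg_le_sqrt_div {b t σ : ℝ} (hσ : 1 / 2 ≤ σ) (ht : 0 < t) {M : ℕ} (hM : 1 ≤ M)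
    (hbM : b * t ≤ M) : b * (M : ℝ) ^ (-σ) ≤ √M / t := by
  have hM_one : (1 : ℝ) ≤ M := by exact_mod_cast hM
  have hpow : (M : ℝ) ^ (-σ) ≤ (√M)⁻¹ := by
    rw [Real.sqrt_eq_rpow, ← Real.rpow_neg (by positivity)]
    exact Real.rpow_le_rpow_of_exponent_le hM_one (by linarith)
  calc b * (M : ℝ) ^ (-σ) ≤ M / t * (M : ℝ) ^ (-σ) := by
        gcongr
        exact (le_div_iff₀ ht).2 hbM
    _ ≤ M / t * (√M)⁻¹ := by gcongr
    _ = √M / t := by rw [div_mul_eq_mul_div, ← div_eq_mul_inv, Real.div_sqrt]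

/-- Partial sums of length at least `A * t` approximate `lerchZeta lam α (σ + t * I)` with error
`3 * √M / t`, uniformly in `α ∈ (0, 1]` and `σ ∈ [1 / 2, σ₁]`. -/
structure IsTruncationConstant (lam σ₁ A : ℝ) : Prop where
  one_le : 1 ≤ A
  norm_lerchZeta_sub_sum_le : ∀ {α σ t : ℝ}, 0 < α → α ≤ 1 → 1 / 2 ≤ σ → σ ≤ σ₁ → 1 ≤ t →
    ∀ {M : ℕ}, A * t ≤ M →
      ‖lerchZeta lam α (σ + t * I) - ∑ n ∈ Finset.range M, lerchTerm lam α (σ + t * I) n‖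
        ≤ 3 * (√M / t)

theorem norm_add_mul_I_le {σ σ₁ t : ℝ} (hσ : 0 ≤ σ) (hσ₁ : σ ≤ σ₁) (ht : 1 ≤ t) :
    ‖(σ + t * I : ℂ)‖ ≤ (σ₁ + 1) * t := by
  calc ‖(σ + t * I : ℂ)‖ ≤ σ + t := by
        refine (norm_add_le _ _).trans_eq ?_
        rw [norm_mul, Complex.norm_I, mul_one, Complex.norm_of_nonneg hσ,
          Complex.norm_of_nonneg (by linarith)]
    _ ≤ (σ₁ + 1) * t := by nlinarith

theorem isTruncationConstant_intCast (k : ℤ) (σ₁ : ℝ) :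
    IsTruncationConstant k σ₁ (max 224 (2 * (σ₁ + 1))) where
  one_le := le_max_of_le_left (by norm_num)
  norm_lerchZeta_sub_sum_le {α σ t} hα hα1 hσ hσ₁ ht {M} hM := by
    have hM_224 : 224 * t ≤ M := le_trans (by gcongr; exact le_max_left _ _) hM
    have hM_one : 1 ≤ M := by
      have : (1 : ℝ) ≤ M := by linarith
      exact_mod_cast this
    have hMs : 2 * ‖(σ + t * I : ℂ)‖ ≤ M := calc
      2 * ‖(σ + t * I : ℂ)‖ ≤ 2 * ((σ₁ + 1) * t) := by
          gcongr
          exact norm_add_mul_I_le (by linarith) hσ₁ ht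
      _ = 2 * (σ₁ + 1) * t := by ring
      _ ≤ max 224 (2 * (σ₁ + 1)) * t := by gcongr; exact le_max_right _ _
      _ ≤ M := hM
    have happrox := norm_hurwitzZeta_sub_sum_le hα hα1 (by simpa using hσ) (by simpa using ht)
      hM_one hMs
    have hhead := mul_rpow_neg_le_sqrt_div hσ (by linarith) hM_one hM_224
    have hmain : (M : ℝ) * (M : ℝ) ^ (-σ) ≤ √M / 1 :=
      mul_rpow_neg_le_sqrt_div hσ one_pos hM_one (mul_one _).le
    have hre : (σ + t * I : ℂ).re = σ := by simp
    have him : (σ + t * I : ℂ).im = t := by simp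
    simp_rw [lerchZeta, if_pos (⟨k, rfl⟩ : ∃ m : ℤ, (m : ℝ) = k), lerchTerm_intCast k]
    calc _ ≤ 224 * (M : ℝ) ^ (-σ) + 2 * M * (M : ℝ) ^ (-σ) / t := by rwa [hre, him] at happrox
      _ = 224 * (M : ℝ) ^ (-σ) + 2 * (M * (M : ℝ) ^ (-σ) / t) := by ring
      _ ≤ √M / t + 2 * (√M / 1 / t) := by gcongr
      _ = 3 * (√M / t) := by ring

theorem isTruncationConstant_of_not_intCast {lam : ℝ} (hlam : ¬ ∃ k : ℤ, (k : ℝ) = lam) (σ₁ : ℝ) :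
    IsTruncationConstant lam σ₁
      (max 1 (max 16 (4 * (σ₁ + 1)) / ‖1 - Complex.exp (2 * π * I * lam)‖)) where
  one_le := le_max_left _ _
  norm_lerchZeta_sub_sum_le {α σ t} hα _ hσ hσ₁ ht {M} hM := by
    set c := ‖1 - Complex.exp (2 * π * I * lam)‖
    have hc : 0 < c := norm_one_sub_cexp_two_pi_pos hlam
    have hM_one : 1 ≤ M := by
      have : 1 * t ≤ (M : ℝ) := le_trans (by gcongr; exact le_max_left _ _) hM
      have : (1 : ℝ) ≤ M := by linarith
      exact_mod_cast this
    have hM_of_le {b : ℝ} (hb : b ≤ max 16 (4 * (σ₁ + 1))) : b / c * t ≤ M := by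
      refine le_trans ?_ hM
      gcongr
      exact le_max_of_le_right (by gcongr)
    have hMs : 4 * ‖(σ + t * I : ℂ)‖ / c ≤ M := calc
      4 * ‖(σ + t * I : ℂ)‖ / c ≤ 4 * ((σ₁ + 1) * t) / c := by
          gcongr
          exact norm_add_mul_I_le (by linarith) hσ₁ ht
      _ = 4 * (σ₁ + 1) / c * t := by ring
      _ ≤ M := hM_of_le (le_max_right _ _)
    have hre : (σ + t * I : ℂ).re = σ := by simp
    have hre_pos : 0 < (σ + t * I : ℂ).re := by rw [hre]; linarith
    have hinv : σ⁻¹ ≤ 2 := inv_le_of_inv_le₀ two_pos (by linarith)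
    have happrox := norm_limit_sub_sum_le hα hre_pos hc le_rfl
      (tendsto_sum_lerchTerm_lerchZeta hlam hα hre_pos) hM_one hMs
    rw [hre] at happrox
    calc _ ≤ (2 + σ⁻¹) * (4 / c) * (M : ℝ) ^ (-σ) := happrox
      _ ≤ (2 + 2) * (4 / c) * (M : ℝ) ^ (-σ) := by gcongr
      _ = 16 / c * (M : ℝ) ^ (-σ) := by ring
      _ ≤ √M / t :=
        mul_rpow_neg_le_sqrt_div hσ (by linarith) hM_one (hM_of_le (le_max_left _ _))
      _ ≤ 3 * (√M / t) := le_mul_of_one_le_left (by positivity) (by norm_num)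

theorem exists_isTruncationConstant (lam σ₁ : ℝ) : ∃ A, IsTruncationConstant lam σ₁ A := by
  by_cases hlam : ∃ k : ℤ, (k : ℝ) = lam
  · obtain ⟨k, rfl⟩ := hlam
    exact ⟨_, isTruncationConstant_intCast k σ₁⟩
  · exact ⟨_, isTruncationConstant_of_not_intCast hlam σ₁⟩

theorem norm_integral_psi_sub_le {Ω : Type*} [MeasurableSpace Ω] {μ : Measure Ω}
    [IsFiniteMeasure μ] {f g : Ω → ℂ} (hf : AEStronglyMeasurable f μ)
    (hg : AEStronglyMeasurable g μ) {B : Set Ω} (hB : MeasurableSet B) {h : Ω → ℝ}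
    (hh : Integrable h μ) (hh_nonneg : 0 ≤ h) (hfg : ∀ᵐ ω ∂μ, ω ∉ B → ‖f ω - g ω‖ ≤ h ω) (z : ℂ) :
    ‖(∫ ω, psi z (f ω) ∂μ) - ∫ ω, psi z (g ω) ∂μ‖ ≤ 2 * μ.real B + ‖z‖ * ∫ ω, h ω ∂μ := by
  have hpsi_integrable {f : Ω → ℂ} (hf : AEStronglyMeasurable f μ) :
      Integrable (fun ω => psi z (f ω)) μ :=
    .of_bound ((continuous_psi z).comp_aestronglyMeasurable hf) 1
      (Eventually.of_forall fun _ => (norm_psi _ _).le)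
  have hind_integrable : Integrable (B.indicator fun _ => (2 : ℝ)) μ :=
    (integrable_const _).indicator hB
  have hbound : ∀ᵐ ω ∂μ, ‖psi z (f ω) - psi z (g ω)‖
      ≤ B.indicator (fun _ => 2) ω + ‖z‖ * h ω := by
    filter_upwards [hfg] with ω hω
    have hzh : 0 ≤ ‖z‖ * h ω := mul_nonneg (norm_nonneg z) (hh_nonneg ω)
    by_cases hωB : ω ∈ B
    · rw [Set.indicator_of_mem hωB]
      refine (norm_sub_le _ _).trans ?_
      rw [norm_psi, norm_psi]
      linarith
    · rw [Set.indicator_of_notMem hωB, zero_add]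
      exact (norm_psi_sub_le _ _ _).trans (by gcongr; exact hω hωB)
  rw [← integral_sub (hpsi_integrable hf) (hpsi_integrable hg)]
  refine (norm_integral_le_of_norm_le (hind_integrable.add (hh.const_mul _)) hbound).trans_eq ?_
  simp only [Pi.add_apply]
  rw [integral_add hind_integrable (hh.const_mul _), integral_indicator_const _ hB,
    integral_const_mul, smul_eq_mul, mul_comm (μ.real B)]

theorem timeMeasure_real_Iic {T t₀ : ℝ} (hT : 0 < T) (ht₀ : 0 ≤ t₀) (ht₀T : t₀ ≤ T) :
    (timeMeasure T).real (Set.Iic t₀) = t₀ / T := by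
  rw [timeMeasure, measureReal_ennreal_smul_apply, measureReal_restrict_apply measurableSet_Iic,
    Set.Iic_inter_Ioc_of_le ht₀T, Real.volume_real_Ioc_of_le ht₀,
    ENNReal.toReal_ofReal (by positivity)]
  ring

theorem norm_mean_psi_lerchZeta_sub_le {lam σ₁ A α σ T t₀ : ℝ} (hA : IsTruncationConstant lam σ₁ A)
    (hα : 0 < α) (hα1 : α ≤ 1) (hσ : 1 / 2 ≤ σ) (hσ₁ : σ ≤ σ₁) (ht₀ : 1 ≤ t₀) (ht₀T : t₀ ≤ T)
    {N M : ℕ} (hN : 1 ≤ N) (hNM : N ≤ M) (hM : A * T ≤ M) (z : ℂ) :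
    ‖(∫ t, psi z (lerchZeta lam α (σ + t * I)) ∂(timeMeasure T))
        - ∫ t, psi z (∑ n ∈ Finset.range N, lerchTerm lam α (σ + t * I) n) ∂(timeMeasure T)‖
      ≤ 2 * (t₀ / T) + ‖z‖ * (3 * (√M / t₀)
        + (N : ℝ) ^ (1 / 2 - σ) * (8 * (1 + M / T) * (1 + Real.log M))) := by
  have hT : 0 < T := by linarith
  have := isProbabilityMeasure_timeMeasure hT
  set Q : ℝ → ℂ := fun t => ∑ n ∈ Finset.Ico N M, lerchTerm lam α (σ + t * I) n
  have hQ_cont : Continuous Q := by fun_prop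
  have hQ_integrable : Integrable (fun t => ‖Q t‖) (timeMeasure T) :=
    .of_bound hQ_cont.norm.aestronglyMeasurable (∑ n ∈ Finset.Ico N M, ((n : ℝ) + α) ^ (-σ))
      (Eventually.of_forall fun t => by
        rw [norm_norm]
        exact norm_sum_le_of_le _ fun n _ => (norm_lerchTerm_add_mul_I hα t n).le)
  have happrox : ∀ᵐ t ∂(timeMeasure T), t ∉ Set.Iic t₀ →
      ‖lerchZeta lam α (σ + t * I) - ∑ n ∈ Finset.range N, lerchTerm lam α (σ + t * I) n‖
        ≤ 3 * (√M / t₀) + ‖Q t‖ := by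
    have hmem : ∀ᵐ t ∂(timeMeasure T), t ∈ Set.Ioc 0 T :=
      Measure.ae_smul_measure (ae_restrict_mem measurableSet_Ioc) _
    filter_upwards [hmem] with t ht ht₀t
    rw [Set.mem_Iic, not_le] at ht₀t
    have hAt : A * t ≤ M :=
      (mul_le_mul_of_nonneg_left ht.2 (zero_le_one.trans hA.one_le)).trans hM
    have hlong := hA.norm_lerchZeta_sub_sum_le hα hα1 hσ hσ₁ (by linarith) hAt
    calc _ = ‖(lerchZeta lam α (σ + t * I) - ∑ n ∈ Finset.range M, lerchTerm lam α (σ + t * I) n)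
          + Q t‖ := by rw [← Finset.sum_range_add_sum_Ico _ hNM, sub_add_eq_sub_sub, sub_add_cancel]
      _ ≤ 3 * (√M / t) + ‖Q t‖ := (norm_add_le _ _).trans (by gcongr)
      _ ≤ 3 * (√M / t₀) + ‖Q t‖ := by gcongr
  refine (norm_integral_psi_sub_le (h := fun t => 3 * (√M / t₀) + ‖Q t‖)
    (aestronglyMeasurable_lerchZeta lam hα (by linarith) T)
    (Continuous.aestronglyMeasurable (by fun_prop)) measurableSet_Iic
    ((integrable_const _).add hQ_integrable) (fun t => by positivity) happrox z).trans ?_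
  rw [timeMeasure_real_Iic hT (by linarith) ht₀T, integral_add (integrable_const _) hQ_integrable,
    integral_const, probReal_univ, one_smul]
  gcongr
  exact integral_norm_sum_lerchTerm_le hα hσ hN hT

/-! ### The mean value over a partial sum -/

theorem psi_sum_lerchTerm (lam α σ t : ℝ) (N : ℕ) (z : ℂ) :
    psi z (∑ n ∈ Finset.range N, lerchTerm lam α (σ + t * I) n)
      = Complex.exp (I * trigSum (fun n : Fin N => starRingEnd ℂ z * lerchTerm lam α σ n)
        fun n => -t * Real.log (((n : ℕ) : ℝ) + α)) := by
  rw [psi, trigSum]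
  congr 3
  rw [← Complex.conj_re, map_mul, Complex.conj_conj, Finset.mul_sum, Complex.re_sum,
    Finset.sum_range]
  refine Finset.sum_congr rfl fun n _ => ?_
  rw [lerchTerm_add_mul_I, mul_assoc]

/-- The lower bound for signed sums of `log (n + α)` in `Admissible`, with exponent `Ω`, for the
indices `n ≤ X`. -/
def HasSpacing (α Ω X : ℝ) : Prop :=
  ∀ (N : ℕ) (n : Fin N → ℕ) (ε : Fin N → ℝ),
    (∀ j, (n j : ℝ) ≤ X) → (∀ j, ε j = 1 ∨ ε j = -1) →
    ∑ j, ε j * Real.log ((n j : ℝ) + α) ≠ 0 →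
    X ^ (-(Ω * (N : ℝ) ^ 2)) ≤ |∑ j, ε j * Real.log ((n j : ℝ) + α)|

theorem HasSpacing.inv_rpow_le_abs_signedSum {α Ω X : ℝ} (h : HasSpacing α Ω X) (hΩ : 0 ≤ Ω)
    (hX : 1 ≤ X) {N : ℕ} (hN : (N : ℝ) ≤ X + 1) {k m : ℕ} (hkm : k ≤ m) (p : Fin k → Fin N × Bool)
    (hp : signedSum p (fun n => Real.log (((n : ℕ) : ℝ) + α)) ≠ 0) :
    (X ^ (Ω * (m : ℝ) ^ 2))⁻¹ ≤ |signedSum p fun n => Real.log (((n : ℕ) : ℝ) + α)| := by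
  have hindex (j : Fin k) : (((p j).1 : ℕ) : ℝ) ≤ X := by
    have : (((p j).1 : ℕ) : ℝ) + 1 ≤ N := by exact_mod_cast (p j).1.2
    linarith
  have hsign (j : Fin k) : (boolSign (p j).2 : ℝ) = 1 ∨ (boolSign (p j).2 : ℝ) = -1 := by
    cases (p j).2 <;> simp [boolSign]
  calc (X ^ (Ω * (m : ℝ) ^ 2))⁻¹ = X ^ (-(Ω * (m : ℝ) ^ 2)) := (Real.rpow_neg (by linarith) _).symm
    _ ≤ X ^ (-(Ω * (k : ℝ) ^ 2)) := Real.rpow_le_rpow_of_exponent_le hX (by gcongr)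
    _ ≤ _ := h k (fun j => (p j).1) (fun j => boolSign (p j).2) hindex hsign hp

theorem norm_mean_psi_sum_sub_prod_le {α Ω X : ℝ} (hα : 0 < α)
    (hind : LinearIndependent ℚ fun n : ℕ => Real.log ((n : ℝ) + α)) (hsp : HasSpacing α Ω X)
    (hΩ : 0 ≤ Ω) (hX : 1 ≤ X) {T : ℝ} (hT : 0 < T) (lam σ : ℝ) {N : ℕ} (hN : (N : ℝ) ≤ X + 1)
    (K : ℕ) {y : ℝ} (hy : 0 < y) (z : ℂ) :
    ‖(∫ t, psi z (∑ n ∈ Finset.range N, lerchTerm lam α (σ + t * I) n) ∂(timeMeasure T))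
        - ∏ n ∈ Finset.range N, (besselJ0 (‖z‖ * ((n : ℝ) + α) ^ (-σ)) : ℂ)‖
      ≤ (2 * K + 1) * ((1 + ‖z‖ * ∑ n ∈ Finset.range N, ((n : ℝ) + α) ^ (-σ)) ^ (2 * K)
          * (2 * X ^ (Ω * ((2 * K : ℕ) : ℝ) ^ 2) / T))
        + 2 * (2 * (y ^ (2 * K))⁻¹ * Real.exp
          (y ^ 2 * (‖z‖ ^ 2 * ∑ n ∈ Finset.range N, (((n : ℝ) + α) ^ (-σ)) ^ 2) / 4)) := by
  have hnorm (n : Fin N) : ‖starRingEnd ℂ z * lerchTerm lam α σ n‖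
      = ‖z‖ * (((n : ℕ) : ℝ) + α) ^ (-σ) := by
    rw [norm_mul, Complex.norm_conj, norm_lerchTerm hα, Complex.ofReal_re]
  have hmean := norm_mean_cexp_trigSum_sub_prod_le (hind.comp _ Fin.val_injective) hT
    (Real.rpow_pos_of_pos (by linarith) _) (fun n : Fin N => starRingEnd ℂ z * lerchTerm lam α σ n)
    K hy fun k hk p hp => hsp.inv_rpow_le_abs_signedSum hΩ hX hN hk p hp
  simp_rw [hnorm, mul_pow, ← Finset.mul_sum] at hmean
  simp_rw [psi_sum_lerchTerm]
  rw [Finset.sum_range, Finset.sum_range, Finset.prod_range]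
  exact hmean

theorem sum_rpow_neg_le {α σ : ℝ} (hα : 0 < α) (hσ : 0 ≤ σ) (N : ℕ) :
    ∑ n ∈ Finset.range N, ((n : ℝ) + α) ^ (-σ) ≤ N * α ^ (-σ) := by
  refine (Finset.sum_le_card_nsmul _ _ (α ^ (-σ)) fun n _ => ?_).trans (by simp)
  exact Real.rpow_le_rpow_of_nonpos hα (le_add_of_nonneg_left n.cast_nonneg)
    (neg_nonpos.2 hσ)

theorem sum_range_radius_sq_le {α σ : ℝ} (hα : 0 < α) (hσ : 1 / 2 < σ) {N : ℕ} (hN : 1 ≤ N) :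
    ∑ n ∈ Finset.range N, (((n : ℝ) + α) ^ (-σ)) ^ 2
      ≤ α ^ (-(2 * σ)) + (1 + 1 / (2 * σ - 1)) := by
  rw [← Finset.sum_range_add_sum_Ico _ hN, Finset.sum_range_one, Nat.cast_zero, zero_add,
    rpow_neg_sq hα.le]
  gcongr
  simpa using sum_Ico_radius_sq_le hα hσ le_rfl N

/-! ### The three error terms -/

section ErrorTerms

variable {x : ℝ}

theorem ceil_mul_exp_le {A : ℝ} (hA : 1 ≤ A) (hAx : 4 * A ≤ x) :
    (⌈A * Real.exp x⌉₊ : ℝ) ≤ x * Real.exp x := by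
  have hexp : 1 ≤ Real.exp x := Real.one_le_exp (by linarith)
  calc (⌈A * Real.exp x⌉₊ : ℝ) ≤ A * Real.exp x + 1 := (Nat.ceil_lt_add_one (by positivity)).le
    _ ≤ 4 * A * Real.exp x := by nlinarith
    _ ≤ x * Real.exp x := by gcongr

theorem sqrt_div_exp_le {M : ℝ} (hx : 1 ≤ x) (hM : M ≤ x * Real.exp x) :
    √M / Real.exp (3 * x / 4) ≤ x * Real.exp (-(x / 8)) ^ 2 := by
  rw [div_le_iff₀ (Real.exp_pos _)]
  calc √M ≤ √(x * Real.exp x) := Real.sqrt_le_sqrt hM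
    _ = √x * Real.exp (x / 2) := by rw [Real.sqrt_mul (by linarith), Real.exp_half]
    _ ≤ x * Real.exp (x / 2) := by
        gcongr
        exact Real.sqrt_le_left (by linarith) |>.2 (by nlinarith)
    _ = x * Real.exp (-(x / 8)) ^ 2 * Real.exp (3 * x / 4) := by
        rw [mul_assoc, ← Real.exp_nat_mul, ← Real.exp_add]
        congr 2
        push_cast
        ring

theorem mean_square_factor_le {M : ℝ} (hx : 4 ≤ x) (hM : 1 ≤ M) (hMx : M ≤ x * Real.exp x) :
    8 * (1 + M / Real.exp x) * (1 + Real.log M) ≤ 24 * x ^ 2 := by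
  have hquot : M / Real.exp x ≤ x := (div_le_iff₀ (Real.exp_pos _)).2 hMx
  have hlog_nonneg : 0 ≤ Real.log M := Real.log_nonneg hM
  have hlog : Real.log M ≤ 2 * x := calc
    Real.log M ≤ Real.log (x * Real.exp x) := Real.log_le_log (by linarith) hMx
    _ = Real.log x + x := by rw [Real.log_mul (by linarith) (Real.exp_pos _).ne', Real.log_exp]
    _ ≤ 2 * x := by linarith [Real.log_le_self (by linarith : 0 ≤ x)]
  calc 8 * (1 + M / Real.exp x) * (1 + Real.log M) ≤ 8 * (1 + x) * (1 + 2 * x) := by gcongr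
    _ ≤ 24 * x ^ 2 := by nlinarith

theorem truncation_error_le {A ζ G : ℝ} {N : ℕ} {σ : ℝ} (hA : 1 ≤ A) (hAx : 4 * A ≤ x)
    (hζ : ζ ≤ x) (hGx : Real.exp (-(x / 8)) ≤ G) (hx_sq : x ^ 2 ≤ Real.exp (x / 8))
    (hxG : x ^ 3 * G ≤ 1) (hN : (N : ℝ) ^ (1 / 2 - σ) ≤ G ^ 2) :
    2 * (Real.exp (3 * x / 4) / Real.exp x)
        + ζ * (3 * (√(⌈A * Real.exp x⌉₊ : ℝ) / Real.exp (3 * x / 4))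
          + (N : ℝ) ^ (1 / 2 - σ) * (8 * (1 + (⌈A * Real.exp x⌉₊ : ℝ) / Real.exp x)
            * (1 + Real.log (⌈A * Real.exp x⌉₊ : ℝ)))) ≤ 29 * G := by
  have hexp : 1 ≤ Real.exp x := Real.one_le_exp (by linarith)
  have hM := ceil_mul_exp_le hA hAx
  have hM_one : 1 ≤ (⌈A * Real.exp x⌉₊ : ℝ) := by
    have := Nat.le_ceil (A * Real.exp x)
    nlinarith
  have := Real.log_nonneg hM_one
  have hmean := mean_square_factor_le (by linarith) hM_one hM
  have hsqrt := sqrt_div_exp_le (by linarith) hM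
  have hquot : Real.exp (3 * x / 4) / Real.exp x = Real.exp (-(x / 8)) ^ 2 := by
    rw [← Real.exp_sub, ← Real.exp_nat_mul]
    congr 1
    push_cast
    ring
  rw [hquot]
  set u := Real.exp (-(x / 8)) with hu
  have hu_pos : 0 < u := Real.exp_pos _
  have hu_one : u ≤ 1 := Real.exp_le_one_iff.2 (by linarith)
  have hG : 0 ≤ G := hu_pos.le.trans hGx
  have hxu : x ^ 2 * u ≤ 1 := by
    rw [hu, Real.exp_neg, mul_inv_le_iff₀ (Real.exp_pos _), one_mul]
    exact hx_sq
  calc _ ≤ 2 * u ^ 2 + x * (3 * (x * u ^ 2) + G ^ 2 * (24 * x ^ 2)) := by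
        gcongr
        linarith
    _ = (2 * u + 3 * (x ^ 2 * u)) * u + 24 * (x ^ 3 * G) * G := by ring
    _ ≤ (2 * 1 + 3 * 1) * G + 24 * 1 * G := by gcongr
    _ = 29 * G := by ring

theorem moment_error_le {Ω L ζ R : ℝ} {K N : ℕ} (hL : 1 ≤ L) (hx : 1 ≤ x)
    (hLx : 3 * x ^ 2 ≤ Real.exp L) (hK : 1 ≤ K) (hN : (N : ℝ) ≤ Real.exp L + 1) (hζ : 0 ≤ ζ)
    (hζx : ζ ≤ x) (hR : 0 ≤ R) (hRN : R ≤ N * x) (hKx : 4 * (Ω + 2) * (K ^ 2 * L) ≤ x / 2) :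
    (2 * K + 1) * ((1 + ζ * R) ^ (2 * K)
        * (2 * Real.exp L ^ (Ω * ((2 * K : ℕ) : ℝ) ^ 2) / Real.exp x))
      ≤ 2 * Real.exp (-(x / 2)) := by
  have hK_one : (1 : ℝ) ≤ K := by exact_mod_cast hK
  have hexpL : 1 ≤ Real.exp L := Real.one_le_exp (by linarith)
  have hbase : 1 + ζ * R ≤ Real.exp (2 * L) := calc
    1 + ζ * R ≤ 1 + x * ((Real.exp L + 1) * x) := by gcongr; exact hRN.trans (by gcongr)
    _ ≤ 3 * x ^ 2 * Real.exp L := by nlinarith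
    _ ≤ Real.exp L * Real.exp L := by gcongr
    _ = Real.exp (2 * L) := by rw [← Real.exp_add, two_mul]
  have hexponent : 2 * K + 4 * (L * K) + 4 * (Ω * (K ^ 2 * L)) ≤ x / 2 := by
    have hKL : (K : ℝ) ≤ K ^ 2 * L := by nlinarith
    have hLK : L * K ≤ K ^ 2 * L := by nlinarith
    linarith
  calc _ ≤ Real.exp (2 * K) * (Real.exp (2 * L) ^ (2 * K)
        * (2 * Real.exp L ^ (Ω * ((2 * K : ℕ) : ℝ) ^ 2) / Real.exp x)) := by
        gcongr
        exact Real.add_one_le_exp _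
    _ = 2 * Real.exp (2 * K + 4 * (L * K) + 4 * (Ω * (K ^ 2 * L)) - x) := by
        rw [← Real.exp_nat_mul, ← Real.exp_mul, Real.exp_sub, Real.exp_add, Real.exp_add]
        push_cast
        ring_nf
    _ ≤ 2 * Real.exp (-(x / 2)) := by
        gcongr
        linarith

theorem variance_error_le {V : ℝ} {K : ℕ} (hV : 0 ≤ V) (hVK : 2 * V ≤ K) :
    2 * (2 * (Real.exp 1 ^ (2 * K))⁻¹ * Real.exp (Real.exp 1 ^ 2 * V / 4))
      ≤ 4 * Real.exp (-(K : ℝ)) := by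
  have hexp_one : Real.exp 1 ^ 2 ≤ 8 := calc
    Real.exp 1 ^ 2 ≤ 2.8 ^ 2 := by gcongr; linarith [Real.exp_one_lt_d9]
    _ ≤ 8 := by norm_num
  have hVK' : Real.exp 1 ^ 2 * V / 4 ≤ K := by
    linarith [mul_le_mul_of_nonneg_right hexp_one hV]
  calc _ ≤ 2 * (2 * (Real.exp 1 ^ (2 * K))⁻¹ * Real.exp K) := by gcongr
    _ = 4 * Real.exp (-(K : ℝ)) := by
        rw [← Real.exp_nat_mul, ← Real.exp_neg, mul_assoc, ← Real.exp_add]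
        push_cast
        ring_nf

theorem bessel_tail_error_le {ζ G b c : ℝ} (hx : 1 ≤ x) (hζ : 0 ≤ ζ) (hζx : ζ ≤ x) (hG : 0 ≤ G)
    (hxG : x ^ 3 * G ≤ 1) (hb : 0 ≤ b) (hbG : b ≤ G ^ 2) (hc : 0 ≤ c) (hcx : c ≤ x) :
    ζ ^ 2 * (b * (1 + c)) ≤ 2 * G := by
  calc ζ ^ 2 * (b * (1 + c)) ≤ x ^ 2 * (G ^ 2 * (x + x)) := by gcongr
    _ = 2 * (x ^ 3 * G) * G := by ring
    _ ≤ 2 * 1 * G := by gcongr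
    _ = 2 * G := by ring

end ErrorTerms

/-! ### The choice of the parameters -/

/-- The size `exp (-(log T) ^ (θ / 2) / 2)` of the error term, as a function of `x = log T`. -/
noncomputable def errorSize (θ x : ℝ) : ℝ :=
  Real.exp (-(1 / 2) * x ^ (θ / 2))

/-- The number of terms kept in the partial sum of the Lerch zeta-function, about
`exp ((log T) ^ (3 θ / 2))`, as a function of `x = log T`. It is so long that its power
`1 / 2 - σ ≤ -(log T) ^ (-θ)` is at most the square of `errorSize`, and still far below `T`. -/
noncomputable def truncationLength (θ x : ℝ) : ℕ :=
  ⌊Real.exp (x ^ (3 * θ / 2))⌋₊ + 1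

/-- Half the order of the highest moment that is compared with the random model, as a function of
`x = log T`. It exceeds the variance, which is `O(x ^ (2 δ + θ))`, and its square times
`x ^ (3 θ / 2)` is `o(x)`, which is possible because `θ + δ < 1 / 4`. -/
noncomputable def momentDegree (θ δ x : ℝ) : ℕ :=
  ⌈x ^ (2 * δ + 9 * θ / 8)⌉₊

/-- The number `x = log T` is large enough, in terms of `α`, `θ` and `δ`, for all the estimates. No
condition involves `σ₁`, because the threshold for `T` may not depend on it. -/
structure LargeParameter (α Ω θ δ x : ℝ) : Prop where
  admissible : Admissible α
  omega_pos : 0 < Ω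
  theta_pos : 0 < θ
  delta_pos : 0 < δ
  add_lt : θ + δ < 1 / 4
  hasSpacing : HasSpacing α Ω (Real.exp (x ^ (3 * θ / 2)))
  one_le : 1 ≤ x
  two_mul_rpow_delta_le : 2 * x ^ δ ≤ x
  pow_mul_errorSize_le : x ^ 3 * errorSize θ x ≤ 1
  half_mul_rpow_le : 1 / 2 * x ^ (θ / 2) ≤ x / 8
  sq_le_exp : x ^ 2 ≤ Real.exp (x / 8)
  sq_le_exp_rpow : 3 * x ^ 2 ≤ Real.exp (x ^ (3 * θ / 2))
  moment_le : 16 * (Ω + 2) * ((x ^ (2 * δ + 9 * θ / 8)) ^ 2 * x ^ (3 * θ / 2)) ≤ x / 2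
  variance_le : 24 * ((x ^ δ) ^ 2 * x ^ θ) ≤ x ^ (2 * δ + 9 * θ / 8)
  exp_rpow_add_one_le : Real.exp (x ^ (3 * θ / 2)) + 1 ≤ Real.exp x
  inv_le_log_log : α⁻¹ ≤ Real.log (Real.log x)
  log_le_rpow : Real.log x ≤ x ^ θ

theorem eventually_const_mul_rpow_le {p q c d : ℝ} (hpq : p < q) (hd : 0 < d) :
    ∀ᶠ x : ℝ in atTop, c * x ^ p ≤ d * x ^ q := by
  filter_upwards [(tendsto_rpow_atTop (sub_pos.2 hpq)).eventually_ge_atTop (c / d),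
    eventually_gt_atTop 0] with x hx hx_pos
  calc c * x ^ p ≤ d * x ^ (q - p) * x ^ p := by
        gcongr
        exact (div_le_iff₀' hd).1 hx
    _ = d * x ^ q := by rw [mul_assoc, ← Real.rpow_add hx_pos, sub_add_cancel]

theorem eventually_const_mul_pow_le_exp_rpow {p b : ℝ} (hp : 0 < p) (hb : 0 < b) (c : ℝ) (m : ℕ) :
    ∀ᶠ x : ℝ in atTop, c * x ^ m ≤ Real.exp (b * x ^ p) := by
  have hlittle := (isLittleO_rpow_exp_pos_mul_atTop (m / p) hb).bound
    (inv_pos.2 (by positivity : 0 < |c| + 1))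
  filter_upwards [(tendsto_rpow_atTop hp).eventually hlittle, eventually_gt_atTop 0]
    with x hx hx_pos
  rw [← Real.rpow_mul hx_pos.le, mul_div_cancel₀ _ hp.ne', Real.rpow_natCast,
    Real.norm_of_nonneg (by positivity), Real.norm_of_nonneg (by positivity), inv_mul_eq_div,
    le_div_iff₀' (by positivity)] at hx
  refine le_trans ?_ hx
  gcongr
  exact (le_abs_self c).trans (le_add_of_nonneg_right zero_le_one)

theorem eventually_log_rpow_le (p : ℝ) : ∀ᶠ y : ℝ in atTop, Real.log y ^ p ≤ y := by
  have hlittle := (isLittleO_rpow_exp_atTop p).bound one_pos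
  filter_upwards [Real.tendsto_log_atTop.eventually hlittle, eventually_gt_atTop 0] with y hy hy_pos
  rw [Real.exp_log hy_pos, one_mul, Real.norm_of_nonneg hy_pos.le] at hy
  exact (le_abs_self _).trans hy

theorem eventually_exp_rpow_add_one_le {p : ℝ} (hp : p < 1) :
    ∀ᶠ x : ℝ in atTop, Real.exp (x ^ p) + 1 ≤ Real.exp x := by
  filter_upwards [eventually_const_mul_rpow_le (c := 1) hp one_half_pos, eventually_ge_atTop 2]
    with x hx hx_two
  rw [Real.rpow_one] at hx
  have hhalf : 2 ≤ Real.exp (x / 2) := by linarith [Real.add_one_le_exp (x / 2)]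
  have hle : Real.exp (x ^ p) ≤ Real.exp (x / 2) := Real.exp_le_exp.2 (by linarith)
  calc Real.exp (x ^ p) + 1 ≤ Real.exp (x / 2) * Real.exp (x / 2) := by nlinarith
    _ = Real.exp x := by rw [← Real.exp_add, add_halves]

theorem eventually_largeParameter {α Ω X₀ θ δ : ℝ} (hα : Admissible α) (hΩ : 0 < Ω)
    (hspacing : ∀ X, X₀ ≤ X → HasSpacing α Ω X) (hθ : 0 < θ) (hδ : 0 < δ)
    (hθδ : θ + δ < 1 / 4) : ∀ᶠ x in atTop, LargeParameter α Ω θ δ x := by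
  have hlength : Tendsto (fun x : ℝ => Real.exp (x ^ (3 * θ / 2))) atTop atTop :=
    Real.tendsto_exp_atTop.comp (tendsto_rpow_atTop (by linarith))
  filter_upwards [hlength.eventually_ge_atTop X₀, eventually_ge_atTop 1,
    eventually_const_mul_rpow_le (c := 2) (by linarith : δ < 1) one_pos,
    eventually_const_mul_pow_le_exp_rpow (half_pos hθ) one_half_pos 1 3,
    eventually_const_mul_rpow_le (c := 1 / 2) (d := 1 / 8) (by linarith : θ / 2 < 1) (by norm_num),
    eventually_const_mul_pow_le_exp_rpow (b := 1 / 8) one_pos (by norm_num) 1 2,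
    eventually_const_mul_pow_le_exp_rpow (p := 3 * θ / 2) (by linarith) one_pos 3 2,
    eventually_const_mul_rpow_le (p := 2 * (2 * δ + 9 * θ / 8) + 3 * θ / 2) (q := 1)
      (c := 16 * (Ω + 2)) (by linarith) one_half_pos,
    eventually_const_mul_rpow_le (p := 2 * δ + θ) (q := 2 * δ + 9 * θ / 8) (c := 24)
      (by linarith) one_pos,
    eventually_exp_rpow_add_one_le (p := 3 * θ / 2) (by linarith),
    (Real.tendsto_log_atTop.comp Real.tendsto_log_atTop).eventually_ge_atTop α⁻¹,
    (isLittleO_log_rpow_atTop hθ).bound one_pos]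
    with x hX hx_one hdelta herror hhalf hsq hsq_rpow hmoment hvariance hexp hloglog hlog
  have hx_pos : 0 < x := by linarith
  have hrpow_sq (p : ℝ) : (x ^ p) ^ 2 = x ^ (2 * p) := by
    rw [← Real.rpow_mul_natCast hx_pos.le, mul_comm, Nat.cast_ofNat]
  simp only [Real.rpow_one, one_mul] at hdelta herror hhalf hsq hsq_rpow hmoment hvariance
  refine ⟨hα, hΩ, hθ, hδ, hθδ, hspacing _ hX, hx_one, hdelta, ?_, by linarith, ?_, hsq_rpow, ?_, ?_,
    hexp, hloglog, ?_⟩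
  · rwa [errorSize, neg_mul, Real.exp_neg, mul_inv_le_iff₀ (Real.exp_pos _), one_mul]
  · rwa [div_eq_inv_mul, ← one_div]
  · rw [hrpow_sq, ← Real.rpow_add hx_pos]
    linarith
  · rwa [hrpow_sq, ← Real.rpow_add hx_pos]
  · rwa [one_mul, Real.norm_of_nonneg (Real.log_nonneg hx_one),
      Real.norm_of_nonneg (by positivity)] at hlog

theorem Admissible.exists_eventually_largeParameter {α θ δ : ℝ} (hα : Admissible α) (hθ : 0 < θ)
    (hδ : 0 < δ) (hθδ : θ + δ < 1 / 4) : ∃ Ω, ∀ᶠ x in atTop, LargeParameter α Ω θ δ x := by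
  obtain ⟨Ω, hΩ, X₀, hspacing⟩ := hα.spacing
  exact ⟨Ω, eventually_largeParameter hα hΩ hspacing hθ hδ hθδ⟩

theorem inv_rpow_le {α σ a b : ℝ} (hα : 0 < α) (hα1 : α ≤ 1) (hσ : 0 ≤ σ) (hσa : σ ≤ a)
    (hb : α⁻¹ ≤ b) : α ^ (-σ) ≤ b ^ a := by
  have hinv : 1 ≤ α⁻¹ := (one_le_inv₀ hα).2 hα1
  calc α ^ (-σ) = α⁻¹ ^ σ := by rw [Real.rpow_neg hα.le, Real.inv_rpow hα.le]
    _ ≤ b ^ σ := Real.rpow_le_rpow (by positivity) hb hσ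
    _ ≤ b ^ a := Real.rpow_le_rpow_of_exponent_le (hinv.trans hb) hσa

theorem errorSize_pos (θ x : ℝ) : 0 < errorSize θ x :=
  Real.exp_pos _

theorem one_le_truncationLength (θ x : ℝ) : 1 ≤ truncationLength θ x :=
  Nat.le_add_left 1 _

theorem exp_le_truncationLength (θ x : ℝ) : Real.exp (x ^ (3 * θ / 2)) ≤ truncationLength θ x := by
  rw [truncationLength, Nat.cast_add_one]
  exact (Nat.lt_floor_add_one _).le

theorem truncationLength_le (θ x : ℝ) :
    (truncationLength θ x : ℝ) ≤ Real.exp (x ^ (3 * θ / 2)) + 1 := by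
  rw [truncationLength, Nat.cast_add_one]
  gcongr
  exact Nat.floor_le (Real.exp_pos _).le

theorem rpow_le_momentDegree (θ δ x : ℝ) : x ^ (2 * δ + 9 * θ / 8) ≤ momentDegree θ δ x :=
  Nat.le_ceil _

theorem norm_le_two_mul {z : ℂ} {r : ℝ} (hre : |z.re| ≤ r) (him : |z.im| ≤ r) : ‖z‖ ≤ 2 * r := by
  linarith [Complex.norm_le_abs_re_add_abs_im z]

namespace LargeParameter

variable {α Ω θ δ x : ℝ} (hx : LargeParameter α Ω θ δ x)

include hx

theorem pos : 0 < x :=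
  zero_lt_one.trans_le hx.one_le

theorem one_le_rpow : 1 ≤ x ^ (3 * θ / 2) :=
  Real.one_le_rpow hx.one_le (by linarith [hx.theta_pos])

theorem rpow_theta_le : x ^ θ ≤ x := by
  simpa only [Real.rpow_one] using
    Real.rpow_le_rpow_of_exponent_le hx.one_le (by linarith [hx.add_lt, hx.delta_pos] : θ ≤ 1)

theorem exp_neg_le_errorSize : Real.exp (-(x / 8)) ≤ errorSize θ x :=
  Real.exp_le_exp.2 (by linarith [hx.half_mul_rpow_le])

theorem half_lt {σ : ℝ} (hσ : 1 / 2 + x ^ (-θ) ≤ σ) : 1 / 2 < σ := by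
  linarith [Real.rpow_pos_of_pos hx.pos (-θ)]

theorem truncationLength_rpow_le {σ : ℝ} (hσ : 1 / 2 + x ^ (-θ) ≤ σ) :
    (truncationLength θ x : ℝ) ^ (1 / 2 - σ) ≤ errorSize θ x ^ 2 := by
  have hσ_half := hx.half_lt hσ
  calc (truncationLength θ x : ℝ) ^ (1 / 2 - σ)
      ≤ Real.exp (x ^ (3 * θ / 2)) ^ (1 / 2 - σ) :=
        Real.rpow_le_rpow_of_nonpos (Real.exp_pos _) (exp_le_truncationLength θ x) (by linarith)
    _ = Real.exp (x ^ (3 * θ / 2) * (1 / 2 - σ)) := (Real.exp_mul _ _).symm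
    _ ≤ Real.exp (x ^ (3 * θ / 2) * -x ^ (-θ)) := by
        gcongr
        · exact zero_le_one.trans hx.one_le_rpow
        · linarith
    _ = errorSize θ x ^ 2 := by
        rw [errorSize, ← Real.exp_nat_mul, mul_neg, ← Real.rpow_add hx.pos]
        push_cast
        ring_nf

theorem truncationLength_rpow_le' {σ : ℝ} (hσ : 1 / 2 + x ^ (-θ) ≤ σ) :
    (truncationLength θ x : ℝ) ^ (1 - 2 * σ) ≤ errorSize θ x ^ 2 := by
  have hσ_half := hx.half_lt hσ
  refine le_trans ?_ (hx.truncationLength_rpow_le hσ)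
  have : (1 : ℝ) ≤ truncationLength θ x := by exact_mod_cast one_le_truncationLength θ x
  exact Real.rpow_le_rpow_of_exponent_le this (by linarith)

theorem one_div_le_rpow {σ : ℝ} (hσ : 1 / 2 + x ^ (-θ) ≤ σ) : 1 / (2 * σ - 1) ≤ x ^ θ := by
  rw [div_le_iff₀ (by linarith [hx.half_lt hσ])]
  calc (1 : ℝ) = x ^ θ * x ^ (-θ) := by rw [← Real.rpow_add hx.pos, add_neg_cancel, Real.rpow_zero]
    _ ≤ x ^ θ * (2 * σ - 1) := by
        gcongr
        · exact Real.rpow_nonneg hx.pos.le θ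
        · linarith [Real.rpow_pos_of_pos hx.pos (-θ)]

/-- Since neither may `T₀` depend on `σ₁` nor the implied constant on `α`, the bound goes through
`(log log x) ^ (2 σ₁)`: the two parameters are dominated one after the other. -/
theorem rpow_neg_two_mul_le {σ σ₁ : ℝ} (hσ : 1 / 2 + x ^ (-θ) ≤ σ) (hσ₁ : σ ≤ σ₁)
    (hlog : Real.log (Real.log x) ^ (2 * σ₁) ≤ Real.log x) : α ^ (-(2 * σ)) ≤ x ^ θ := by
  have hσ_half := hx.half_lt hσ
  calc α ^ (-(2 * σ)) ≤ Real.log (Real.log x) ^ (2 * σ₁) :=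
        inv_rpow_le hx.admissible.pos hx.admissible.le_one (by linarith) (by linarith)
          hx.inv_le_log_log
    _ ≤ Real.log x := hlog
    _ ≤ x ^ θ := hx.log_le_rpow

theorem momentDegree_le : (momentDegree θ δ x : ℝ) ≤ 2 * x ^ (2 * δ + 9 * θ / 8) := by
  have hone : 1 ≤ x ^ (2 * δ + 9 * θ / 8) :=
    Real.one_le_rpow hx.one_le (by linarith [hx.theta_pos, hx.delta_pos])
  have := Nat.ceil_lt_add_one (zero_le_one.trans hone)
  rw [momentDegree]
  linarith

theorem one_le_momentDegree : 1 ≤ momentDegree θ δ x :=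
  Nat.one_le_ceil_iff.2 (Real.rpow_pos_of_pos hx.pos _)

theorem exp_neg_momentDegree_le : Real.exp (-(momentDegree θ δ x : ℝ)) ≤ errorSize θ x := by
  have hdegree : x ^ (θ / 2) ≤ momentDegree θ δ x := (Real.rpow_le_rpow_of_exponent_le hx.one_le
    (by linarith [hx.theta_pos, hx.delta_pos])).trans (rpow_le_momentDegree θ δ x)
  refine Real.exp_le_exp.2 ?_
  linarith [Real.rpow_nonneg hx.pos.le (θ / 2)]

theorem moment_exponent_le :
    4 * (Ω + 2) * ((momentDegree θ δ x : ℝ) ^ 2 * x ^ (3 * θ / 2)) ≤ x / 2 := by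
  have hΩ := hx.omega_pos
  have hrpow := zero_le_one.trans hx.one_le_rpow
  calc 4 * (Ω + 2) * ((momentDegree θ δ x : ℝ) ^ 2 * x ^ (3 * θ / 2))
      ≤ 4 * (Ω + 2) * ((2 * x ^ (2 * δ + 9 * θ / 8)) ^ 2 * x ^ (3 * θ / 2)) := by
        gcongr
        exact hx.momentDegree_le
    _ = 16 * (Ω + 2) * ((x ^ (2 * δ + 9 * θ / 8)) ^ 2 * x ^ (3 * θ / 2)) := by ring
    _ ≤ x / 2 := hx.moment_le

variable {σ : ℝ} {z : ℂ}

theorem variance_le_momentDegree (hσ : 1 / 2 + x ^ (-θ) ≤ σ) (hασ : α ^ (-(2 * σ)) ≤ x ^ θ)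
    (hz : ‖z‖ ≤ 2 * x ^ δ) :
    2 * (‖z‖ ^ 2 * ∑ n ∈ Finset.range (truncationLength θ x), (((n : ℝ) + α) ^ (-σ)) ^ 2)
      ≤ momentDegree θ δ x := by
  have hsum : ∑ n ∈ Finset.range (truncationLength θ x), (((n : ℝ) + α) ^ (-σ)) ^ 2
      ≤ 3 * x ^ θ := by
    linarith [sum_range_radius_sq_le hx.admissible.pos (hx.half_lt hσ)
      (one_le_truncationLength θ x), hx.one_div_le_rpow hσ,
      Real.one_le_rpow hx.one_le hx.theta_pos.le]
  calc _ ≤ 2 * ((2 * x ^ δ) ^ 2 * (3 * x ^ θ)) := by gcongr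
    _ = 24 * ((x ^ δ) ^ 2 * x ^ θ) := by ring
    _ ≤ x ^ (2 * δ + 9 * θ / 8) := hx.variance_le
    _ ≤ momentDegree θ δ x := rpow_le_momentDegree θ δ x

theorem norm_mean_psi_sum_sub_prod_le (lam : ℝ) (hσ : 1 / 2 + x ^ (-θ) ≤ σ)
    (hασ : α ^ (-(2 * σ)) ≤ x ^ θ) (hz : ‖z‖ ≤ 2 * x ^ δ) :
    ‖(∫ t, psi z (∑ n ∈ Finset.range (truncationLength θ x), lerchTerm lam α (σ + t * I) n)
          ∂(timeMeasure (Real.exp x)))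
        - ∏ n ∈ Finset.range (truncationLength θ x), (besselJ0 (‖z‖ * ((n : ℝ) + α) ^ (-σ)) : ℂ)‖
      ≤ 6 * errorSize θ x := by
  have hα := hx.admissible.pos
  have hσ_half := hx.half_lt hσ
  have hα_le : α ^ (-σ) ≤ x := calc
    α ^ (-σ) ≤ α ^ (-(2 * σ)) :=
      Real.rpow_le_rpow_of_exponent_ge hα hx.admissible.le_one (by linarith)
    _ ≤ x := hασ.trans hx.rpow_theta_le
  have hsum := (sum_rpow_neg_le hα (by linarith) (truncationLength θ x)).trans
    (mul_le_mul_of_nonneg_left hα_le (Nat.cast_nonneg _))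
  have hmean := LerchDensity.norm_mean_psi_sum_sub_prod_le hα hx.admissible.independent
    hx.hasSpacing hx.omega_pos.le (Real.one_le_exp (zero_le_one.trans hx.one_le_rpow))
    (Real.exp_pos x) lam σ (truncationLength_le θ x) (momentDegree θ δ x) (Real.exp_pos 1) z
  have hmoment := moment_error_le hx.one_le_rpow hx.one_le hx.sq_le_exp_rpow hx.one_le_momentDegree
    (truncationLength_le θ x) (norm_nonneg z) (hz.trans hx.two_mul_rpow_delta_le)
    (Finset.sum_nonneg fun n _ => by positivity)
    hsum hx.moment_exponent_le
  have hvariance := variance_error_le (mul_nonneg (by positivity)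
    (Finset.sum_nonneg fun n _ => by positivity)) (hx.variance_le_momentDegree hσ hασ hz)
  have hexp : Real.exp (-(x / 2)) ≤ errorSize θ x :=
    (Real.exp_le_exp.2 (by linarith [hx.pos])).trans hx.exp_neg_le_errorSize
  linarith [hx.exp_neg_momentDegree_le]

theorem norm_mean_psi_lerchZeta_sub_le {lam σ₁ A : ℝ} (hA : IsTruncationConstant lam σ₁ A)
    (hAx : 4 * A ≤ x) (hσ : 1 / 2 + x ^ (-θ) ≤ σ) (hσ₁ : σ ≤ σ₁) (hz : ‖z‖ ≤ 2 * x ^ δ) :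
    ‖(∫ t, psi z (lerchZeta lam α (σ + t * I)) ∂(timeMeasure (Real.exp x)))
        - ∫ t, psi z (∑ n ∈ Finset.range (truncationLength θ x), lerchTerm lam α (σ + t * I) n)
          ∂(timeMeasure (Real.exp x))‖ ≤ 29 * errorSize θ x := by
  have hlength : truncationLength θ x ≤ ⌈A * Real.exp x⌉₊ := by
    have : (truncationLength θ x : ℝ) ≤ ⌈A * Real.exp x⌉₊ := calc
      (truncationLength θ x : ℝ) ≤ Real.exp x :=
        (truncationLength_le θ x).trans hx.exp_rpow_add_one_le
      _ ≤ A * Real.exp x := le_mul_of_one_le_left (Real.exp_pos _).le hA.one_le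
      _ ≤ ⌈A * Real.exp x⌉₊ := Nat.le_ceil _
    exact_mod_cast this
  have hx_pos := hx.pos
  exact (LerchDensity.norm_mean_psi_lerchZeta_sub_le hA hx.admissible.pos hx.admissible.le_one
    (hx.half_lt hσ).le hσ₁ (Real.one_le_exp (by linarith)) (Real.exp_le_exp.2 (by linarith))
    (one_le_truncationLength θ x) hlength (Nat.le_ceil _) z).trans
    (truncation_error_le hA.one_le hAx (hz.trans hx.two_mul_rpow_delta_le) hx.exp_neg_le_errorSize
      hx.sq_le_exp hx.pow_mul_errorSize_le (hx.truncationLength_rpow_le hσ))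

theorem norm_prod_sub_besselProduct_le (hσ : 1 / 2 + x ^ (-θ) ≤ σ) (hz : ‖z‖ ≤ 2 * x ^ δ) :
    ‖∏ n ∈ Finset.range (truncationLength θ x), (besselJ0 (‖z‖ * ((n : ℝ) + α) ^ (-σ)) : ℂ)
        - besselProduct σ α z‖ ≤ 2 * errorSize θ x := by
  have hσ_half := hx.half_lt hσ
  rw [norm_sub_rev]
  exact (norm_besselProduct_sub_prod_le hx.admissible.pos hσ_half
    (one_le_truncationLength θ x) z).trans
    (bessel_tail_error_le hx.one_le (norm_nonneg z) (hz.trans hx.two_mul_rpow_delta_le)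
      (errorSize_pos θ x).le hx.pow_mul_errorSize_le (by positivity)
      (hx.truncationLength_rpow_le' hσ) (one_div_nonneg.2 (by linarith))
      ((hx.one_div_le_rpow hσ).trans hx.rpow_theta_le))

theorem norm_mean_psi_sub_fourierM_le {lam σ₁ A : ℝ} (hA : IsTruncationConstant lam σ₁ A)
    (hAx : 4 * A ≤ x) (hlog : Real.log (Real.log x) ^ (2 * σ₁) ≤ Real.log x)
    (hσ : 1 / 2 + x ^ (-θ) ≤ σ) (hσ₁ : σ ≤ σ₁) (hz : ‖z‖ ≤ 2 * x ^ δ) :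
    ‖(∫ t, psi z (lerchZeta lam α (σ + t * I)) ∂(timeMeasure (Real.exp x))) - fourierM σ α z‖
      ≤ 37 * errorSize θ x := by
  have htrunc := hx.norm_mean_psi_lerchZeta_sub_le hA hAx hσ hσ₁ hz
  have hmean := hx.norm_mean_psi_sum_sub_prod_le lam hσ (hx.rpow_neg_two_mul_le hσ hσ₁ hlog) hz
  have htail := hx.norm_prod_sub_besselProduct_le hσ hz
  rw [fourierM_eq_besselProduct hx.admissible.pos (hx.half_lt hσ)]
  refine (norm_sub_le_norm_sub_add_norm_sub _ _ _).trans ((add_le_add htrunc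
    ((norm_sub_le_norm_sub_add_norm_sub _ _ _).trans (add_le_add hmean htail))).trans_eq ?_)
  ring

end LargeParameter

theorem norm_besselProduct_le_one {σ α : ℝ} (hα : 0 < α) (hσ : 1 / 2 < σ) (z : ℂ) :
    ‖besselProduct σ α z‖ ≤ 1 := by
  refine le_of_tendsto (hasProd_besselProduct hα hσ z).tendsto_prod_nat.norm
    (Eventually.of_forall fun N => ?_)
  rw [norm_prod]
  exact Finset.prod_le_one (fun _ _ => norm_nonneg _) fun _ _ => norm_besselJ0_le_one _

theorem norm_integral_psi_le_one {S : Type*} [MeasurableSpace S] (μ : Measure S)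
    [IsProbabilityMeasure μ] (z : ℂ) (f : S → ℂ) : ‖∫ s, psi z (f s) ∂μ‖ ≤ 1 := by
  simpa using norm_integral_le_of_norm_le_const (μ := μ)
    (Eventually.of_forall fun s => (norm_psi z (f s)).le)

theorem norm_mean_psi_sub_fourierM_le_two {α σ T : ℝ} (hα : 0 < α) (hσ : 1 / 2 < σ) (hT : 0 < T)
    (f : ℝ → ℂ) (z : ℂ) : ‖(∫ t, psi z (f t) ∂(timeMeasure T)) - fourierM σ α z‖ ≤ 2 := by
  have := isProbabilityMeasure_timeMeasure hT
  rw [fourierM_eq_besselProduct hα hσ]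
  refine (norm_sub_le _ _).trans ?_
  linarith [norm_integral_psi_le_one (timeMeasure T) z f, norm_besselProduct_le_one hα hσ z]

theorem one_le_exp_mul_errorSize {θ x y : ℝ} (hθ : θ ≤ 2) (hx : 1 ≤ x) (hxy : x ≤ y) :
    1 ≤ Real.exp (1 / 2 * y) * errorSize θ x := by
  have hrpow : x ^ (θ / 2) ≤ x := by
    simpa only [Real.rpow_one] using
      Real.rpow_le_rpow_of_exponent_le hx (by linarith : θ / 2 ≤ 1)
  rw [errorSize, ← Real.exp_add]
  exact Real.one_le_exp (by linarith)

/-- The estimate is proved for `x ≥ x₁`, where `x₁` depends on `lam` and `σ₁` only; for smaller `x`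
it is trivial, because the error term is bounded below in terms of `x₁`. -/
theorem exists_norm_mean_psi_sub_fourierM_le (lam σ₁ : ℝ) :
    ∃ C, ∀ {α Ω θ δ x σ : ℝ} {z : ℂ}, LargeParameter α Ω θ δ x → 1 / 2 + x ^ (-θ) ≤ σ → σ ≤ σ₁ →
      ‖z‖ ≤ 2 * x ^ δ →
      ‖(∫ t, psi z (lerchZeta lam α (σ + t * I)) ∂(timeMeasure (Real.exp x))) - fourierM σ α z‖
        ≤ C * errorSize θ x := by
  obtain ⟨A, hA⟩ := exists_isTruncationConstant lam σ₁
  obtain ⟨x₁, hx₁⟩ := eventually_atTop.1 ((eventually_ge_atTop (4 * A)).and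
    (Real.tendsto_log_atTop.eventually (eventually_log_rpow_le (2 * σ₁))))
  refine ⟨37 + 2 * Real.exp (1 / 2 * x₁), fun {α Ω θ δ x σ z} hx hσ hσ₁ hz => ?_⟩
  have hpos := errorSize_pos θ x
  rw [add_mul]
  rcases le_total x₁ x with hlarge | hsmall
  · exact (hx.norm_mean_psi_sub_fourierM_le hA (hx₁ x hlarge).1 (hx₁ x hlarge).2 hσ hσ₁ hz).trans
      (le_add_of_nonneg_right (by positivity))
  · refine (norm_mean_psi_sub_fourierM_le_two hx.admissible.pos (hx.half_lt hσ) (Real.exp_pos x) _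
      z).trans (le_add_of_nonneg_of_le (by positivity) ?_)
    linarith [one_le_exp_mul_errorSize (by linarith [hx.add_lt, hx.delta_pos] : θ ≤ 2) hx.one_le
      hsmall]

theorem exists_largeParameter_threshold (α θ δ : ℝ) :
    ∃ T₀, 0 < T₀ ∧ (Admissible α → 0 < θ → 0 < δ → θ + δ < 1 / 4 →
      ∃ Ω, ∀ T, T₀ ≤ T → LargeParameter α Ω θ δ (Real.log T)) := by
  by_cases h : Admissible α ∧ 0 < θ ∧ 0 < δ ∧ θ + δ < 1 / 4
  · obtain ⟨hα, hθ, hδ, hθδ⟩ := h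
    obtain ⟨Ω, hΩ⟩ := hα.exists_eventually_largeParameter hθ hδ hθδ
    obtain ⟨T₀, hT₀⟩ := eventually_atTop.1
      ((Real.tendsto_log_atTop.eventually hΩ).and (eventually_gt_atTop 0))
    exact ⟨T₀, (hT₀ T₀ le_rfl).2, fun _ _ _ _ => ⟨Ω, fun T hT => (hT₀ T hT).1⟩⟩
  · exact ⟨1, one_pos, fun hα hθ hδ hθδ => absurd ⟨hα, hθ, hδ, hθδ⟩ h⟩

end LerchDensity

/-- The first conjunct says that `M_σ(·; α)` is the density of the infinite convolution and that its
Fourier transform is the product of Bessel functions. In the second one the implied constant `C`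
depends only on `lam` and `σ₁`, and `T₀` depends only on `α`, `θ` and `δ`. -/
theorem mainTheorem4 :
    (∀ α σ : ℝ, 0 < α → α ≤ 1 → 1 / 2 < σ →
      LerchDensity.IsLimitDensity σ α (LerchDensity.densityM σ α) ∧
      ∀ z : ℂ, HasProd
        (fun n : ℕ => (LerchDensity.besselJ0 (‖z‖ * ((n : ℝ) + α) ^ (-σ)) : ℂ))
        (LerchDensity.fourierM σ α z)) ∧
    ∃ (C : ℝ → ℝ → ℝ) (T₀ : ℝ → ℝ → ℝ → ℝ),
      ∀ lam α σ₁ θ δ : ℝ, LerchDensity.Admissible α → 0 < σ₁ → 0 < θ → 0 < δ → θ + δ < 1 / 4 →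
        0 < T₀ α θ δ ∧
        ∀ T : ℝ, T₀ α θ δ ≤ T →
        ∀ σ : ℝ, 1 / 2 + (Real.log T) ^ (-θ) ≤ σ → σ ≤ σ₁ →
        ∀ z : ℂ, |z.re| ≤ (Real.log T) ^ δ → |z.im| ≤ (Real.log T) ^ δ →
          ‖((1 / T : ℝ) : ℂ) * (∫ t in (0 : ℝ)..T,
              LerchDensity.psi z
                (LerchDensity.lerchZeta lam α ((σ : ℂ) + (t : ℂ) * Complex.I)))
            - LerchDensity.fourierM σ α z‖
          ≤ C lam σ₁ * Real.exp (-(1 / 2) * (Real.log T) ^ (θ / 2)) := by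
  refine ⟨fun α σ hα _ hσ => ⟨LerchDensity.isLimitDensity_densityM hα hσ, fun z => ?_⟩, ?_⟩
  · rw [LerchDensity.fourierM_eq_besselProduct hα hσ]
    exact LerchDensity.hasProd_besselProduct hα hσ z
  choose C hC using LerchDensity.exists_norm_mean_psi_sub_fourierM_le
  choose T₀ hT₀ hthreshold using LerchDensity.exists_largeParameter_threshold
  refine ⟨C, T₀, fun lam α σ₁ θ δ hα _ hθ hδ hθδ => ⟨hT₀ α θ δ, ?_⟩⟩
  intro T hT σ hσ hσ₁ z hre him
  have hT_pos : 0 < T := (hT₀ α θ δ).trans_le hT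
  obtain ⟨Ω, hlarge⟩ := hthreshold α θ δ hα hθ hδ hθδ
  have hmean := hC lam σ₁ (hlarge T hT) hσ hσ₁ (LerchDensity.norm_le_two_mul hre him)
  rwa [Real.exp_log hT_pos, LerchDensity.integral_timeMeasure hT_pos] at hmean
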